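/- Let either (1) $R$ be a regular local ring with maximal ideal $\mathfrak m$, minimally generated by $x_1,\dots,x_m$ ($m=\dim R$), or (2) $R=k[x_1,\dots,x_m]$ be a standard graded polynomial ring over a field, $\mathfrak m=(x_1,\dots,x_m)$. Put $k=R/\mathfrak m$ and let $K_\bullet$ be the Koszul complex on $x_1,\dots,x_m$. Let $F$ be a free $R$-module with basis $f_1,\dots,f_n$, and let $\psi:F\to R$ be a linear map such that $\psi(f_1),\dots,\psi(f_n)$ is a regular sequence, in case (2) consisting of homogeneous elements of positive degree. Let $w\in\mathbb N^n$ and $d\ge 1$. For $\alpha\in\mathbb N^n$ put $|\alpha|=\sum_j\alpha_j$ and $\psi(f^\alpha)=\prod_j\psi(f_j)^{\alpha_j}$, and let $I=(\operatorname{im}\psi)^d_w$ be the ideal generated by the $\psi(f^\alpha)$ with $|\alpha|=d$, $\alpha\le w$. Let $S=\operatorname{Sym}(F)$ and let $(\bigwedge^a F\otimes S_b)_w$ be the span of the $f_\sigma\otimes f^\alpha$ with $|\sigma|=a$, $|\alpha|=b$ and $\sum_{j\in\sigma}\epsilon_j+\alpha\le w$. Let $\kappa:(\bigwedge^{a}F\otimes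 S_b)_w\to(\bigwedge^{a-1}F\otimes S_{b+1})_w$ be the tautological Koszul map $f_\sigma\otimes s\mapsto\sum_{j\in\sigma}\pm f_{\sigma\setminus j}\otimes f_js$, and $L^a_{b,w}=\ker\kappa$ (so $L^0_{b,w}=(S_b)_w$). Let $L^w(\psi,d)$ be the complex with $R$ in degree $0$ and $L^{a}_{d,w}$ in degree $a+1$, with differentials induced by the Koszul differential of $\psi$ on $\bigwedge F$, the last one being $(S_d)_w\to R$, $f^\alpha\mapsto\psi(f^\alpha)$. A lift of the Koszul complex $\bigwedge^\bullet F$ of $\psi$ is a morphism of complexes $\bigwedge^\bullet F\to K_\bullet$ that is the identity of $R$ in degree $0$; write $z_\sigma\in K_{|\sigma|}$ for the image of $f_\sigma$. Then: (a) The differential of $L^w(\psi,d)\otimes_R k$ is zero, and a lift $f_\sigma\mapsto z_\sigma$ exists. For every lift and every $a\ge0$ there is exactly one isomorphism of $R$-modules $L^{a}_{d,w}\otimes_R k\to H_{a+1}(R/I\otimes_R K_\bullet)$ such that $\kappa(f_\sigma\otimes f^\alpha)\otimes 1\mapsto[\psi(f^\alpha)z_\sigma]$ for all $f_\sigma\otimes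 f^\alpha\in(\bigwedge^{a+1}F\otimes S_{d-1})_w$ (in particular the elements $\psi(f^\alpha)z_\sigma$ are cycles), and in degree $0$ there is exactly one isomorphism $R\otimes_R k\to H_0(R/I\otimes_R K_\bullet)$ with $1\otimes 1\mapsto[1]$. Thus $L^w(\psi,d)\otimes k\cong H_\bullet(R/I\otimes_R K_\bullet)$. (b) For every lift and every $i\ge1$, the classes $[\psi(f^\alpha)z_\sigma]$ with $|\sigma|=i$, $|\alpha|=d-1$, $\sum_{j\in\sigma}\epsilon_j+\alpha\le w$ and $\min\sigma\le s$ for every $s$ with $\alpha_s>0$ form a $k$-basis of $H_i(R/I\otimes_R K_\bullet)$. (c) If $d\ge2$, then for every lift the product of any two of the cycles $\psi(f^\alpha)z_\sigma$ with $f_\sigma\otimes f^\alpha\in(\bigwedge^{i}F\otimes S_{d-1})_w$, $i\ge1$, is zero in the homology of $R/I\otimes_R K_\bullet$, and $R/I$ is a Golod ring, i.e. the Koszul complex of $R/I$ on any minimal system of generators of its maximal ideal (in case (2): minimal homogeneous generators of its homogeneous maximal ideal) admits a trivial Massey operation: there are a homogeneous $k$-basis $\mathcal B$ of its homology in positive degrees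 and a function $\mu$ from the nonempty words in $\mathcal B$ to the Koszul complex, with $\mu(h_1,\dots,h_p)$ homogeneous of degree $\sum_j|h_j|+p-1$, such that $\mu(h)$ is a cycle of class $h$ for $h\in\mathcal B$ and, for $p\ge2$, $d\mu(h_1,\dots,h_p)=\sum_{j=1}^{p-1}(-1)^{|\mu(h_1,\dots,h_j)|+1}\mu(h_1,\dots,h_j)\,\mu(h_{j+1},\dots,h_p)$. -/

import Mathlib

open scoped TensorProduct

universe u v

noncomputable section

namespace RestrictedPower

/-! ### Koszul complexes and Koszul homology -/

section Koszul

variable {R : Type u} [CommRing R] {M : Type v} [AddCommGroup M] [Module R M]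

theorem contractLeft_mem (φ : Module.Dual R M) (i : ℕ) {u : ExteriorAlgebra R M}
    (hu : u ∈ ⋀[R]^(i + 1) M) :
    CliffordAlgebra.contractLeft φ u ∈ ⋀[R]^i M := by
  induction i generalizing u with
  | zero =>
    have hu' : u ∈ LinearMap.range (ExteriorAlgebra.ι R (M := M)) := by
      simpa [ExteriorAlgebra.exteriorPower] using hu
    obtain ⟨v, rfl⟩ := hu'
    rw [CliffordAlgebra.contractLeft_ι]
    simp [ExteriorAlgebra.exteriorPower, Submodule.mem_one]
  | succ i ih =>
    rw [ExteriorAlgebra.exteriorPower, pow_succ'] at hu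
    induction hu using Submodule.mul_induction_on' with
    | mem_mul_mem a ha b hb =>
      obtain ⟨v, rfl⟩ := ha
      rw [CliffordAlgebra.contractLeft_ι_mul]
      refine Submodule.sub_mem _ (Submodule.smul_mem _ _ hb) ?_
      rw [ExteriorAlgebra.exteriorPower, pow_succ']
      exact Submodule.mul_mem_mul ⟨v, rfl⟩ (ih hb)
    | add a _ b _ h1 h2 =>
      rw [map_add]
      exact Submodule.add_mem _ h1 h2

/-- The Koszul differential `⋀^(i+1) M → ⋀^i M` of a linear form `φ : M → R`:
`v₀ ∧ ⋯ ∧ vᵢ ↦ ∑ⱼ (-1)^j φ(vⱼ) v₀ ∧ ⋯ (omit vⱼ) ⋯ ∧ vᵢ`. -/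
def koszulD (φ : Module.Dual R M) (i : ℕ) : ⋀[R]^(i + 1) M →ₗ[R] ⋀[R]^i M :=
  (CliffordAlgebra.contractLeft φ).restrict fun _ hu => contractLeft_mem φ i hu

/-- The unit `1 ∈ ⋀^0 M`. -/
def unit₀ (R : Type u) [CommRing R] (M : Type v) [AddCommGroup M] [Module R M] : ⋀[R]^0 M :=
  (exteriorPower.zeroEquiv R M).symm 1

variable (φ : Module.Dual R M) (N : Type*) [AddCommGroup N] [Module R N]

/-- The cycles of degree `i` in `N ⊗ ⋀ M`. -/
def koszulCycles : (i : ℕ) → Submodule R (N ⊗[R] ⋀[R]^i M)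
  | 0 => ⊤
  | i + 1 => LinearMap.ker ((koszulD φ i).lTensor N)

/-- The boundaries of degree `i` in `N ⊗ ⋀ M`. -/
def koszulBoundaries (i : ℕ) : Submodule R (N ⊗[R] ⋀[R]^i M) :=
  LinearMap.range ((koszulD φ i).lTensor N)

/-- The homology in degree `i` of the complex `N ⊗ ⋀ M` with differential induced by `φ`. -/
abbrev KoszulHomology (i : ℕ) : Type _ :=
  koszulCycles φ N i ⧸ (koszulBoundaries φ N i).submoduleOf (koszulCycles φ N i)

variable {N}

/-- `z` is a cycle, and `h` is its homology class. -/
def IsClassOf {i : ℕ} (z : N ⊗[R] ⋀[R]^i M) (h : KoszulHomology φ N i) : Prop :=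
  ∃ hz : z ∈ koszulCycles φ N i, h = Submodule.Quotient.mk ⟨z, hz⟩

end Koszul

/-- The linear form on `R^m` with `e_i ↦ x_i`; its Koszul complex is the Koszul complex on
`x_1, …, x_m`. -/
abbrev formOf {R : Type u} [CommRing R] {m : ℕ} (x : Fin m → R) : Module.Dual R (Fin m → R) :=
  Fintype.linearCombination R x

/-- The `R`-module `H` is annihilated by `𝔪`, and the family `v` is a basis of `H` over `R/𝔪`. -/
structure IsResidueBasis {R : Type*} [CommRing R] (𝔪 : Ideal R) {H : Type*} [AddCommGroup H]
    [Module R H] {ι : Type*} (v : ι → H) : Prop where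
  annihilated : ∀ r ∈ 𝔪, ∀ h : H, r • h = 0
  span_eq_top : Submodule.span R (Set.range v) = ⊤
  independent : ∀ c : ι →₀ R, Finsupp.linearCombination R v c = 0 → ∀ i, c i ∈ 𝔪

/-! ### Trivial Massey operations and Golod rings -/

/-- The homological degree of `μ(h_1, …, h_p)`, that is `|h_1| + ⋯ + |h_p| + p - 1`. -/
def masseyDegree {Λ : Type} (deg : Λ → ℕ) (l : List Λ) : ℕ :=
  (l.map deg).sum + (l.length - 1)

/-- The Koszul complex on `y_1, …, y_m`, as a DG algebra, admits a trivial Massey operation: there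
are a homogeneous basis `(h_λ)` of its homology in positive degrees over `Q/(y_1, …, y_m)`, with
`deg λ = |h_λ|`, and a function `μ` on the nonempty words in the `h_λ` such that `μ(h_λ)` is a cycle
of class `h_λ` and
`d μ(h_1, …, h_p) = ∑_{j=1}^{p-1} (-1)^(|μ(h_1, …, h_j)|+1) μ(h_1, …, h_j) μ(h_{j+1}, …, h_p)`. -/
def AdmitsTrivialMasseyOperation {Q : Type u} [CommRing Q] {m : ℕ} (y : Fin m → Q) : Prop :=
  ∃ (Λ : Type) (deg : Λ → ℕ) (μ : List Λ → ExteriorAlgebra Q (Fin m → Q)),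
    (∀ l : Λ, 1 ≤ deg l) ∧
    (∀ l : List Λ, l ≠ [] → μ l ∈ ⋀[Q]^(masseyDegree deg l) (Fin m → Q)) ∧
    (∀ i : ℕ, 1 ≤ i → ∃ h : {l : Λ // deg l = i} → KoszulHomology (formOf y) Q i,
      (∀ l, ∃ z : ⋀[Q]^i (Fin m → Q), (z : ExteriorAlgebra Q (Fin m → Q)) = μ [l.1] ∧
        IsClassOf (formOf y) ((1 : Q) ⊗ₜ[Q] z) (h l)) ∧
      IsResidueBasis (Ideal.span (Set.range y)) h) ∧
    (∀ l : List Λ, 2 ≤ l.length →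
      CliffordAlgebra.contractLeft (formOf y) (μ l) =
        ∑ j ∈ Finset.Ico 1 l.length,
          (-1 : Q) ^ (masseyDegree deg (l.take j) + 1) • (μ (l.take j) * μ (l.drop j)))

/-- A Noetherian local ring is Golod if the Koszul complex on minimal generators of its maximal
ideal admits a trivial Massey operation. -/
structure IsGolodRing (Q : Type u) [CommRing Q] : Prop extends
    IsLocalRing Q, IsNoetherianRing Q where
  massey : ∀ (m : ℕ) (y : Fin m → Q),
    Ideal.span (Set.range y) = IsLocalRing.maximalIdeal Q →
    m = (IsLocalRing.maximalIdeal Q).spanFinrank →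
    AdmitsTrivialMasseyOperation y

/-- The ideal generated by the homogeneous elements of positive degree. -/
def irrelevantIdeal {k : Type*} {Q : Type*} [Field k] [CommRing Q] [Algebra k Q]
    (𝒬 : ℕ → Submodule k Q) : Ideal Q :=
  Ideal.span {q | ∃ D : ℕ, 0 < D ∧ q ∈ 𝒬 D}

/-- The graded version of the Golod property for a positively graded `k`-algebra `Q`: the Koszul
complex on minimal homogeneous generators of the homogeneous maximal ideal admits a trivial Massey
operation. -/
def IsGradedGolodRing {k : Type*} {Q : Type*} [Field k] [CommRing Q] [Algebra k Q]
    (𝒬 : ℕ → Submodule k Q) : Prop :=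
  ∀ (m : ℕ) (y : Fin m → Q), (∀ i, ∃ D : ℕ, 0 < D ∧ y i ∈ 𝒬 D) →
    Ideal.span (Set.range y) = irrelevantIdeal 𝒬 →
    m = (irrelevantIdeal 𝒬).spanFinrank →
    AdmitsTrivialMasseyOperation y

/-- The grading that a quotient of the standard graded polynomial ring inherits. -/
def quotientGrading {k : Type*} [Field k] {m : ℕ} (I : Ideal (MvPolynomial (Fin m) k)) (D : ℕ) :
    Submodule k (MvPolynomial (Fin m) k ⧸ I) :=
  (MvPolynomial.homogeneousSubmodule (Fin m) k D).map (Ideal.Quotient.mkₐ k I).toLinearMap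

/-! ### Restricted powers and the complexes `L^w(ψ, d)`

`F` is a free module with basis `f_1, …, f_n`; its symmetric algebra is `R[X_1, …, X_n]`, with
`f^α` the monomial `X^α`. -/

section Restricted

variable {R : Type u} [CommRing R] {F : Type v} [AddCommGroup F] [Module R F] {n : ℕ}

/-- `ψ(f^α) = ψ(f_1)^{α_1} ⋯ ψ(f_n)^{α_n}`. -/
def psiPow (f : Module.Basis (Fin n) R F) (ψ : Module.Dual R F) (α : Fin n →₀ ℕ) : R :=
  ∏ j, ψ (f j) ^ α j

/-- The `w`-restricted `d`th power of `im ψ`. -/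
def restrictedPower (f : Module.Basis (Fin n) R F) (ψ : Module.Dual R F) (w : Fin n → ℕ) (d : ℕ) :
    Ideal R :=
  Ideal.span {r | ∃ α : Fin n →₀ ℕ, (∀ j, α j ≤ w j) ∧ α.degree = d ∧ r = psiPow f ψ α}

/-- `f_σ = f_{σ_1} ∧ ⋯ ∧ f_{σ_a}` for `σ = {σ_1 < ⋯ < σ_a}`. -/
def wedge (f : Module.Basis (Fin n) R F) {a : ℕ} (σ : Set.powersetCard (Fin n) a) : ⋀[R]^a F :=
  exteriorPower.ιMulti_family R a f σ

/-- `mdeg (f_σ ⊗ f^α) ≤ w`. -/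
def MultidegreeLE (w : Fin n → ℕ) {a : ℕ} (σ : Set.powersetCard (Fin n) a) (α : Fin n →₀ ℕ) :
    Prop :=
  ∀ j, (if j ∈ (σ : Finset (Fin n)) then 1 else 0) + α j ≤ w j

/-- `f_σ ⊗ f^α`. -/
def wedgeMonomial (f : Module.Basis (Fin n) R F) {a : ℕ} (σ : Set.powersetCard (Fin n) a)
    (α : Fin n →₀ ℕ) : ⋀[R]^a F ⊗[R] MvPolynomial (Fin n) R :=
  wedge f σ ⊗ₜ[R] MvPolynomial.monomial α 1

/-- `(⋀^a ⊗ S_b)_w`. -/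
def restrictedTerm (f : Module.Basis (Fin n) R F) (w : Fin n → ℕ) (a b : ℕ) :
    Submodule R (⋀[R]^a F ⊗[R] MvPolynomial (Fin n) R) :=
  Submodule.span R {u | ∃ (σ : Set.powersetCard (Fin n) a) (α : Fin n →₀ ℕ),
    α.degree = b ∧ MultidegreeLE w σ α ∧ u = wedgeMonomial f σ α}

/-- The tautological Koszul differential `κ : ⋀^(a+1) ⊗ S → ⋀^a ⊗ S`,
`f_σ ⊗ s ↦ ∑_{j ∈ σ} ± f_{σ ∖ j} ⊗ f_j s`. -/
def kappa (f : Module.Basis (Fin n) R F) (a : ℕ) :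
    ⋀[R]^(a + 1) F ⊗[R] MvPolynomial (Fin n) R →ₗ[R] ⋀[R]^a F ⊗[R] MvPolynomial (Fin n) R :=
  ∑ j, TensorProduct.map (koszulD (f.coord j) a) (LinearMap.mulLeft R (MvPolynomial.X j))

/-- `L^a_{b,w} = ker (κ : (⋀^a ⊗ S_b)_w → (⋀^(a-1) ⊗ S_(b+1))_w)`. The complex `L^w(ψ, d)` has
`R` in degree `0` and `L^a_{d,w}` in degree `a + 1`. -/
def LTerm (f : Module.Basis (Fin n) R F) (w : Fin n → ℕ) (b : ℕ) :
    (a : ℕ) → Submodule R (⋀[R]^a F ⊗[R] MvPolynomial (Fin n) R)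
  | 0 => restrictedTerm f w 0 b
  | a + 1 => restrictedTerm f w (a + 1) b ⊓ LinearMap.ker (kappa f a)

/-- The map `Kos ⊗ 1`, which induces the differential `L^(a+1)_{d,w} → L^a_{d,w}` of
`L^w(ψ, d)`. -/
def kosTensor (ψ : Module.Dual R F) (n a : ℕ) :
    ⋀[R]^(a + 1) F ⊗[R] MvPolynomial (Fin n) R →ₗ[R] ⋀[R]^a F ⊗[R] MvPolynomial (Fin n) R :=
  (koszulD ψ a).rTensor (MvPolynomial (Fin n) R)

/-- The map `⋀^0 ⊗ S = S → R`, `f^α ↦ ψ(f^α)`, which induces the last differential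
`L^0_{d,w} = (S_d)_w → R` of `L^w(ψ, d)`. -/
def augmentation (f : Module.Basis (Fin n) R F) (ψ : Module.Dual R F) :
    ⋀[R]^0 F ⊗[R] MvPolynomial (Fin n) R →ₗ[R] R :=
  (TensorProduct.lid R R).toLinearMap ∘ₗ
    TensorProduct.map (exteriorPower.zeroEquiv R F).toLinearMap
      (MvPolynomial.aeval fun j => ψ (f j)).toLinearMap

/-- A lift of the Koszul complex `⋀ F` of `ψ` to the Koszul complex `K = ⋀ G` of `φ`: a morphism of
complexes that is the identity of `R` in degree `0`. With `z_σ = lift (f_σ)`, it amounts to elements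
`z_σ ∈ K` with `z_∅ = 1` and `d z_σ = ∑_{r ∈ σ} ± ψ(f_r) z_{σ ∖ r}`. -/
structure KoszulLift {G : Type*} [AddCommGroup G] [Module R G]
    (ψ : Module.Dual R F) (φ : Module.Dual R G) where
  lift : (i : ℕ) → ⋀[R]^i F →ₗ[R] ⋀[R]^i G
  lift_zero : lift 0 (unit₀ R F) = unit₀ R G
  comm : ∀ i, koszulD φ i ∘ₗ lift (i + 1) = lift i ∘ₗ koszulD ψ i

/-- `ψ(f^α) φ^i_i(f_σ) = ψ(f^α) z_σ`, an element of the Koszul complex `K` on `x`. -/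
def liftedElement (f : Module.Basis (Fin n) R F) (ψ : Module.Dual R F) {m : ℕ} {x : Fin m → R}
    (ℓ : KoszulLift ψ (formOf x)) {i : ℕ} (σ : Set.powersetCard (Fin n) i) (α : Fin n →₀ ℕ) :
    ⋀[R]^i (Fin m → R) :=
  psiPow f ψ α • ℓ.lift i (wedge f σ)

/-- The index set of the semistandard hook tableaux with column `σ`, `|σ| = i`, with `α` the
content of the rest of the first row, `|α| + 1 = d`, and with multidegree at most `w`: the smallest
entry of `σ` is at most every entry of the first row. -/
def StandardPair (n : ℕ) (w : Fin n → ℕ) (d i : ℕ) : Type :=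
  {p : Set.powersetCard (Fin n) i × (Fin n →₀ ℕ) //
    p.2.degree + 1 = d ∧ MultidegreeLE w p.1 p.2 ∧
      ∀ s ∈ p.2.support, ∃ r ∈ (p.1 : Finset (Fin n)), r ≤ s}

/-- The description of the Koszul homology of `R/(im ψ)^d_w` with respect to `K`, the Koszul
complex on `x`, with `𝔪 = (x_1, …, x_m)` and `k = R/𝔪`. -/
structure KoszulHomologyDescription (f : Module.Basis (Fin n) R F) (ψ : Module.Dual R F)
    (w : Fin n → ℕ) (d : ℕ) {m : ℕ} (x : Fin m → R) : Prop where
  /-- The last differential of `L^w(ψ, d) ⊗ k` vanishes. -/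
  minimal_zero : (LTerm f w d 0).map (augmentation f ψ) ≤ Ideal.span (Set.range x)
  /-- `Kos ⊗ 1` maps `L^(a+1)_{d,w}` into `L^a_{d,w}`, and it vanishes after tensoring with `k`. -/
  minimal : ∀ a : ℕ, (LTerm f w d (a + 1)).map (kosTensor ψ n a) ≤
    Ideal.span (Set.range x) • LTerm f w d a
  /-- The elements `z_σ` exist. -/
  exists_lift : Nonempty (KoszulLift ψ (formOf x))
  /-- In degree `0` the isomorphism is given by `1 ⊗ 1 ↦ [1]`. -/
  iso_zero : ∃! e : ((R ⧸ Ideal.span (Set.range x)) ⊗[R] R) ≃ₗ[R]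
      KoszulHomology (formOf x) (R ⧸ restrictedPower f ψ w d) 0,
    IsClassOf (formOf x) (1 ⊗ₜ[R] unit₀ R (Fin m → R)) (e (1 ⊗ₜ[R] 1))
  /-- In degree `a + 1` the isomorphism is given by
  `1 ⊗ κ(f_σ ⊗ f^α) ↦ [ψ(f^α) z_σ]` for `f_σ ⊗ f^α ∈ (⋀^(a+1) ⊗ S_(d-1))_w`. -/
  iso : ∀ (ℓ : KoszulLift ψ (formOf x)) (a : ℕ),
    ∃! e : ((R ⧸ Ideal.span (Set.range x)) ⊗[R] LTerm f w d a) ≃ₗ[R]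
        KoszulHomology (formOf x) (R ⧸ restrictedPower f ψ w d) (a + 1),
      ∀ (σ : Set.powersetCard (Fin n) (a + 1)) (α : Fin n →₀ ℕ),
        α.degree + 1 = d → MultidegreeLE w σ α →
        ∃ hu : kappa f a (wedgeMonomial f σ α) ∈ LTerm f w d a,
          IsClassOf (formOf x) (1 ⊗ₜ[R] liftedElement f ψ ℓ σ α)
            (e (1 ⊗ₜ[R] ⟨kappa f a (wedgeMonomial f σ α), hu⟩))
  /-- The classes `[ψ(f^α) z_σ]` of the semistandard `(σ, α)` are a `k`-basis. -/
  basis : ∀ (ℓ : KoszulLift ψ (formOf x)) (i : ℕ), 1 ≤ i →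
    ∃ h : StandardPair n w d i → KoszulHomology (formOf x) (R ⧸ restrictedPower f ψ w d) i,
      (∀ p, IsClassOf (formOf x) (1 ⊗ₜ[R] liftedElement f ψ ℓ p.1.1 p.1.2) (h p)) ∧
      IsResidueBasis (Ideal.span (Set.range x)) h
  /-- If `d ≥ 2`, the product of two of the cycles of positive degree is zero in homology. -/
  product : 2 ≤ d → ∀ (ℓ : KoszulLift ψ (formOf x)) (i j : ℕ), 1 ≤ i → 1 ≤ j →
    ∀ (σ : Set.powersetCard (Fin n) i) (α : Fin n →₀ ℕ)
      (τ : Set.powersetCard (Fin n) j) (β : Fin n →₀ ℕ),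
      α.degree + 1 = d → MultidegreeLE w σ α → β.degree + 1 = d → MultidegreeLE w τ β →
      (1 : R ⧸ restrictedPower f ψ w d) ⊗ₜ[R]
          ((liftedElement f ψ ℓ σ α : ExteriorAlgebra R (Fin m → R)) *
            (liftedElement f ψ ℓ τ β : ExteriorAlgebra R (Fin m → R))) ∈
        LinearMap.range ((CliffordAlgebra.contractLeft (Q := (0 : QuadraticForm R (Fin m → R)))
          (formOf x)).lTensor (R ⧸ restrictedPower f ψ w d))

end Restricted

end RestrictedPower

end

/-! Write `a` for the sequence of the ψ(f_j), I_b for the b-th restricted power, and J_α for the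
ideal generated by the a_j with α_j < w_j.

In both settings `a` is regular in every order, so monomial ideals in `a` have the same colon ideals
by monomials as if the a_j were variables. Consequently I_b/I_{b+1} is the direct sum of copies of
R/J_α, one for each α ≤ w with |α| = b (`IsPermutablyRegular.coeff_mem`, `evalMonomial_smul_mem`).
The Koszul complex K on x resolves k and J_α is generated by a regular sequence in 𝔪. Hence the
homology of K modulo J_α has as k-basis the classes of the z_σ, with σ among the indices that are
free in α (`subset_homology`). The layer I_b/I_{b+1} therefore contributes one class a^α z_σ for
each symbol f_σ ⊗ f^α of multidegree at most w with |α| = b.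

The evaluation f_σ ⊗ f^α ↦ a^α z_σ turns the tautological differential κ into the differential of K
(`IsKoszulFamily.d_hookEval`), so the connecting maps between consecutive layers are given by κ.
Away from the symbol with σ = ∅ and α = 0, κ has the contracting homotopy that moves the smallest
index into the column (`hookD_hookH_add`). It preserves multidegrees, hence respects the restriction
by w. An induction on b combines these facts. Every cycle modulo I_b is homologous to an evaluated
combination of symbols with |α| = b - 1, up to a multiple of 1 (`exists_hookEval_of_cycle`). In
positive column degree, such a combination u evaluates to a boundary exactly when κ(u) vanishes
modulo 𝔪 (`hookEval_mem_of_hookD_mem`, `hookD_mem_of_hookEval_mem`). So homology is the image of κ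
tensored with k, which is L ⊗ k. The homotopy takes values in the span of the semistandard symbols
and kills them, and this yields the basis. Minimality of L holds because `kosTensor` and κ
anticommute.

For products, the lift is taken multiplicative, induced by a linear map g : F → R^m. Two monomials
of degree d - 1 multiply into I_d unless they are equal with every positive exponent maximal. In
that case one factor a_s is the boundary of g(f_s), and this makes the product a boundary
(`evalMonomial_mul_extBasis_mem`). The same bounding elements define a Massey operation that
vanishes on words of length at least three (`extD_shortMassey`).

What remains is specific to the two settings. Permutability follows from Krull's intersection
theorem or from the grading. Exactness of K follows from the fact that regular local rings are
domains, or from a direct computation with variables. Since I_d ⊆ 𝔪² for d ≥ 2, minimal generators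
of the maximal ideal of R/I_d lift to elements of R whose Koszul complex is again exact. -/

noncomputable section

namespace RestrictedPower

/-! ### Regular sequences that are regular in every order -/

section PermutablyRegular

variable {R : Type u} [CommRing R] {n : ℕ}

/-- The ideal generated by the `a j` with `j ∈ U`. -/
def subsetIdeal (a : Fin n → R) (U : Finset (Fin n)) : Ideal R :=
  Ideal.span (a '' U)

/-- Every `a t` is a nonzerodivisor modulo the ideal generated by any of the other entries. -/
def IsPermutablyRegular (a : Fin n → R) : Prop :=
  ∀ (U : Finset (Fin n)) (t : Fin n), t ∉ U →
    ∀ r, a t * r ∈ subsetIdeal a U → r ∈ subsetIdeal a U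

theorem mem_subsetIdeal {a : Fin n → R} {U : Finset (Fin n)} {j : Fin n} (hj : j ∈ U) :
    a j ∈ subsetIdeal a U :=
  Ideal.subset_span ⟨j, hj, rfl⟩

theorem subsetIdeal_mono (a : Fin n → R) {U V : Finset (Fin n)} (h : U ⊆ V) :
    subsetIdeal a U ≤ subsetIdeal a V :=
  Ideal.span_mono (Set.image_mono (by exact_mod_cast h))

theorem subsetIdeal_insert (a : Fin n → R) (U : Finset (Fin n)) (s : Fin n) :
    subsetIdeal a (insert s U) = Ideal.span {a s} ⊔ subsetIdeal a U := by
  rw [subsetIdeal, Finset.coe_insert, Set.image_insert_eq, Ideal.span_insert]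
  rfl

theorem mem_subsetIdeal_insert {a : Fin n → R} {U : Finset (Fin n)} {s : Fin n} {r : R} :
    r ∈ subsetIdeal a (insert s U) ↔ ∃ q, ∃ j ∈ subsetIdeal a U, r = a s * q + j := by
  rw [subsetIdeal_insert, Submodule.mem_sup]
  constructor
  · rintro ⟨y, hy, j, hj, rfl⟩
    obtain ⟨q, rfl⟩ := Ideal.mem_span_singleton'.1 hy
    exact ⟨q, j, hj, by ring⟩
  · rintro ⟨q, j, hj, rfl⟩
    exact ⟨a s * q, Ideal.mul_mem_right _ _ (Ideal.mem_span_singleton_self _), j, hj, rfl⟩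

/-- Exchanging two consecutive entries of a regular sequence. -/
theorem nonzerodivisor_of_insert {a : Fin n → R}
    (hsep : ∀ U s r, (∀ k : ℕ, r ∈ subsetIdeal a U ⊔ Ideal.span {a s ^ k}) →
      r ∈ subsetIdeal a U)
    {U : Finset (Fin n)} {s t : Fin n}
    (hs : ∀ r, a s * r ∈ subsetIdeal a U → r ∈ subsetIdeal a U)
    (ht : ∀ r, a t * r ∈ subsetIdeal a (insert s U) → r ∈ subsetIdeal a (insert s U)) :
    ∀ r, a t * r ∈ subsetIdeal a U → r ∈ subsetIdeal a U := by
  intro r hr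
  refine hsep U s r fun k => ?_
  -- Modulo the ideal of `U`, the element `r` is divisible by every power of `a s`, and each
  -- quotient is again killed by `a t`: `ht` supplies one more factor `a s`, and `hs` cancels it in
  -- the relation.
  have key : ∀ k : ℕ, ∃ q, a t * q ∈ subsetIdeal a U ∧ r - a s ^ k * q ∈ subsetIdeal a U := by
    intro k
    induction k with
    | zero => exact ⟨r, hr, by simp⟩
    | succ k ih =>
      obtain ⟨q, hq, hrq⟩ := ih
      obtain ⟨p, j, hj, rfl⟩ := mem_subsetIdeal_insert.1
        (ht q (subsetIdeal_mono a (Finset.subset_insert s U) hq))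
      refine ⟨p, hs _ ?_, ?_⟩
      · have := Ideal.sub_mem _ hq (Ideal.mul_mem_left _ (a t) hj)
        convert this using 1
        ring
      · have := Ideal.add_mem _ hrq (Ideal.mul_mem_left _ (a s ^ k) hj)
        convert this using 1
        ring
  obtain ⟨q, -, hq⟩ := key k
  have : r = (r - a s ^ k * q) + a s ^ k * q := by ring
  rw [this]
  exact Submodule.add_mem_sup hq (Ideal.mul_mem_right _ _ (Ideal.mem_span_singleton_self _))

/-- A regular sequence is permutable if the ideals generated by its entries are closed in the
adic topologies of the entries. -/
theorem isPermutablyRegular_of_separated {a : Fin n → R}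
    (hreg : ∀ i r, a i * r ∈ subsetIdeal a (Finset.univ.filter (· < i)) →
      r ∈ subsetIdeal a (Finset.univ.filter (· < i)))
    (hsep : ∀ U s r, (∀ k : ℕ, r ∈ subsetIdeal a U ⊔ Ideal.span {a s ^ k}) →
      r ∈ subsetIdeal a U) : IsPermutablyRegular a := by
  have key : ∀ p : ℕ, ∀ (U : Finset (Fin n)) (t : Fin n), t ∉ U → (∀ u ∈ U, (u : ℕ) < p) →
      (t : ℕ) < p → ∀ r, a t * r ∈ subsetIdeal a U → r ∈ subsetIdeal a U := by
    intro p
    induction p with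
    | zero => intro U t _ _ h; omega
    | succ p ih =>
      -- For the entry of largest index, descend from the full set of smaller indices, where
      -- regularity is given, by removing one index at a time through the exchange lemma.
      have last : ∀ t : Fin n, (t : ℕ) = p → ∀ c : ℕ, ∀ U : Finset (Fin n),
          (∀ u ∈ U, (u : ℕ) < p) → (Finset.univ.filter (· < t) \ U).card = c →
          ∀ r, a t * r ∈ subsetIdeal a U → r ∈ subsetIdeal a U := by
        intro t ht c
        induction c with
        | zero =>
          intro U hU hc
          have : U = Finset.univ.filter (· < t) := by
            apply Finset.Subset.antisymm
            · intro u hu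
              simpa [Fin.lt_def, ht] using hU u hu
            · exact Finset.sdiff_eq_empty_iff_subset.1 (Finset.card_eq_zero.1 hc)
          rw [this]
          exact hreg t
        | succ c ihc =>
          intro U hU hc
          obtain ⟨s, hs⟩ : (Finset.univ.filter (· < t) \ U).Nonempty := by
            rw [← Finset.card_pos]; omega
          have hs' := Finset.mem_sdiff.1 hs
          have hst : (s : ℕ) < p := by
            have := (Finset.mem_filter.1 hs'.1).2
            rw [Fin.lt_def] at this; omega
          refine nonzerodivisor_of_insert hsep (ih U s hs'.2 hU hst) (ihc (insert s U) ?_ ?_)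
          · intro u hu
            rcases Finset.mem_insert.1 hu with rfl | hu
            exacts [hst, hU u hu]
          · rw [Finset.sdiff_insert, Finset.card_erase_of_mem hs, hc]; rfl
      intro U t htU hU ht
      by_cases htp : (t : ℕ) = p
      · refine last t htp _ U (fun u hu => ?_) rfl
        have h1 := hU u hu
        have h2 : (u : ℕ) ≠ t := fun h => htU (Fin.ext h ▸ hu)
        omega
      · by_cases hex : ∃ i ∈ U, (i : ℕ) = p
        · obtain ⟨i, hiU, hip⟩ := hex
          obtain ⟨V, hiV, rfl⟩ : ∃ V, i ∉ V ∧ insert i V = U :=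
            ⟨U.erase i, by simp, Finset.insert_erase hiU⟩
          have hV : ∀ u ∈ V, (u : ℕ) < p := fun u hu => by
            have h1 := hU u (Finset.mem_insert_of_mem hu)
            have h2 : (u : ℕ) ≠ i := fun h => hiV (Fin.ext h ▸ hu)
            omega
          have htp' : (t : ℕ) < p := by omega
          have htV : t ∉ V := fun h => htU (Finset.mem_insert_of_mem h)
          intro r hr
          obtain ⟨q, j, hj, hrj⟩ := mem_subsetIdeal_insert.1 hr
          -- The relation `a t * r = a i * q + j` is read as a statement about `a i`, the entry of
          -- largest index, modulo the ideal of `insert t V`.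
          have hq : q ∈ subsetIdeal a (insert t V) := by
            refine last i hip _ (insert t V) (fun u hu => ?_) rfl q ?_
            · rcases Finset.mem_insert.1 hu with rfl | hu
              exacts [htp', hV u hu]
            · exact mem_subsetIdeal_insert.2 ⟨r, -j, neg_mem hj, by rw [hrj]; ring⟩
          obtain ⟨q', j', hj', rfl⟩ := mem_subsetIdeal_insert.1 hq
          have := ih V t htV hV htp' (r - a i * q') (by
            have : a t * (r - a i * q') = a i * j' + j := by
              rw [mul_sub, hrj]; ring
            rw [this]
            exact add_mem (Ideal.mul_mem_left _ _ hj') hj)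
          exact mem_subsetIdeal_insert.2 ⟨q', _, this, by ring⟩
        · push Not at hex
          exact ih U t htU (fun u hu => by have := hU u hu; have := hex u hu; omega) (by omega)
  intro U t htU
  exact key n U t htU (fun u _ => u.2) t.2

/-! ### Monomials in a permutable regular sequence -/

/-- The monomial `a_1^{α_1} ⋯ a_n^{α_n}`. -/
def evalMonomial (a : Fin n → R) (α : Fin n →₀ ℕ) : R := ∏ j, a j ^ α j

@[simp] theorem evalMonomial_zero (a : Fin n → R) : evalMonomial a 0 = 1 := by
  simp [evalMonomial]

theorem evalMonomial_add (a : Fin n → R) (α β : Fin n →₀ ℕ) :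
    evalMonomial a (α + β) = evalMonomial a α * evalMonomial a β := by
  simp [evalMonomial, pow_add, Finset.prod_mul_distrib]

@[simp] theorem evalMonomial_single (a : Fin n → R) (s : Fin n) :
    evalMonomial a (Finsupp.single s 1) = a s := by
  rw [evalMonomial, Finset.prod_eq_single s]
  · simp
  · intro b _ hb
    simp [Finsupp.single_eq_of_ne hb]
  · simp

theorem evalMonomial_of_pos (a : Fin n → R) {α : Fin n →₀ ℕ} {s : Fin n} (hs : α s ≠ 0) :
    evalMonomial a α = a s * evalMonomial a (α - Finsupp.single s 1) := by
  rw [← evalMonomial_single a s, ← evalMonomial_add,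
    add_tsub_cancel_of_le (Finsupp.single_le_iff.2 (Nat.one_le_iff_ne_zero.2 hs))]

/-- The ideal generated by the monomials with exponents in a list. -/
def monomialIdeal (a : Fin n → R) (l : List (Fin n →₀ ℕ)) : Ideal R :=
  Ideal.span {r | ∃ β ∈ l, r = evalMonomial a β}

theorem evalMonomial_mem {a : Fin n → R} {l : List (Fin n →₀ ℕ)} {β : Fin n →₀ ℕ} (h : β ∈ l) :
    evalMonomial a β ∈ monomialIdeal a l :=
  Ideal.subset_span ⟨β, h, rfl⟩

theorem monomialIdeal_le_iff {a : Fin n → R} {l : List (Fin n →₀ ℕ)} {J : Ideal R} :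
    monomialIdeal a l ≤ J ↔ ∀ β ∈ l, evalMonomial a β ∈ J := by
  rw [monomialIdeal, Ideal.span_le]
  constructor
  · intro h β hβ
    exact h ⟨β, hβ, rfl⟩
  · rintro h _ ⟨β, hβ, rfl⟩
    exact h β hβ

/-- The exponents of the generators of the colon ideal of a monomial ideal by `a s`. -/
def colonList (s : Fin n) (l : List (Fin n →₀ ℕ)) : List (Fin n →₀ ℕ) :=
  l.map (· - Finsupp.single s 1)

theorem filter_le_colonList (a : Fin n → R) (s : Fin n) (l : List (Fin n →₀ ℕ)) :
    monomialIdeal a (l.filter (· s = 0)) ≤ monomialIdeal a (colonList s l) := by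
  rw [monomialIdeal_le_iff]
  intro β hβ
  obtain ⟨hβl, hβs⟩ := List.mem_filter.1 hβ
  refine evalMonomial_mem (List.mem_map.2 ⟨β, hβl, ?_⟩)
  ext j
  by_cases hj : j = s
  · subst hj
    have : β j = 0 := by simpa using hβs
    simp [this]
  · simp [Finsupp.single_eq_of_ne hj]

/-- Each generator either avoids `a s` or is `a s` times the generator with lowered exponent. So `a
s * (r - m)` lies in the part that avoids `a s`, for some `m` in the candidate colon ideal, and
there `a s` can be cancelled. -/
theorem mem_colonList_of_mul_mem {a : Fin n → R} {U : Finset (Fin n)} {s : Fin n}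
    {l : List (Fin n →₀ ℕ)}
    (h : ∀ r, a s * r ∈ subsetIdeal a U ⊔ monomialIdeal a (l.filter (· s = 0)) →
      r ∈ subsetIdeal a U ⊔ monomialIdeal a (l.filter (· s = 0)))
    {r : R} (hr : a s * r ∈ subsetIdeal a U ⊔ monomialIdeal a l) :
    r ∈ subsetIdeal a U ⊔ monomialIdeal a (colonList s l) := by
  have hle : subsetIdeal a U ⊔ monomialIdeal a l ≤
      (subsetIdeal a U ⊔ monomialIdeal a (l.filter (· s = 0))) ⊔
        Ideal.span {a s} * monomialIdeal a (colonList s l) := by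
    refine sup_le (le_sup_left.trans le_sup_left) (monomialIdeal_le_iff.2 fun β hβ => ?_)
    by_cases hs : β s = 0
    · exact Ideal.mem_sup_left (Ideal.mem_sup_right
        (evalMonomial_mem (List.mem_filter.2 ⟨hβ, by simpa using hs⟩)))
    · rw [evalMonomial_of_pos a hs]
      exact Ideal.mem_sup_right (Ideal.mul_mem_mul (Ideal.mem_span_singleton_self _)
        (evalMonomial_mem (List.mem_map.2 ⟨β, hβ, rfl⟩)))
  obtain ⟨q, hq, p, hp, hqp⟩ := Submodule.mem_sup.1 (hle hr)
  obtain ⟨m, hm, rfl⟩ := Ideal.mem_span_singleton_mul.1 hp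
  have h1 : r - m ∈ subsetIdeal a U ⊔ monomialIdeal a (l.filter (· s = 0)) := by
    apply h
    have : a s * (r - m) = q := by rw [mul_sub, ← hqp]; ring
    rwa [this]
  have h2 := sup_le_sup_left (filter_le_colonList a s l) (subsetIdeal a U) h1
  have h3 : r = (r - m) + m := by ring
  rw [h3]
  exact add_mem h2 (Ideal.mem_sup_right hm)

/-- The sum of the degrees of the generators is the induction measure for
`IsPermutablyRegular.mem_of_mul_mem`; this and `sum_degree_colonList_lt` make both recursive calls
legitimate. -/
theorem sum_degree_filter_lt {l : List (Fin n →₀ ℕ)} {β : Fin n →₀ ℕ} (hβ : β ∈ l) {s : Fin n}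
    (hs : β s ≠ 0) :
    ((l.filter (· s = 0)).map Finsupp.degree).sum < (l.map Finsupp.degree).sum := by
  induction l with
  | nil => simp at hβ
  | cons γ l ih =>
    have hle : ((l.filter (· s = 0)).map Finsupp.degree).sum ≤ (l.map Finsupp.degree).sum :=
      (List.filter_sublist.map _).sum_le_sum (by simp)
    by_cases hγ : γ s = 0
    · have hβl : β ∈ l := by
        rcases List.mem_cons.1 hβ with rfl | h
        exacts [absurd hγ hs, h]
      simpa [List.filter_cons, hγ] using ih hβl
    · have : 0 < γ.degree := by
        rw [Nat.pos_iff_ne_zero, Ne, Finsupp.degree_eq_zero_iff]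
        rintro rfl; simp at hγ
      simp [hγ]
      omega

theorem degree_tsub_single_add {β : Fin n →₀ ℕ} {s : Fin n} (hs : β s ≠ 0) :
    (β - Finsupp.single s 1).degree + 1 = β.degree := by
  have h : β - Finsupp.single s 1 + Finsupp.single s 1 = β :=
    tsub_add_cancel_of_le (Finsupp.single_le_iff.2 (Nat.one_le_iff_ne_zero.2 hs))
  conv_rhs => rw [← h]
  simp

theorem sum_degree_colonList_lt {l : List (Fin n →₀ ℕ)} {β : Fin n →₀ ℕ} (hβ : β ∈ l) {s : Fin n}
    (hs : β s ≠ 0) :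
    ((colonList s l).map Finsupp.degree).sum < (l.map Finsupp.degree).sum := by
  rw [colonList, List.map_map]
  refine List.sum_lt_sum _ _ (fun γ _ => Finsupp.degree_mono tsub_le_self) ⟨β, hβ, ?_⟩
  have := degree_tsub_single_add hs
  simp only [Function.comp]
  omega

/-- A member of a permutable regular sequence is a nonzerodivisor modulo every monomial ideal in
the other members. -/
theorem IsPermutablyRegular.mem_of_mul_mem {a : Fin n → R} (ha : IsPermutablyRegular a) (N : ℕ) :
    ∀ (l : List (Fin n →₀ ℕ)) (U : Finset (Fin n)) (t : Fin n),
      (l.map Finsupp.degree).sum ≤ N → t ∉ U → (∀ β ∈ l, ∀ u ∈ insert t U, β u = 0) →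
      ∀ r, a t * r ∈ subsetIdeal a U ⊔ monomialIdeal a l →
        r ∈ subsetIdeal a U ⊔ monomialIdeal a l := by
  induction N using Nat.strong_induction_on with
  | _ N ih =>
  intro l U t hN htU hl r hr
  -- If no generator involves a variable, the monomial ideal is zero or the unit ideal.
  by_cases hz : ∀ β ∈ l, β = 0
  · by_cases hnil : l = []
    · subst hnil
      have : monomialIdeal a [] = ⊥ := by simp [monomialIdeal]
      rw [this, sup_bot_eq] at hr ⊢
      exact ha U t htU r hr
    · obtain ⟨β, hβ⟩ := List.exists_mem_of_ne_nil l hnil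
      have : (1 : R) ∈ subsetIdeal a U ⊔ monomialIdeal a l :=
        Ideal.mem_sup_right (by have := evalMonomial_mem (a := a) hβ; simpa [hz β hβ] using this)
      rw [(Ideal.eq_top_iff_one _).2 this]
      trivial
  push Not at hz
  obtain ⟨β, hβ, hβ0⟩ := hz
  obtain ⟨s, hs⟩ := Finsupp.ne_iff.1 hβ0
  have hs : β s ≠ 0 := hs
  have hsU : s ∉ U := fun h => hs (hl β hβ s (Finset.mem_insert_of_mem h))
  have hst : s ≠ t := fun h => hs (hl β hβ s (h ▸ Finset.mem_insert_self _ _))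
  have hlt := sum_degree_filter_lt hβ hs
  have hlt' := sum_degree_colonList_lt hβ hs
  have hcol : ∀ r, a s * r ∈ subsetIdeal a U ⊔ monomialIdeal a l →
      r ∈ subsetIdeal a U ⊔ monomialIdeal a (colonList s l) := fun r hr => by
    refine mem_colonList_of_mul_mem (ih _ (by omega) _ U s le_rfl hsU ?_) hr
    intro γ hγ u hu
    obtain ⟨hγl, hγs⟩ := List.mem_filter.1 hγ
    rcases Finset.mem_insert.1 hu with rfl | hu
    · simpa using hγs
    · exact hl γ hγl u (Finset.mem_insert_of_mem hu)
  have hle : subsetIdeal a U ⊔ monomialIdeal a l ≤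
      subsetIdeal a (insert s U) ⊔ monomialIdeal a (l.filter (· s = 0)) := by
    refine sup_le_iff.2 ⟨(subsetIdeal_mono a (Finset.subset_insert _ _)).trans le_sup_left,
      monomialIdeal_le_iff.2 fun γ hγ => ?_⟩
    by_cases hγs : γ s = 0
    · exact Ideal.mem_sup_right (evalMonomial_mem (List.mem_filter.2 ⟨hγ, by simpa using hγs⟩))
    · rw [evalMonomial_of_pos a hγs]
      exact Ideal.mem_sup_left (Ideal.mul_mem_right _ _ (mem_subsetIdeal (by simp)))
  -- Adding `a s` to the linear part absorbs all generators that involve `s`. This writes `r` as `a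
  -- s * q` plus admissible terms, and `q` is then treated through the colon ideal by `a s`.
  have h1 := ih _ (by omega) (l.filter (· s = 0)) (insert s U) t le_rfl
    (by simp [hst.symm, htU]) (by
      intro γ hγ u hu
      obtain ⟨hγl, hγs⟩ := List.mem_filter.1 hγ
      rcases Finset.mem_insert.1 hu with rfl | hu
      · exact hl γ hγl _ (by simp)
      rcases Finset.mem_insert.1 hu with rfl | hu
      · simpa using hγs
      · exact hl γ hγl u (Finset.mem_insert_of_mem hu)) r (hle hr)
  obtain ⟨p, hp, m, hm, rfl⟩ := Submodule.mem_sup.1 h1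
  obtain ⟨q, j, hj, rfl⟩ := mem_subsetIdeal_insert.1 hp
  have hjm : j + m ∈ subsetIdeal a U ⊔ monomialIdeal a l := by
    refine Submodule.add_mem_sup hj ?_
    refine (monomialIdeal_le_iff.2 fun γ hγ => ?_ : monomialIdeal a _ ≤ monomialIdeal a l) hm
    exact evalMonomial_mem (List.mem_filter.1 hγ).1
  have h2 : a s * (a t * q) ∈ subsetIdeal a U ⊔ monomialIdeal a l := by
    have := sub_mem hr (Ideal.mul_mem_left _ (a t) hjm)
    convert this using 1
    ring
  have h3 := ih _ (by omega) (colonList s l) U t le_rfl htU (by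
    intro γ hγ u hu
    obtain ⟨δ, hδ, rfl⟩ := List.mem_map.1 hγ
    simp [hl δ hδ u hu]) q (hcol _ h2)
  have h4 : a s * q ∈ subsetIdeal a U ⊔ monomialIdeal a l := by
    obtain ⟨j', hj', m', hm', rfl⟩ := Submodule.mem_sup.1 h3
    rw [mul_add]
    refine Submodule.add_mem_sup (Ideal.mul_mem_left _ _ hj') ?_
    have : Ideal.span {a s} * monomialIdeal a (colonList s l) ≤ monomialIdeal a l := by
      rw [monomialIdeal, monomialIdeal, Ideal.span_mul_span', Ideal.span_le]
      rintro _ ⟨_, rfl, _, ⟨_, hγ, rfl⟩, rfl⟩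
      obtain ⟨δ, hδ, rfl⟩ := List.mem_map.1 hγ
      change a s * _ ∈ monomialIdeal a l
      -- Subtraction of exponents is truncated: a generator without `s` is its own image in the
      -- colon list, and multiplying it by `a s` stays in the ideal.
      by_cases hδs : δ s = 0
      · have : δ - Finsupp.single s 1 = δ := by
          ext j
          by_cases hj : j = s
          · subst hj; simp [hδs]
          · simp [Finsupp.single_eq_of_ne hj]
        rw [this]
        exact Ideal.mul_mem_left _ _ (evalMonomial_mem hδ)
      · rw [← evalMonomial_of_pos a hδs]
        exact evalMonomial_mem hδ
    exact this (Ideal.mul_mem_mul (Ideal.mem_span_singleton_self _) hm')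
  rw [add_assoc]
  exact add_mem h4 hjm

/-- The colon ideal of a monomial ideal by a monomial. -/
theorem IsPermutablyRegular.colon {a : Fin n → R} (ha : IsPermutablyRegular a)
    (D : ℕ) : ∀ (α : Fin n →₀ ℕ) (l : List (Fin n →₀ ℕ)), α.degree = D →
      ∀ r, evalMonomial a α * r ∈ monomialIdeal a l → r ∈ monomialIdeal a (l.map (· - α)) := by
  induction D with
  | zero =>
    intro α l hα r hr
    rw [Finsupp.degree_eq_zero_iff] at hα
    subst hα
    simpa using hr
  | succ D ih =>
    intro α l hα r hr
    obtain ⟨s, hs⟩ : ∃ s, α s ≠ 0 := by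
      by_contra! h
      have : α = 0 := Finsupp.ext h
      simp [this] at hα
    have hsub : ∀ r, a s * r ∈ monomialIdeal a l → r ∈ monomialIdeal a (colonList s l) := by
      intro r hr
      have h := mem_colonList_of_mul_mem (U := ∅) (s := s) (l := l)
        (ha.mem_of_mul_mem _ _ ∅ s le_rfl (by simp) (by
          intro γ hγ u hu
          obtain ⟨hγl, hγs⟩ := List.mem_filter.1 hγ
          simp only [insert_empty_eq, Finset.mem_singleton] at hu
          subst hu
          simpa using hγs)) (Ideal.mem_sup_right hr)
      simpa [subsetIdeal] using h
    rw [evalMonomial_of_pos a hs, mul_assoc] at hr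
    have h1 := ih (α - Finsupp.single s 1) (colonList s l)
      (by have := degree_tsub_single_add hs; omega) r (hsub _ hr)
    have : (colonList s l).map (· - (α - Finsupp.single s 1)) = l.map (· - α) := by
      rw [colonList, List.map_map]
      refine List.map_congr_left fun β _ => ?_
      have h : Finsupp.single s 1 + (α - Finsupp.single s 1) = α :=
        add_tsub_cancel_of_le (Finsupp.single_le_iff.2 (Nat.one_le_iff_ne_zero.2 hs))
      simp only [Function.comp]
      rw [tsub_tsub, h]
    rwa [this] at h1

/-! ### The coefficients of a relation between restricted monomials -/

/-- The exponents `α ≤ w` with `|α| = d`. -/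
def restrictedExponents (w : Fin n → ℕ) (d : ℕ) : Finset (Fin n →₀ ℕ) :=
  (Finset.Iic (Finsupp.equivFunOnFinite.symm w)).filter (·.degree = d)

theorem mem_restrictedExponents {w : Fin n → ℕ} {d : ℕ} {α : Fin n →₀ ℕ} :
    α ∈ restrictedExponents w d ↔ (∀ j, α j ≤ w j) ∧ α.degree = d := by
  simp [restrictedExponents, Finsupp.le_def]

/-- The ideal generated by the monomials `a^α` with `α ≤ w` and `|α| = d`. -/
def restrictedIdeal (a : Fin n → R) (w : Fin n → ℕ) (d : ℕ) : Ideal R :=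
  Ideal.span (evalMonomial a '' restrictedExponents w d)

theorem evalMonomial_mem_restrictedIdeal {a : Fin n → R} {w : Fin n → ℕ} {d : ℕ} {α : Fin n →₀ ℕ}
    (h : ∀ j, α j ≤ w j) (hd : α.degree = d) : evalMonomial a α ∈ restrictedIdeal a w d :=
  Ideal.subset_span ⟨α, mem_restrictedExponents.2 ⟨h, hd⟩, rfl⟩

/-- The indices `j` with `α_j < w_j`. -/
def freeIndices (w : Fin n → ℕ) (α : Fin n →₀ ℕ) : Finset (Fin n) :=
  Finset.univ.filter fun j => α j < w j

theorem mem_freeIndices {w : Fin n → ℕ} {α : Fin n →₀ ℕ} {j : Fin n} :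
    j ∈ freeIndices w α ↔ α j < w j := by simp [freeIndices]

theorem restrictedIdeal_eq_monomialIdeal (a : Fin n → R) (w : Fin n → ℕ) (d : ℕ) :
    restrictedIdeal a w d = monomialIdeal a (restrictedExponents w d).toList := by
  rw [restrictedIdeal, monomialIdeal]
  congr 1
  ext r
  simp [eq_comm]

/-- `c α` lies in the colon by `a^α` of the ideal generated by all the other monomials in sight. Any
such exponent `β ≤ w` fails `β ≤ α`, so `α j < β j ≤ w j` for some `j`, and the colon generator
`a^(β - α)` is divisible by an `a j` with `j` free. This is the directness of the decomposition of
I_d/I_{d+1}. -/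
theorem IsPermutablyRegular.coeff_mem {a : Fin n → R} (ha : IsPermutablyRegular a)
    {w : Fin n → ℕ} {d : ℕ} (c : (Fin n →₀ ℕ) → R)
    (h : ∑ α ∈ restrictedExponents w d, evalMonomial a α * c α ∈ restrictedIdeal a w (d + 1))
    {α : Fin n →₀ ℕ} (hα : α ∈ restrictedExponents w d) :
    c α ∈ subsetIdeal a (freeIndices w α) := by
  classical
  set l := ((restrictedExponents w d).erase α).toList ++ (restrictedExponents w (d + 1)).toList
    with hl
  have h1 : evalMonomial a α * c α ∈ monomialIdeal a l := by
    rw [← Finset.add_sum_erase _ _ hα] at h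
    have h2 : ∑ β ∈ (restrictedExponents w d).erase α, evalMonomial a β * c β ∈
        monomialIdeal a l :=
      sum_mem fun β hβ => Ideal.mul_mem_right _ _ (evalMonomial_mem
        (List.mem_append_left _ (Finset.mem_toList.2 hβ)))
    have h3 : restrictedIdeal a w (d + 1) ≤ monomialIdeal a l := by
      rw [restrictedIdeal_eq_monomialIdeal, monomialIdeal_le_iff]
      intro β hβ
      exact evalMonomial_mem (List.mem_append_right _ hβ)
    simpa using sub_mem (h3 h) h2
  refine (monomialIdeal_le_iff.2 ?_ : monomialIdeal a _ ≤ _) (ha.colon _ α l rfl _ h1)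
  intro γ hγ
  obtain ⟨β, hβ, rfl⟩ := List.mem_map.1 hγ
  obtain ⟨-, hαd⟩ := mem_restrictedExponents.1 hα
  have hβ' : (∀ j, β j ≤ w j) ∧ ¬ β ≤ α := by
    rcases List.mem_append.1 hβ with hβ | hβ
    · obtain ⟨hne, hβ⟩ := Finset.mem_erase.1 (Finset.mem_toList.1 hβ)
      obtain ⟨hβw, hβd⟩ := mem_restrictedExponents.1 hβ
      refine ⟨hβw, fun hle => hne ?_⟩
      have hz : (α - β).degree = 0 := by
        have h5 := congrArg Finsupp.degree (tsub_add_cancel_of_le hle)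
        rw [map_add] at h5
        omega
      rw [Finsupp.degree_eq_zero_iff, tsub_eq_zero_iff_le] at hz
      exact le_antisymm hle hz
    · obtain ⟨hβw, hβd⟩ := mem_restrictedExponents.1 (Finset.mem_toList.1 hβ)
      refine ⟨hβw, fun hle => ?_⟩
      have := Finsupp.degree_mono hle
      omega
  obtain ⟨hβw, hβα⟩ := hβ'
  rw [Finsupp.le_def] at hβα
  push Not at hβα
  obtain ⟨j, hj⟩ := hβα
  have hj' : (β - α) j ≠ 0 := by
    rw [Finsupp.tsub_apply]; omega
  rw [evalMonomial_of_pos a hj']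
  exact Ideal.mul_mem_right _ _ (mem_subsetIdeal (mem_freeIndices.2 (hj.trans_le (hβw j))))

end PermutablyRegular

/-! ### The tautological Koszul complex on symbols and its contracting homotopy -/

section Combinatorial

variable {n : ℕ}

/-- The number of elements of `σ` below `r`. -/
def position (r : Fin n) (σ : Finset (Fin n)) : ℕ := (σ.filter (· < r)).card

theorem position_eq_zero {s : Fin n} {σ : Finset (Fin n)} (h : ∀ r ∈ σ, s ≤ r) :
    position s σ = 0 := by
  rw [position, Finset.card_eq_zero, Finset.filter_eq_empty_iff]
  exact fun r hr => not_lt.2 (h r hr)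

theorem position_insert_of_lt {r s : Fin n} {σ : Finset (Fin n)} (hs : s ∉ σ) (h : s < r) :
    position r (insert s σ) = position r σ + 1 := by
  rw [position, Finset.filter_insert, if_pos h, Finset.card_insert_of_notMem (by simp [hs])]
  rfl

theorem position_erase_of_lt {r s : Fin n} {σ : Finset (Fin n)} (hs : s ∈ σ) (h : s < r) :
    position r (σ.erase s) + 1 = position r σ := by
  conv_rhs => rw [← Finset.insert_erase hs]
  rw [position_insert_of_lt (by simp) h]

theorem position_erase_of_le {r s : Fin n} {σ : Finset (Fin n)} (h : r ≤ s) :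
    position r (σ.erase s) = position r σ := by
  rw [position, position, Finset.filter_erase, Finset.erase_eq_of_notMem]
  simp [h]

variable (R : Type u) [CommRing R]

/-- The sign `(-1)^(number of elements of σ below r)`. -/
def koszulSign (r : Fin n) (σ : Finset (Fin n)) : R := (-1) ^ position r σ

theorem koszulSign_mul_self (r : Fin n) (σ : Finset (Fin n)) :
    koszulSign R r σ * koszulSign R r σ = 1 := by
  rw [koszulSign, ← pow_add, ← two_mul, pow_mul]; simp

/-- Removing the smaller of two indices shifts the position of the larger by one, while removing the
larger does not affect the smaller. This is the cancellation behind `hookD_hookD`. -/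
theorem koszulSign_mul_erase {r s : Fin n} {σ : Finset (Fin n)} (hr : r ∈ σ) (hs : s ∈ σ)
    (hrs : r ≠ s) :
    koszulSign R r σ * koszulSign R s (σ.erase r) +
      koszulSign R s σ * koszulSign R r (σ.erase s) = 0 := by
  rcases lt_or_gt_of_ne hrs with h | h
  · rw [koszulSign, koszulSign, koszulSign, koszulSign, position_erase_of_le h.le,
      ← position_erase_of_lt hr h, pow_succ]
    ring
  · rw [koszulSign, koszulSign, koszulSign, koszulSign, position_erase_of_le h.le,
      ← position_erase_of_lt hs h, pow_succ]
    ring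

theorem koszulSign_eq_one {s : Fin n} {σ : Finset (Fin n)} (h : ∀ r ∈ σ, s ≤ r) :
    koszulSign R s σ = 1 := by
  rw [koszulSign, position_eq_zero h, pow_zero]

theorem koszulSign_insert_of_lt {r s : Fin n} {σ : Finset (Fin n)} (hs : s ∉ σ) (h : s < r) :
    koszulSign R r (insert s σ) = -koszulSign R r σ := by
  rw [koszulSign, koszulSign, position_insert_of_lt hs h, pow_succ]
  ring

/-- The free module on the symbols `f_σ ⊗ f^α`. -/
abbrev HookModule (n : ℕ) : Type u := (Finset (Fin n) × (Fin n →₀ ℕ)) →₀ R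

variable {R}

/-- The basis element `f_σ ⊗ f^α`. -/
abbrev hook (σ : Finset (Fin n)) (α : Fin n →₀ ℕ) : HookModule R n := Finsupp.single (σ, α) 1

/-- The tautological Koszul differential on the symbols `f_σ ⊗ f^α`. -/
def hookD : HookModule R n →ₗ[R] HookModule R n :=
  Finsupp.linearCombination R fun p =>
    ∑ r ∈ p.1, koszulSign R r p.1 • hook (p.1.erase r) (p.2 + Finsupp.single r 1)

theorem hookD_hook (σ : Finset (Fin n)) (α : Fin n →₀ ℕ) :
    hookD (hook σ α : HookModule R n) =
      ∑ r ∈ σ, koszulSign R r σ • hook (σ.erase r) (α + Finsupp.single r 1) := by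
  simp [hookD]

theorem hookD_hookD (u : HookModule R n) : hookD (hookD u) = 0 := by
  have : (hookD ∘ₗ hookD : HookModule R n →ₗ[R] HookModule R n) = 0 := by
    refine Finsupp.lhom_ext' fun p => LinearMap.ext_ring ?_
    obtain ⟨σ, α⟩ := p
    change hookD (hookD (hook σ α)) = 0
    simp only [hookD_hook, map_sum, map_smul, Finset.smul_sum, smul_smul]
    rw [Finset.sum_sigma']
    refine Finset.sum_involution (fun x _ => ⟨x.2, x.1⟩) ?_ ?_ ?_ ?_
    · rintro ⟨r, s⟩ h
      obtain ⟨hr, hs⟩ : r ∈ σ ∧ s ≠ r ∧ s ∈ σ := by simpa using h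
      simp only
      rw [Finset.erase_right_comm, add_right_comm, ← add_smul,
        koszulSign_mul_erase R hr hs.2 hs.1.symm, zero_smul]
    · rintro ⟨r, s⟩ h _ heq
      obtain ⟨hr, hs⟩ : r ∈ σ ∧ s ≠ r ∧ s ∈ σ := by simpa using h
      exact hs.1 (congrArg Sigma.fst heq)
    · rintro ⟨r, s⟩ h
      obtain ⟨hr, hs⟩ : r ∈ σ ∧ s ≠ r ∧ s ∈ σ := by simpa using h
      simp [hr, hs.2, hs.1.symm]
    · rintro ⟨r, s⟩ h
      rfl
  exact LinearMap.congr_fun this u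

/-- The set of indices that occur in `f_σ ⊗ f^α`. -/
def hookSupport (p : Finset (Fin n) × (Fin n →₀ ℕ)) : Finset (Fin n) := p.1 ∪ p.2.support

open Classical in
/-- The contracting homotopy that moves the smallest index into the column. -/
def hookH : HookModule R n →ₗ[R] HookModule R n :=
  Finsupp.linearCombination R fun p =>
    if h : (hookSupport p).Nonempty then
      if (hookSupport p).min' h ∈ p.1 then 0
      else hook (insert ((hookSupport p).min' h) p.1)
        (p.2 - Finsupp.single ((hookSupport p).min' h) 1)
    else 0

/-- `s` is the smallest index that occurs in `f_σ ⊗ f^α`. -/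
def IsLeastIndex (s : Fin n) (σ : Finset (Fin n)) (α : Fin n →₀ ℕ) : Prop :=
  (s ∈ σ ∨ α s ≠ 0) ∧ (∀ r ∈ σ, s ≤ r) ∧ ∀ r, α r ≠ 0 → s ≤ r

theorem IsLeastIndex.min'_eq {s : Fin n} {σ : Finset (Fin n)} {α : Fin n →₀ ℕ}
    (h : IsLeastIndex s σ α) (hne : (hookSupport (σ, α)).Nonempty) :
    (hookSupport (σ, α)).min' hne = s := by
  apply le_antisymm
  · refine Finset.min'_le _ _ ?_
    simpa [hookSupport] using h.1
  · refine Finset.le_min' _ _ _ fun r hr => ?_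
    rcases Finset.mem_union.1 hr with hr | hr
    · exact h.2.1 r hr
    · exact h.2.2 r (Finsupp.mem_support_iff.1 hr)

theorem IsLeastIndex.nonempty {s : Fin n} {σ : Finset (Fin n)} {α : Fin n →₀ ℕ}
    (h : IsLeastIndex s σ α) : (hookSupport (σ, α)).Nonempty :=
  ⟨s, by simpa [hookSupport] using h.1⟩

theorem exists_isLeastIndex {σ : Finset (Fin n)} {α : Fin n →₀ ℕ} (h : σ.card + α.degree ≠ 0) :
    ∃ s, IsLeastIndex s σ α := by
  have hne : (hookSupport (σ, α)).Nonempty := by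
    by_contra hemp
    rw [Finset.not_nonempty_iff_eq_empty, hookSupport, Finset.union_eq_empty] at hemp
    apply h
    have h2 : α = 0 := Finsupp.support_eq_empty.1 hemp.2
    have h1 : σ = ∅ := hemp.1
    simp [h1, h2]
  have hmin := Finset.min'_mem _ hne
  refine ⟨(hookSupport (σ, α)).min' hne, by simpa [hookSupport] using hmin, fun r hr => ?_,
    fun r hr => ?_⟩
  · exact Finset.min'_le _ _ (Finset.mem_union_left _ hr)
  · exact Finset.min'_le _ _ (Finset.mem_union_right _ (Finsupp.mem_support_iff.2 hr))

theorem hookH_hook_of_mem {s : Fin n} {σ : Finset (Fin n)} {α : Fin n →₀ ℕ}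
    (h : IsLeastIndex s σ α) (hs : s ∈ σ) : hookH (hook σ α : HookModule R n) = 0 := by
  simp [hookH, h.nonempty, h.min'_eq, hs]

theorem hookH_hook_of_notMem {s : Fin n} {σ : Finset (Fin n)} {α : Fin n →₀ ℕ}
    (h : IsLeastIndex s σ α) (hs : s ∉ σ) :
    hookH (hook σ α : HookModule R n) = hook (insert s σ) (α - Finsupp.single s 1) := by
  simp [hookH, h.nonempty, h.min'_eq, hs]

/-- Each term of κ only transfers an index from the column to the row, so the set of occurring
indices is unchanged, and with it the minimum. -/
theorem IsLeastIndex.erase {s r : Fin n} {σ : Finset (Fin n)} {α : Fin n →₀ ℕ}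
    (h : IsLeastIndex s σ α) (hr : r ∈ σ) :
    IsLeastIndex s (σ.erase r) (α + Finsupp.single r 1) := by
  refine ⟨?_, fun q hq => h.2.1 q (Finset.mem_of_mem_erase hq), fun q hq => ?_⟩
  · by_cases hrs : s = r
    · right; subst hrs; simp
    · rcases h.1 with h1 | h1
      · left; simp [hrs, h1]
      · right; simp [h1]
  · by_cases hrq : q = r
    · subst hrq; exact h.2.1 _ hr
    · exact h.2.2 q (by simpa [Finsupp.single_eq_of_ne hrq] using hq)

/-- Let `s` be the least index. If `s` is in the column, the homotopy kills the symbol and sees only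
the term of κ that moves `s` out, which it moves back with sign 1. If `s` is only in the row, κ
after the homotopy returns the symbol together with terms for the other column indices. Those terms
cancel against the other composite, since inserting `s` below them changes their signs. -/
theorem hookD_hookH_add {σ : Finset (Fin n)} {α : Fin n →₀ ℕ} (h : σ.card + α.degree ≠ 0) :
    hookD (hookH (hook σ α : HookModule R n)) + hookH (hookD (hook σ α : HookModule R n)) =
      hook σ α := by
  obtain ⟨s, hs⟩ := exists_isLeastIndex h
  by_cases hsσ : s ∈ σ
  · rw [hookH_hook_of_mem hs hsσ, map_zero, zero_add, hookD_hook, map_sum,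
      Finset.sum_eq_single_of_mem s hsσ]
    · rw [map_smul, hookH_hook_of_notMem (hs.erase hsσ) (by simp),
        koszulSign_eq_one R hs.2.1, one_smul, Finset.insert_erase hsσ, add_tsub_cancel_right]
    · intro r hr hrs
      rw [map_smul, hookH_hook_of_mem (hs.erase hr) (by simp [hrs.symm, hsσ]), smul_zero]
  · have hαs : α s ≠ 0 := by
      rcases hs.1 with h1 | h1
      exacts [absurd h1 hsσ, h1]
    rw [hookH_hook_of_notMem hs hsσ, hookD_hook, hookD_hook, map_sum,
      Finset.sum_insert hsσ, koszulSign_eq_one R (σ := insert s σ), one_smul,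
      Finset.erase_insert hsσ,
      tsub_add_cancel_of_le (Finsupp.single_le_iff.2 (Nat.one_le_iff_ne_zero.2 hαs)),
      add_assoc, ← Finset.sum_add_distrib, Finset.sum_eq_zero, add_zero]
    · intro r hr
      have hsr : s < r := lt_of_le_of_ne (hs.2.1 r hr) fun h => hsσ (h ▸ hr)
      rw [map_smul, hookH_hook_of_notMem (hs.erase hr) (by simp [hsσ]),
        koszulSign_insert_of_lt R hsσ hsr, neg_smul, Finset.erase_insert_of_ne hsr.ne,
        tsub_add_eq_add_tsub (Finsupp.single_le_iff.2 (Nat.one_le_iff_ne_zero.2 hαs)),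
        neg_add_cancel]
    · intro r hr
      rcases Finset.mem_insert.1 hr with rfl | hr
      exacts [le_rfl, hs.2.1 r hr]

/-! ### The restricted terms -/

/-- `f_σ ⊗ f^α` has multidegree at most `w`, with `|α| = b`. -/
def hookSet (w : Fin n → ℕ) (b : ℕ) : Set (Finset (Fin n) × (Fin n →₀ ℕ)) :=
  {p | p.2.degree = b ∧ ∀ j, (if j ∈ p.1 then 1 else 0) + p.2 j ≤ w j}

theorem mem_hookSet_iff {w : Fin n → ℕ} {b : ℕ} {σ : Finset (Fin n)} {α : Fin n →₀ ℕ} :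
    (σ, α) ∈ hookSet w b ↔ α ∈ restrictedExponents w b ∧ σ ⊆ freeIndices w α := by
  rw [mem_restrictedExponents]
  constructor
  · rintro ⟨hd, h⟩
    refine ⟨⟨fun j => le_of_add_le_right (h j), hd⟩, fun j hj => mem_freeIndices.2 ?_⟩
    have := h j
    simp only [hj, if_true] at this
    omega
  · rintro ⟨⟨hw, hd⟩, h⟩
    refine ⟨hd, fun j => ?_⟩
    by_cases hj : j ∈ σ
    · have := mem_freeIndices.1 (h hj)
      simp only [hj, if_true]
      omega
    · simpa [hj] using hw j

theorem hookSet_erase {w : Fin n → ℕ} {b : ℕ} {σ : Finset (Fin n)} {α : Fin n →₀ ℕ}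
    (h : (σ, α) ∈ hookSet w b) {r : Fin n} (hr : r ∈ σ) :
    (σ.erase r, α + Finsupp.single r 1) ∈ hookSet w (b + 1) := by
  obtain ⟨hd, hw⟩ := h
  refine ⟨by simpa using hd, fun j => ?_⟩
  by_cases hj : j = r
  · subst hj
    have := hw j
    simp only [hr, if_true] at this
    simp; omega
  · have := hw j
    simpa [hj, Finsupp.single_eq_of_ne hj] using this

theorem hookSet_insert {w : Fin n → ℕ} {b : ℕ} {σ : Finset (Fin n)} {α : Fin n →₀ ℕ}
    (h : (σ, α) ∈ hookSet w (b + 1)) {s : Fin n} (hs : s ∉ σ) (hα : α s ≠ 0) :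
    (insert s σ, α - Finsupp.single s 1) ∈ hookSet w b := by
  obtain ⟨hd, hw⟩ := h
  refine ⟨?_, fun j => ?_⟩
  · have := degree_tsub_single_add hα
    simp only at hd ⊢
    omega
  · have h1 := hw j
    by_cases hj : j = s
    · subst hj
      simp only [hs, if_false] at h1
      simp; omega
    · simpa [hj, Finsupp.single_eq_of_ne hj] using h1

/-- The span of the `f_σ ⊗ f^α` of multidegree at most `w` with `|α| = b`. -/
abbrev hookTerm (R : Type u) [CommRing R] (w : Fin n → ℕ) (b : ℕ) :
    Submodule R (HookModule R n) :=
  Finsupp.supported R R (hookSet w b)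

theorem hookTerm_induction {w : Fin n → ℕ} {b : ℕ} (f : HookModule R n →ₗ[R] HookModule R n)
    (N : Submodule R (HookModule R n))
    (h : ∀ σ α, (σ, α) ∈ hookSet w b → f (hook σ α) ∈ N) {u : HookModule R n}
    (hu : u ∈ hookTerm R w b) : f u ∈ N := by
  rw [hookTerm, Finsupp.supported_eq_span_single] at hu
  have : Submodule.span R ((fun i => Finsupp.single i (1 : R)) '' hookSet w b) ≤ N.comap f := by
    rw [Submodule.span_le]
    rintro _ ⟨⟨σ, α⟩, hp, rfl⟩
    exact h σ α hp
  exact this hu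

theorem hookD_mem {w : Fin n → ℕ} {b : ℕ} {u : HookModule R n} (hu : u ∈ hookTerm R w b) :
    hookD u ∈ hookTerm R w (b + 1) := by
  refine hookTerm_induction _ _ (fun σ α hp => ?_) hu
  rw [hookD_hook]
  exact sum_mem fun r hr => Submodule.smul_mem _ _
    (Finsupp.single_mem_supported R 1 (hookSet_erase hp hr))

/-- The pairs `(σ, α)` whose smallest index lies in `σ`. -/
def standardSet (n : ℕ) : Set (Finset (Fin n) × (Fin n →₀ ℕ)) :=
  {p | ∃ s ∈ p.1, IsLeastIndex s p.1 p.2}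

/-- Moving the least index into the column keeps the multidegree and yields a semistandard symbol.
Together with `hookH_eq_zero_of_standard` this is what selects the basis. -/
theorem hookH_mem {w : Fin n → ℕ} {b : ℕ} {u : HookModule R n} (hu : u ∈ hookTerm R w (b + 1)) :
    hookH u ∈ Finsupp.supported R R (hookSet w b ∩ standardSet n) := by
  refine hookTerm_induction _ _ (fun σ α hp => ?_) hu
  obtain ⟨s, hs⟩ := exists_isLeastIndex (σ := σ) (α := α) (by have : α.degree = b + 1 := hp.1; omega)
  by_cases hsσ : s ∈ σ
  · rw [hookH_hook_of_mem hs hsσ]; exact zero_mem _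
  · have hαs : α s ≠ 0 := by
      rcases hs.1 with h1 | h1
      exacts [absurd h1 hsσ, h1]
    rw [hookH_hook_of_notMem hs hsσ]
    refine Finsupp.single_mem_supported R 1 ⟨hookSet_insert hp hsσ hαs, s, by simp, by simp,
      fun r hr => ?_, fun r hr => hs.2.2 r ?_⟩
    · rcases Finset.mem_insert.1 hr with rfl | hr
      exacts [le_rfl, hs.2.1 r hr]
    · intro h0
      simp [h0] at hr

theorem hookH_mem_hookTerm {w : Fin n → ℕ} {b : ℕ} {u : HookModule R n}
    (hu : u ∈ hookTerm R w (b + 1)) : hookH u ∈ hookTerm R w b :=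
  Finsupp.supported_mono Set.inter_subset_left (hookH_mem hu)

theorem hookH_eq_zero_of_standard {u : HookModule R n}
    (hu : u ∈ Finsupp.supported R R (standardSet n)) : hookH u = 0 := by
  rw [Finsupp.supported_eq_span_single] at hu
  have : Submodule.span R ((fun i => Finsupp.single i (1 : R)) '' standardSet n) ≤
      LinearMap.ker (hookH : HookModule R n →ₗ[R] HookModule R n) := by
    rw [Submodule.span_le]
    rintro _ ⟨⟨σ, α⟩, ⟨s, hsσ, hs⟩, rfl⟩
    exact hookH_hook_of_mem hs hsσ
  exact this hu

/-- The symbols `f_σ ⊗ f^α` with `|σ| = i`. -/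
def columnSet (n i : ℕ) : Set (Finset (Fin n) × (Fin n →₀ ℕ)) := {p | p.1.card = i}

theorem homotopy_apply {u : HookModule R n}
    (hu : ∀ p ∈ u.support, p.1.card + p.2.degree ≠ 0) :
    hookD (hookH u) + hookH (hookD u) = u := by
  have hu' : u ∈ Finsupp.supported R R {p : Finset (Fin n) × (Fin n →₀ ℕ) |
      p.1.card + p.2.degree ≠ 0} := fun p hp => hu p hp
  rw [Finsupp.supported_eq_span_single] at hu'
  have : Submodule.span R ((fun i => Finsupp.single i (1 : R)) ''
      {p : Finset (Fin n) × (Fin n →₀ ℕ) | p.1.card + p.2.degree ≠ 0}) ≤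
      LinearMap.eqLocus (hookD ∘ₗ hookH + hookH ∘ₗ hookD) LinearMap.id := by
    rw [Submodule.span_le]
    rintro _ ⟨⟨σ, α⟩, hp, rfl⟩
    exact hookD_hookH_add hp
  exact this hu'

theorem homotopy_apply_of_mem {w : Fin n → ℕ} {b : ℕ} {u : HookModule R n}
    (hu : u ∈ hookTerm R w (b + 1)) : hookD (hookH u) + hookH (hookD u) = u :=
  homotopy_apply fun p hp => by
    have : p.2.degree = b + 1 := (hu hp).1
    omega

theorem hookD_mem_column {i : ℕ} {u : HookModule R n}
    (hu : u ∈ Finsupp.supported R R (columnSet n (i + 1))) :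
    hookD u ∈ Finsupp.supported R R (columnSet n i) := by
  rw [Finsupp.supported_eq_span_single] at hu
  have : Submodule.span R ((fun i => Finsupp.single i (1 : R)) '' columnSet n (i + 1)) ≤
      (Finsupp.supported R R (columnSet n i)).comap hookD := by
    rw [Submodule.span_le]
    rintro _ ⟨⟨σ, α⟩, hp, rfl⟩
    change hookD (hook σ α : HookModule R n) ∈ Finsupp.supported R R _
    rw [hookD_hook]
    refine sum_mem fun r hr => Submodule.smul_mem _ _ (Finsupp.single_mem_supported R 1 ?_)
    change (σ.erase r).card = i
    rw [Finset.card_erase_of_mem hr, show σ.card = i + 1 from hp]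
    rfl
  exact this hu

theorem hookH_mem_column {i : ℕ} {u : HookModule R n}
    (hu : u ∈ Finsupp.supported R R (columnSet n i)) :
    hookH u ∈ Finsupp.supported R R (columnSet n (i + 1)) := by
  rw [Finsupp.supported_eq_span_single] at hu
  have : Submodule.span R ((fun i => Finsupp.single i (1 : R)) '' columnSet n i) ≤
      (Finsupp.supported R R (columnSet n (i + 1))).comap hookH := by
    rw [Submodule.span_le]
    rintro _ ⟨⟨σ, α⟩, hp, rfl⟩
    change hookH (hook σ α : HookModule R n) ∈ Finsupp.supported R R _
    by_cases hz : σ.card + α.degree ≠ 0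
    · obtain ⟨s, hs⟩ := exists_isLeastIndex hz
      by_cases hsσ : s ∈ σ
      · rw [hookH_hook_of_mem hs hsσ]; exact zero_mem _
      · rw [hookH_hook_of_notMem hs hsσ]
        refine Finsupp.single_mem_supported R 1 ?_
        change (insert s σ).card = i + 1
        rw [Finset.card_insert_of_notMem hsσ, show σ.card = i from hp]
    · have h1 : σ = ∅ := by rw [← Finset.card_eq_zero]; omega
      have h2 : α = 0 := by rw [← Finsupp.degree_eq_zero_iff]; omega
      subst h1 h2
      simp [hookH, hookSupport]
  exact this hu

/-- An ideal multiple of a free module consists of the elements with coordinates in the ideal. -/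
theorem mem_ideal_smul_top_finsupp {ι : Type*} {J : Ideal R} {u : ι →₀ R} :
    u ∈ J • (⊤ : Submodule R (ι →₀ R)) ↔ ∀ p, u p ∈ J := by
  constructor
  · intro h p
    refine Submodule.smul_induction_on h (fun r hr m _ => ?_) fun x y hx hy => ?_
    · simpa using Ideal.mul_mem_right _ _ hr
    · simpa using add_mem hx hy
  · intro h
    rw [← Finsupp.sum_single u]
    refine sum_mem fun p _ => ?_
    have : Finsupp.single p (u p) = u p • Finsupp.single p 1 := by simp
    rw [this]
    exact Submodule.smul_mem_smul (h p) trivial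

theorem map_mem_ideal_smul_top {M N : Type*} [AddCommGroup M] [Module R M] [AddCommGroup N]
    [Module R N] (f : M →ₗ[R] N) {J : Ideal R} {u : M} (hu : u ∈ J • (⊤ : Submodule R M)) :
    f u ∈ J • (⊤ : Submodule R N) := by
  have := Submodule.mem_map_of_mem (f := f) hu
  rw [Submodule.map_smul''] at this
  exact Submodule.smul_mono le_rfl le_top this

end Combinatorial

/-! ### Homology modulo a restricted power, for an abstract resolution of the residue ring -/

section Core

variable {R : Type u} [CommRing R] {n : ℕ} {E : Type*} [AddCommGroup E] [Module R E]

theorem mem_ideal_smul_top_iff_repr {ι : Type*} (b : Module.Basis ι R E) {J : Ideal R} {e : E} :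
    e ∈ J • (⊤ : Submodule R E) ↔ ∀ i, b.repr e i ∈ J := by
  rw [← mem_ideal_smul_top_finsupp]
  constructor
  · exact fun h => map_mem_ideal_smul_top b.repr.toLinearMap h
  · intro h
    simpa using map_mem_ideal_smul_top b.repr.symm.toLinearMap h

theorem mem_smul_top_of_smul_mem [Module.Free R E] {J : Ideal R} {t : R}
    (ht : ∀ r, t * r ∈ J → r ∈ J) {e : E} (he : t • e ∈ J • (⊤ : Submodule R E)) :
    e ∈ J • (⊤ : Submodule R E) := by
  rw [mem_ideal_smul_top_iff_repr (Module.Free.chooseBasis R E)] at he ⊢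
  intro i
  apply ht
  simpa using he i

theorem IsPermutablyRegular.coeff_mem_smul_top [Module.Free R E] {a : Fin n → R}
    (ha : IsPermutablyRegular a) {w : Fin n → ℕ} {d : ℕ} (c : (Fin n →₀ ℕ) → E)
    (h : ∑ α ∈ restrictedExponents w d, evalMonomial a α • c α ∈
      restrictedIdeal a w (d + 1) • (⊤ : Submodule R E))
    {α : Fin n →₀ ℕ} (hα : α ∈ restrictedExponents w d) :
    c α ∈ subsetIdeal a (freeIndices w α) • (⊤ : Submodule R E) := by
  rw [mem_ideal_smul_top_iff_repr (Module.Free.chooseBasis R E)] at h ⊢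
  intro i
  refine ha.coeff_mem (fun α => (Module.Free.chooseBasis R E).repr (c α) i) ?_ hα
  have := h i
  simpa [Finsupp.finsetSum_apply] using this

/-- The complex `(E, d)` is a resolution of `R/𝔪` with augmentation given by `one`, and `𝔪` acts
on it by null-homotopic maps. -/
structure IsResidueResolution (𝔪 : Ideal R) (d : E →ₗ[R] E) (one : E) : Prop where
  sq : ∀ c, d (d c) = 0
  exact : ∀ c, d c = 0 → ∃ (r : R) (b : E), c = r • one + d b
  one_boundary : ∀ (r : R) (b : E), r • one = d b → r ∈ 𝔪
  homotopy : ∀ x ∈ 𝔪, ∃ h : E →ₗ[R] E, ∀ c, d (h c) + h (d c) = x • c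

/-- The images `z_σ` of the `f_σ` under a lift of the Koszul complex of `a`. -/
structure IsKoszulFamily (a : Fin n → R) (d : E →ₗ[R] E) (one : E) (z : Finset (Fin n) → E) :
    Prop where
  empty : z ∅ = one
  apply : ∀ σ, d (z σ) = ∑ r ∈ σ, koszulSign R r σ • a r • z (σ.erase r)

variable {𝔪 : Ideal R} {d : E →ₗ[R] E} {one : E} {a : Fin n → R} {z : Finset (Fin n) → E}

/-- `𝔪` annihilates the homology modulo any ideal. -/
theorem IsResidueResolution.smul_mem (hE : IsResidueResolution 𝔪 d one) {J : Ideal R} {x : R}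
    (hx : x ∈ 𝔪) {c : E} (hc : d c ∈ J • (⊤ : Submodule R E)) :
    x • c ∈ LinearMap.range d ⊔ J • (⊤ : Submodule R E) := by
  obtain ⟨h, hh⟩ := hE.homotopy x hx
  rw [← hh c]
  exact Submodule.add_mem_sup ⟨_, rfl⟩ (map_mem_ideal_smul_top h hc)

theorem mem_subsetIdeal_smul_top_insert {T : Finset (Fin n)} {t : Fin n} {e : E} :
    e ∈ subsetIdeal a (insert t T) • (⊤ : Submodule R E) ↔
      ∃ q, e - a t • q ∈ subsetIdeal a T • (⊤ : Submodule R E) := by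
  rw [subsetIdeal_insert, Submodule.sup_smul, Submodule.mem_sup]
  constructor
  · rintro ⟨y, hy, j, hj, rfl⟩
    rw [Submodule.ideal_span_singleton_smul] at hy
    obtain ⟨q, -, rfl⟩ := (Submodule.mem_smul_pointwise_iff_exists y (a t) ⊤).1 hy
    exact ⟨q, by simpa using hj⟩
  · rintro ⟨q, hq⟩
    exact ⟨a t • q, Submodule.smul_mem_smul (Ideal.mem_span_singleton_self _) trivial, _, hq,
      by abel⟩

/-- Only the summand that removes `t` survives modulo the ideal of `T`. -/
theorem IsKoszulFamily.d_insert (hz : IsKoszulFamily a d one z) {T σ : Finset (Fin n)} {t : Fin n}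
    (ht : t ∉ T) (hσ : σ ⊆ T) :
    d (z (insert t σ)) - (koszulSign R t (insert t σ) * a t) • z σ ∈
      subsetIdeal a T • (⊤ : Submodule R E) := by
  have htσ : t ∉ σ := fun h => ht (hσ h)
  rw [hz.apply, Finset.sum_insert htσ, Finset.erase_insert htσ, mul_smul, add_sub_cancel_left]
  exact sum_mem fun r hr => Submodule.smul_mem _ _
    (Submodule.smul_mem_smul (mem_subsetIdeal (hσ hr)) trivial)

theorem IsKoszulFamily.d_mem (hz : IsKoszulFamily a d one z) {T σ : Finset (Fin n)} (hσ : σ ⊆ T) :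
    d (z σ) ∈ subsetIdeal a T • (⊤ : Submodule R E) := by
  rw [hz.apply]
  exact sum_mem fun r hr => Submodule.smul_mem _ _
    (Submodule.smul_mem_smul (mem_subsetIdeal (hσ hr)) trivial)

/-- The homology of `(E, d)` modulo the ideal generated by some of the entries of `a` has the
classes of the `z_σ` as basis. -/
theorem subset_homology [Module.Free R E] (hE : IsResidueResolution 𝔪 d one)
    (ha : IsPermutablyRegular a) (ham : ∀ j, a j ∈ 𝔪) (hz : IsKoszulFamily a d one z)
    (T : Finset (Fin n)) :
    (∀ c, d c ∈ subsetIdeal a T • (⊤ : Submodule R E) → ∃ (ρ : Finset (Fin n) → R) (b : E),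
      c - ∑ σ ∈ T.powerset, ρ σ • z σ - d b ∈ subsetIdeal a T • (⊤ : Submodule R E)) ∧
    (∀ (ρ : Finset (Fin n) → R) (b : E),
      ∑ σ ∈ T.powerset, ρ σ • z σ - d b ∈ subsetIdeal a T • (⊤ : Submodule R E) →
      ∀ σ ∈ T.powerset, ρ σ ∈ 𝔪) := by
  induction T using Finset.induction_on with
  | empty =>
    have h0 : subsetIdeal a ∅ • (⊤ : Submodule R E) = ⊥ := by simp [subsetIdeal]
    constructor
    · intro c hc
      rw [h0, Submodule.mem_bot] at hc
      obtain ⟨r, b, rfl⟩ := hE.exact c hc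
      refine ⟨fun _ => r, b, ?_⟩
      simp [hz.empty]
    · intro ρ b h σ hσ
      rw [h0, Submodule.mem_bot] at h
      rw [Finset.powerset_empty, Finset.mem_singleton] at hσ
      subst hσ
      refine hE.one_boundary _ b ?_
      simpa [sub_eq_zero, hz.empty] using h
  | insert t T htT ih =>
    obtain ⟨gen, ind⟩ := ih
    set N := subsetIdeal a T • (⊤ : Submodule R E) with hN
    have dN : ∀ {e}, e ∈ N → d e ∈ N := fun he => map_mem_ideal_smul_top d he
    have hreg : ∀ e, a t • e ∈ N → e ∈ N := fun e he =>
      mem_smul_top_of_smul_mem (ha T t htT) he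
    -- the boundary of a combination of the `z (insert t σ)`
    have hins : ∀ ρ : Finset (Fin n) → R,
        d (∑ σ ∈ T.powerset, (koszulSign R t (insert t σ) * ρ σ) • z (insert t σ)) -
          a t • ∑ σ ∈ T.powerset, ρ σ • z σ ∈ N := by
      intro ρ
      rw [map_sum, Finset.smul_sum, ← Finset.sum_sub_distrib]
      refine sum_mem fun σ hσ => ?_
      have h1 := Submodule.smul_mem _ (koszulSign R t (insert t σ) * ρ σ)
        (hz.d_insert htT (Finset.mem_powerset.1 hσ))
      convert h1 using 1
      rw [map_smul, smul_sub, smul_smul, smul_smul]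
      congr 2
      linear_combination (- a t * ρ σ) * koszulSign_mul_self R t (insert t σ)
    constructor
    · intro c hc
      -- Modulo `N` the boundary of `c` is `a t • e`. Applying `d` and cancelling `a t` makes `e` a
      -- cycle modulo `N`.
      obtain ⟨e, he⟩ := mem_subsetIdeal_smul_top_insert.1 hc
      have hde : d e ∈ N := hreg _ (by
        have := dN he
        rw [map_sub, hE.sq, map_smul, zero_sub] at this
        simpa using neg_mem this)
      obtain ⟨ρ, b, hb⟩ := gen e hde
      -- `y` is chosen with boundary `a t • ∑ ρ σ • z σ` modulo `N`, so that subtracting `y` and `a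
      -- t • b` turns `c` into a cycle modulo `N` itself.
      set y := ∑ σ ∈ T.powerset, (koszulSign R t (insert t σ) * ρ σ) • z (insert t σ) with hy
      have h1 : d (c - y - a t • b) ∈ N := by
        have h2 := sub_mem (add_mem he (Submodule.smul_mem _ (a t) hb)) (hins ρ)
        convert h2 using 1
        simp only [map_sub, map_smul, smul_sub, ← hy]
        abel
      obtain ⟨ρ', b', hb'⟩ := gen _ h1
      refine ⟨fun σ => if t ∈ σ then koszulSign R t σ * ρ (σ.erase t) else ρ' σ, b', ?_⟩
      rw [mem_subsetIdeal_smul_top_insert]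
      refine ⟨b, ?_⟩
      convert hb' using 1
      rw [Finset.sum_powerset_insert htT]
      have e1 : ∑ σ ∈ T.powerset, (if t ∈ σ then koszulSign R t σ * ρ (σ.erase t) else ρ' σ) • z σ
          = ∑ σ ∈ T.powerset, ρ' σ • z σ := Finset.sum_congr rfl fun σ hσ => by
        rw [if_neg fun h => htT (Finset.mem_powerset.1 hσ h)]
      have e2 : ∑ σ ∈ T.powerset, (if t ∈ insert t σ then koszulSign R t (insert t σ) *
          ρ ((insert t σ).erase t) else ρ' (insert t σ)) • z (insert t σ) = y :=
        Finset.sum_congr rfl fun σ hσ => by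
          rw [if_pos (Finset.mem_insert_self _ _),
            Finset.erase_insert fun h => htT (Finset.mem_powerset.1 hσ h)]
      rw [e1, e2]
      abel
    · intro ρ b h
      rw [Finset.sum_powerset_insert htT] at h
      have hd : ∀ σ ∈ T.powerset, d (z σ) ∈ N := fun σ hσ => hz.d_mem (Finset.mem_powerset.1 hσ)
      -- the coefficients of the `z (insert t σ)`
      have hcoef : ∀ σ ∈ T.powerset, ρ (insert t σ) ∈ 𝔪 := by
        obtain ⟨e, he⟩ := mem_subsetIdeal_smul_top_insert.1 h
        have h1 := dN he
        rw [map_sub, map_sub, map_add, hE.sq, sub_zero, map_smul] at h1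
        have h2 : d (∑ σ ∈ T.powerset, ρ σ • z σ) ∈ N := by
          rw [map_sum]
          exact sum_mem fun σ hσ => by
            rw [map_smul]
            exact Submodule.smul_mem _ _ (hd σ hσ)
        have h3 := hins fun σ => koszulSign R t (insert t σ) * ρ (insert t σ)
        simp only [← mul_assoc, koszulSign_mul_self, one_mul] at h3
        -- Modulo `N`, both the boundary of the `z (insert t σ)` part and that of `a t • e` are
        -- divisible by `a t`. After cancellation there is a relation among the `z σ` with `σ ⊆ T`,
        -- whose coefficients are the wanted ones up to sign.
        have h4 := hreg (∑ σ ∈ T.powerset, (koszulSign R t (insert t σ) * ρ (insert t σ)) • z σ -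
          d e) (by
            have := sub_mem (sub_mem h1 h2) h3
            convert this using 1
            rw [smul_sub]
            abel)
        intro σ hσ
        have h5 := ind _ e h4 σ hσ
        have h6 := Ideal.mul_mem_left _ (koszulSign R t (insert t σ)) h5
        rwa [← mul_assoc, koszulSign_mul_self, one_mul] at h6
      -- Terms with coefficients in `𝔪` are boundaries modulo the larger ideal, since `𝔪`
      -- annihilates homology. So they can be removed from the relation.
      have hdins : ∑ σ ∈ T.powerset, ρ (insert t σ) • z (insert t σ) ∈
          LinearMap.range d ⊔ subsetIdeal a (insert t T) • (⊤ : Submodule R E) :=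
        sum_mem fun σ hσ => hE.smul_mem (hcoef σ hσ)
          (hz.d_mem (Finset.insert_subset_insert _ (Finset.mem_powerset.1 hσ)))
      obtain ⟨_, ⟨b', rfl⟩, j, hj, hbj⟩ := Submodule.mem_sup.1 hdins
      rw [← hbj] at h
      have h' : ∑ σ ∈ T.powerset, ρ σ • z σ - d (b - b') ∈
          subsetIdeal a (insert t T) • (⊤ : Submodule R E) := by
        convert sub_mem h hj using 1
        rw [map_sub]
        abel
      obtain ⟨e, he⟩ := mem_subsetIdeal_smul_top_insert.1 h'
      have hde : d e ∈ N := hreg _ (by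
        have h1 := dN he
        rw [map_sub, map_sub, hE.sq, sub_zero, map_smul] at h1
        have h2 : d (∑ σ ∈ T.powerset, ρ σ • z σ) ∈ N := by
          rw [map_sum]
          exact sum_mem fun σ hσ => by
            rw [map_smul]
            exact Submodule.smul_mem _ _ (hd σ hσ)
        simpa using sub_mem h2 h1)
      obtain ⟨ρ', b'', hb''⟩ := gen e hde
      -- Expanding the cycle `e` in the `z σ` changes the coefficients `ρ σ` by multiples of `a t`,
      -- which is in `𝔪`.
      have h7 := ind (fun σ => ρ σ - a t * ρ' σ) (b - b' + a t • b'') (by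
        convert add_mem he (Submodule.smul_mem _ (a t) hb'') using 1
        simp only [sub_smul, Finset.sum_sub_distrib, mul_smul, smul_sub, Finset.smul_sum, map_add,
          map_smul]
        abel)
      have h8 : ∀ σ ∈ T.powerset, ρ σ ∈ 𝔪 := fun σ hσ => by
        have := add_mem (h7 σ hσ) (Ideal.mul_mem_right (ρ' σ) _ (ham t))
        simpa using this
      intro σ hσ
      rw [Finset.mem_powerset] at hσ
      by_cases htσ : t ∈ σ
      · rw [← Finset.insert_erase htσ]
        refine hcoef _ (Finset.mem_powerset.2 ?_)
        rwa [← Finset.subset_insert_iff]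
      · exact h8 σ (Finset.mem_powerset.2 ((Finset.subset_insert_iff_of_notMem htσ).1 hσ))

/-- The map `f_σ ⊗ f^α ↦ a^α z_σ`. -/
def hookEval (a : Fin n → R) (z : Finset (Fin n) → E) : HookModule R n →ₗ[R] E :=
  Finsupp.linearCombination R fun p => evalMonomial a p.2 • z p.1

theorem hookEval_hook (σ : Finset (Fin n)) (α : Fin n →₀ ℕ) :
    hookEval a z (hook σ α) = evalMonomial a α • z σ := by
  simp [hookEval]

/-- Both sides replace an index `r` of the column by a factor `a r`: on the left as a coefficient of
`d (z σ)`, on the right as an extra exponent. The connecting maps of the filtration by restricted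
powers are therefore κ. -/
theorem IsKoszulFamily.d_hookEval (hz : IsKoszulFamily a d one z) (u : HookModule R n) :
    d (hookEval a z u) = hookEval a z (hookD u) := by
  have : d ∘ₗ hookEval a z = hookEval a z ∘ₗ hookD := by
    refine Finsupp.lhom_ext' fun p => LinearMap.ext_ring ?_
    obtain ⟨σ, α⟩ := p
    change d (hookEval a z (hook σ α)) = hookEval a z (hookD (hook σ α))
    rw [hookEval_hook, map_smul, hz.apply, hookD_hook, map_sum, Finset.smul_sum]
    refine Finset.sum_congr rfl fun r _ => ?_
    rw [map_smul, hookEval_hook, evalMonomial_add, evalMonomial_single, smul_smul, smul_smul,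
      smul_smul]
    congr 1
    ring
  exact LinearMap.congr_fun this u

theorem hookEval_mem {w : Fin n → ℕ} {b : ℕ} {u : HookModule R n} (hu : u ∈ hookTerm R w b) :
    hookEval a z u ∈ restrictedIdeal a w b • (⊤ : Submodule R E) := by
  rw [hookEval, Finsupp.linearCombination_apply]
  refine sum_mem fun p hp => Submodule.smul_mem _ _ (Submodule.smul_mem_smul ?_ trivial)
  obtain ⟨hd, hw⟩ := hu hp
  exact evalMonomial_mem_restrictedIdeal (fun j => le_of_add_le_right (hw j)) hd

theorem sum_supported_eq {w : Fin n → ℕ} {b : ℕ} {u : HookModule R n}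
    (hu : u ∈ hookTerm R w b) {M : Type*} [AddCommMonoid M]
    (g : Finset (Fin n) × (Fin n →₀ ℕ) → R → M) (hg : ∀ p, g p 0 = 0) :
    u.sum g = ∑ α ∈ restrictedExponents w b, ∑ σ ∈ (freeIndices w α).powerset,
      g (σ, α) (u (σ, α)) := by
  classical
  rw [Finset.sum_sigma', Finsupp.sum]
  refine Finset.sum_of_injOn (fun p => ⟨p.2, p.1⟩) ?_ ?_ ?_ ?_
  · rintro ⟨σ, α⟩ _ ⟨τ, β⟩ _ h
    simp only [Sigma.mk.injEq, heq_eq_eq] at h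
    rw [h.1, h.2]
  · rintro ⟨σ, α⟩ hp
    obtain ⟨h1, h2⟩ := mem_hookSet_iff.1 (hu hp)
    simp [h1, h2]
  · rintro ⟨α, σ⟩ _ hnot
    have : u (σ, α) = 0 := by
      by_contra hne
      exact hnot ⟨(σ, α), by simpa using hne, rfl⟩
    rw [this, hg]
  · intro p _; rfl

theorem hookEval_eq_sum {w : Fin n → ℕ} {b : ℕ} {u : HookModule R n} (hu : u ∈ hookTerm R w b) :
    hookEval a z u = ∑ α ∈ restrictedExponents w b, evalMonomial a α •
      ∑ σ ∈ (freeIndices w α).powerset, u (σ, α) • z σ := by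
  rw [hookEval, Finsupp.linearCombination_apply, sum_supported_eq hu _ (by simp)]
  refine Finset.sum_congr rfl fun α _ => ?_
  rw [Finset.smul_sum]
  exact Finset.sum_congr rfl fun σ _ => smul_comm _ _ _

theorem exists_sum_of_mem_restrictedIdeal_smul_top {w : Fin n → ℕ} {b : ℕ} {e : E}
    (he : e ∈ restrictedIdeal a w b • (⊤ : Submodule R E)) :
    ∃ c : (Fin n →₀ ℕ) → E, e = ∑ α ∈ restrictedExponents w b, evalMonomial a α • c α := by
  classical
  refine Submodule.smul_induction_on he (fun r hr m _ => ?_) ?_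
  · rw [restrictedIdeal] at hr
    refine Submodule.span_induction ?_ ?_ ?_ ?_ hr
    · rintro _ ⟨α, hα, rfl⟩
      refine ⟨fun β => if β = α then m else 0, ?_⟩
      have hα' : α ∈ restrictedExponents w b := hα
      simp [hα']
    · exact ⟨0, by simp⟩
    · rintro x y _ _ ⟨c, hc⟩ ⟨c', hc'⟩
      exact ⟨c + c', by simp [add_smul, hc, hc', smul_add, Finset.sum_add_distrib]⟩
    · rintro x y _ ⟨c, hc⟩
      refine ⟨x • c, ?_⟩
      rw [smul_assoc, hc, Finset.smul_sum]
      exact Finset.sum_congr rfl fun α _ => smul_comm _ _ _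
  · rintro x y ⟨c, hc⟩ ⟨c', hc'⟩
    exact ⟨c + c', by simp [hc, hc', smul_add, Finset.sum_add_distrib]⟩

/-- If `j` is free in `α`, then `α + ε_j` still satisfies the bound `w`. This is the converse of
`IsPermutablyRegular.coeff_mem_smul_top`. -/
theorem evalMonomial_smul_mem {w : Fin n → ℕ} {b : ℕ} {α : Fin n →₀ ℕ}
    (hα : α ∈ restrictedExponents w b) {e : E}
    (he : e ∈ subsetIdeal a (freeIndices w α) • (⊤ : Submodule R E)) :
    evalMonomial a α • e ∈ restrictedIdeal a w (b + 1) • (⊤ : Submodule R E) := by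
  have hle : Ideal.span {evalMonomial a α} * subsetIdeal a (freeIndices w α) ≤
      restrictedIdeal a w (b + 1) := by
    rw [subsetIdeal, Ideal.span_mul_span', Ideal.span_le]
    rintro _ ⟨_, rfl, _, ⟨j, hj, rfl⟩, rfl⟩
    change evalMonomial a α * a j ∈ _
    rw [← evalMonomial_single a j, ← evalMonomial_add]
    obtain ⟨hw, hd⟩ := mem_restrictedExponents.1 hα
    refine evalMonomial_mem_restrictedIdeal (fun i => ?_) (by simp [hd])
    by_cases hij : i = j
    · subst hij
      have := mem_freeIndices.1 (Finset.mem_coe.1 hj)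
      simp; omega
    · simpa [Finsupp.single_eq_of_ne hij] using hw i
  have := Submodule.smul_mem_smul (Ideal.mem_span_singleton_self (evalMonomial a α)) he
  rw [← Submodule.mul_smul] at this
  exact Submodule.smul_mono hle le_rfl this

/-- If `κ(u)` vanishes modulo `𝔪`, then so does the class of the evaluation of `u`. -/
theorem hookEval_mem_of_hookD_mem (hE : IsResidueResolution 𝔪 d one)
    (hz : IsKoszulFamily a d one z) {w : Fin n → ℕ} {b : ℕ} {u : HookModule R n}
    (hu : u ∈ hookTerm R w b) (hpos : ∀ p ∈ u.support, p.1.card + p.2.degree ≠ 0)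
    (h : hookD u ∈ 𝔪 • (⊤ : Submodule R (HookModule R n))) :
    hookEval a z u ∈ LinearMap.range d ⊔ restrictedIdeal a w (b + 1) • (⊤ : Submodule R E) := by
  have h1 : hookH (hookD u) ∈ hookTerm R w b := hookH_mem_hookTerm (hookD_mem hu)
  have h2 : ∀ p, hookH (hookD u) p ∈ 𝔪 :=
    mem_ideal_smul_top_finsupp.1 (map_mem_ideal_smul_top (N := HookModule R n) hookH h)
  have h3 : hookEval a z (hookH (hookD u)) ∈
      LinearMap.range d ⊔ restrictedIdeal a w (b + 1) • (⊤ : Submodule R E) := by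
    rw [hookEval, Finsupp.linearCombination_apply]
    refine sum_mem fun p hp => hE.smul_mem (h2 p) ?_
    have h4 : hook p.1 p.2 ∈ hookTerm R w b := Finsupp.single_mem_supported R (1 : R) (h1 hp)
    have h5 := hookEval_mem (a := a) (z := z) (hookD_mem h4)
    rwa [← hz.d_hookEval, hookEval_hook] at h5
  have h6 : hookEval a z u = d (hookEval a z (hookH u)) + hookEval a z (hookH (hookD u)) := by
    rw [hz.d_hookEval, ← map_add, homotopy_apply hpos]
  rw [h6]
  exact add_mem (Submodule.mem_sup_left ⟨_, rfl⟩) h3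

theorem evalMonomial_mem_maximal (ham : ∀ j, a j ∈ 𝔪) {α : Fin n →₀ ℕ} (h : α ≠ 0) :
    evalMonomial a α ∈ 𝔪 := by
  obtain ⟨s, hs⟩ := Finsupp.ne_iff.1 h
  rw [evalMonomial_of_pos a hs]
  exact Ideal.mul_mem_right _ _ (ham s)

theorem restrictedIdeal_succ_le (a : Fin n → R) (w : Fin n → ℕ) (b : ℕ) :
    restrictedIdeal a w (b + 1) ≤ restrictedIdeal a w b := by
  conv_lhs => rw [restrictedIdeal]
  rw [Ideal.span_le]
  rintro _ ⟨α, hα, rfl⟩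
  obtain ⟨hw, hd⟩ := mem_restrictedExponents.1 hα
  obtain ⟨s, hs⟩ : ∃ s, α s ≠ 0 := by
    by_contra! h
    have : α = 0 := Finsupp.ext h
    simp [this] at hd
  rw [evalMonomial_of_pos a hs]
  refine Ideal.mul_mem_left _ _ (evalMonomial_mem_restrictedIdeal
    (fun j => (Finsupp.le_def.1 tsub_le_self j).trans (hw j)) ?_)
  have := degree_tsub_single_add hs
  omega

theorem exists_eq_sum_hookTerm (w : Fin n → ℕ) (b : ℕ)
    (ρ : (Fin n →₀ ℕ) → Finset (Fin n) → R) :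
    ∃ u ∈ hookTerm R w b, ∀ α ∈ restrictedExponents w b, ∀ σ ∈ (freeIndices w α).powerset,
      u (σ, α) = ρ α σ := by
  classical
  refine ⟨∑ α ∈ restrictedExponents w b, ∑ σ ∈ (freeIndices w α).powerset,
    ρ α σ • hook σ α, ?_, ?_⟩
  · exact sum_mem fun α hα => sum_mem fun σ hσ => Submodule.smul_mem _ _
      (Finsupp.single_mem_supported R 1 (mem_hookSet_iff.2 ⟨hα, Finset.mem_powerset.1 hσ⟩))
  · intro α hα σ hσ
    rw [Finsupp.finsetSum_apply, Finset.sum_eq_single_of_mem α hα, Finsupp.finsetSum_apply,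
      Finset.sum_eq_single_of_mem σ hσ]
    · simp
    · intro τ _ hτ
      simp [hτ]
    · intro β _ hβ
      rw [Finsupp.finsetSum_apply]
      exact Finset.sum_eq_zero fun τ _ => by simp [hβ]

/-- The symbols `f_σ ⊗ f^α` of multidegree at most `w` and different from `0`, with
`|α| = b - 1`. -/
def prevHookSet (w : Fin n → ℕ) (b : ℕ) : Set (Finset (Fin n) × (Fin n →₀ ℕ)) :=
  {p | p.2.degree + 1 = b ∧ p.1.card + p.2.degree ≠ 0 ∧
    ∀ j, (if j ∈ p.1 then 1 else 0) + p.2 j ≤ w j}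

theorem mem_hookTerm_of_mem_prev {w : Fin n → ℕ} {b : ℕ} {u : HookModule R n}
    (hu : u ∈ Finsupp.supported R R (prevHookSet w (b + 1))) : u ∈ hookTerm R w b :=
  fun p hp => ⟨by have := (hu hp).1; omega, (hu hp).2.2⟩

theorem eq_zero_of_mem_prev_zero {w : Fin n → ℕ} {u : HookModule R n}
    (hu : u ∈ Finsupp.supported R R (prevHookSet w 0)) : u = 0 := by
  rw [← Finsupp.support_eq_empty, Finset.eq_empty_iff_forall_notMem]
  intro p hp
  have := (hu hp).1
  omega

theorem hookD_mem_of_mem_prev {w : Fin n → ℕ} {b : ℕ} {u : HookModule R n}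
    (hu : u ∈ Finsupp.supported R R (prevHookSet w b)) : hookD u ∈ hookTerm R w b := by
  cases b with
  | zero => rw [eq_zero_of_mem_prev_zero hu, map_zero]; exact zero_mem _
  | succ b => exact hookD_mem (mem_hookTerm_of_mem_prev hu)

theorem mem_ideal_smul_top_of_coeff {w : Fin n → ℕ} {b : ℕ} {u : HookModule R n}
    (hu : u ∈ hookTerm R w b)
    (h : ∀ α ∈ restrictedExponents w b, ∀ σ ∈ (freeIndices w α).powerset, u (σ, α) ∈ 𝔪) :
    u ∈ 𝔪 • (⊤ : Submodule R (HookModule R n)) := by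
  refine mem_ideal_smul_top_finsupp.2 fun ⟨σ, α⟩ => ?_
  by_cases hp : (σ, α) ∈ u.support
  · obtain ⟨h1, h2⟩ := mem_hookSet_iff.1 (hu hp)
    exact h α h1 σ (Finset.mem_powerset.2 h2)
  · rw [Finsupp.notMem_support_iff.1 hp]; exact zero_mem _

/-- Every cycle modulo a restricted power is homologous to a combination of the `a^α z_σ`. -/
theorem exists_hookEval_of_cycle [Module.Free R E] (hE : IsResidueResolution 𝔪 d one)
    (ha : IsPermutablyRegular a) (ham : ∀ j, a j ∈ 𝔪) (hz : IsKoszulFamily a d one z)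
    (w : Fin n → ℕ) (b : ℕ) :
    ∀ c, d c ∈ restrictedIdeal a w b • (⊤ : Submodule R E) →
      ∃ u ∈ Finsupp.supported R R (prevHookSet w b), ∃ (e : E) (r : R),
        c - hookEval a z u - d e - r • one ∈ restrictedIdeal a w b • (⊤ : Submodule R E) := by
  have hd1 : d one = 0 := by
    rw [← hz.empty, hz.apply, Finset.sum_empty]
  induction b with
  | zero =>
    intro c _
    refine ⟨0, zero_mem _, 0, 0, ?_⟩
    have : restrictedIdeal a w 0 = ⊤ := by
      rw [Ideal.eq_top_iff_one, ← evalMonomial_zero a]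
      exact evalMonomial_mem_restrictedIdeal (by simp) (by simp)
    rw [this, Submodule.top_smul]
    trivial
  | succ b ih =>
    intro c hc
    obtain ⟨u, hu, e, r, hj⟩ := ih c (Submodule.smul_mono (restrictedIdeal_succ_le a w b) le_rfl hc)
    -- Comparing the boundaries of the two sides in I_b/I_{b+1}, the coefficient of each `a^α` is a
    -- combination of the `z σ`, with coefficients from κ(u), that is a boundary modulo J_α.
    -- Independence in `subset_homology` puts these coefficients in `𝔪`.
    have hκ : hookD u ∈ 𝔪 • (⊤ : Submodule R (HookModule R n)) := by
      obtain ⟨g, hg⟩ := exists_sum_of_mem_restrictedIdeal_smul_top hj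
      refine mem_ideal_smul_top_of_coeff (hookD_mem_of_mem_prev hu) fun α hα => ?_
      refine (subset_homology hE ha ham hz (freeIndices w α)).2 (fun σ => hookD u (σ, α)) (-g α) ?_
      refine ha.coeff_mem_smul_top (fun α => ∑ σ ∈ (freeIndices w α).powerset,
        hookD u (σ, α) • z σ - d (-g α)) ?_ hα
      have h1 := congrArg d hg
      simp only [map_sub, map_sum, map_smul, hE.sq, hd1, smul_zero, sub_zero] at h1
      rw [hz.d_hookEval, hookEval_eq_sum (hookD_mem_of_mem_prev hu), sub_eq_iff_eq_add'] at h1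
      convert hc using 1
      rw [h1, ← Finset.sum_add_distrib]
      exact Finset.sum_congr rfl fun α _ => by rw [map_neg, sub_neg_eq_add, smul_add]
    -- Hence the combination from the previous layer is itself a boundary modulo I_b and can be
    -- absorbed. What remains of `c` is a boundary, a multiple of `one`, and an element of I_b E.
    have hev : hookEval a z u ∈
        LinearMap.range d ⊔ restrictedIdeal a w b • (⊤ : Submodule R E) := by
      cases b with
      | zero => rw [eq_zero_of_mem_prev_zero hu, map_zero]; exact zero_mem _
      | succ b =>
        exact hookEval_mem_of_hookD_mem hE hz (mem_hookTerm_of_mem_prev hu)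
          (fun p hp => (hu hp).2.1) hκ
    obtain ⟨_, ⟨e', rfl⟩, j', hj', hev⟩ := Submodule.mem_sup.1 hev
    obtain ⟨g, hg⟩ := exists_sum_of_mem_restrictedIdeal_smul_top (add_mem hj hj')
    have hcg : c = d (e + e') + r • one + ∑ α ∈ restrictedExponents w b, evalMonomial a α • g α := by
      rw [← hg, ← hev, map_add]
      abel
    -- Each coefficient `g α` is now a cycle modulo J_α, so the generation half of `subset_homology`
    -- expands it in the `z σ` with `σ` free.
    have hdg : ∀ α ∈ restrictedExponents w b,
        d (g α) ∈ subsetIdeal a (freeIndices w α) • (⊤ : Submodule R E) := fun α hα => by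
      refine ha.coeff_mem_smul_top (fun α => d (g α)) ?_ hα
      rw [hcg] at hc
      simpa only [map_add, map_sum, map_smul, hE.sq, hd1, smul_zero, zero_add] using hc
    have hgen : ∀ α, ∃ (ρ : Finset (Fin n) → R) (y : E), α ∈ restrictedExponents w b →
        g α - ∑ σ ∈ (freeIndices w α).powerset, ρ σ • z σ - d y ∈
          subsetIdeal a (freeIndices w α) • (⊤ : Submodule R E) := fun α => by
      by_cases hα : α ∈ restrictedExponents w b
      · obtain ⟨ρ, y, h⟩ := (subset_homology hE ha ham hz (freeIndices w α)).1 _ (hdg α hα)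
        exact ⟨ρ, y, fun _ => h⟩
      · exact ⟨0, 0, fun h => absurd h hα⟩
    choose ρ y hρ using hgen
    obtain ⟨u', hu', hu'ρ⟩ := exists_eq_sum_hookTerm w b ρ
    -- The symbol with empty column and exponent 0, which can occur only for `b = 0`, evaluates to
    -- `one` and is moved into the coefficient `r`.
    refine ⟨u'.erase (∅, 0), ?_,
      e + e' + ∑ α ∈ restrictedExponents w b, evalMonomial a α • y α, r + u' (∅, 0), ?_⟩
    · intro p hp
      rw [Finsupp.support_erase] at hp
      obtain ⟨hp0, hp⟩ := Finset.mem_erase.1 hp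
      obtain ⟨h1, h2⟩ := hu' hp
      refine ⟨by rw [h1], fun h0 => hp0 ?_, h2⟩
      refine Prod.ext ?_ ?_
      · exact Finset.card_eq_zero.1 (by omega)
      · exact (Finsupp.degree_eq_zero_iff _).1 (by omega)
    · have h1 : hookEval a z (u'.erase (∅, 0)) = hookEval a z u' - u' (∅, 0) • one := by
        rw [eq_sub_iff_add_eq', ← hz.empty]
        conv_rhs => rw [← Finsupp.single_add_erase (∅, 0) u', map_add]
        simp [hookEval]
      have h2 : c - hookEval a z (u'.erase (∅, 0)) -
          d (e + e' + ∑ α ∈ restrictedExponents w b, evalMonomial a α • y α) -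
            (r + u' (∅, 0)) • one = ∑ α ∈ restrictedExponents w b, evalMonomial a α •
              (g α - ∑ σ ∈ (freeIndices w α).powerset, ρ α σ • z σ - d (y α)) := by
        have h3 : hookEval a z u' = ∑ α ∈ restrictedExponents w b, evalMonomial a α •
            ∑ σ ∈ (freeIndices w α).powerset, ρ α σ • z σ := by
          rw [hookEval_eq_sum hu']
          refine Finset.sum_congr rfl fun α hα => ?_
          rw [Finset.sum_congr rfl fun σ hσ => by rw [hu'ρ α hα σ hσ]]
        simp only [smul_sub, Finset.sum_sub_distrib, h1, ← h3, map_add, map_sum, map_smul, add_smul]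
        conv_lhs => enter [1, 1, 1]; rw [hcg]
        rw [map_add]
        abel
      rw [h2]
      exact sum_mem fun α hα => evalMonomial_smul_mem hα (hρ α hα)

/-- If a combination of the `a^α z_σ` is a boundary modulo a restricted power, then its image under
the tautological Koszul differential vanishes modulo `𝔪`. -/
theorem hookD_mem_of_hookEval_mem [Module.Free R E] (hE : IsResidueResolution 𝔪 d one)
    (ha : IsPermutablyRegular a) (ham : ∀ j, a j ∈ 𝔪) (hz : IsKoszulFamily a d one z)
    {w : Fin n → ℕ} {b : ℕ} {u : HookModule R n} (hu : u ∈ hookTerm R w b)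
    (h : hookEval a z u ∈
      LinearMap.range d ⊔ restrictedIdeal a w (b + 1) • (⊤ : Submodule R E)) :
    hookD u ∈ 𝔪 • (⊤ : Submodule R (HookModule R n)) := by
  have hd1 : d one = 0 := by
    rw [← hz.empty, hz.apply, Finset.sum_empty]
  obtain ⟨_, ⟨y, rfl⟩, j, hj, hyj⟩ := Submodule.mem_sup.1 h
  have hy : d y ∈ restrictedIdeal a w b • (⊤ : Submodule R E) := by
    rw [eq_sub_of_add_eq hyj]
    exact sub_mem (hookEval_mem hu) (Submodule.smul_mono (restrictedIdeal_succ_le a w b) le_rfl hj)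
  obtain ⟨u', hu', e, r, he⟩ := exists_hookEval_of_cycle hE ha ham hz w b y hy
  obtain ⟨g, hg⟩ := exists_sum_of_mem_restrictedIdeal_smul_top he
  -- A bounding element `y` is a cycle modulo I_b, hence comes from some `u'` one layer below, and
  -- its boundary evaluates κ(u'). So `u` and κ(u') agree modulo `𝔪` by independence in each layer,
  -- and applying κ once more removes κ(u').
  have h1 : u - hookD u' ∈ 𝔪 • (⊤ : Submodule R (HookModule R n)) := by
    have hmem := hookD_mem_of_mem_prev hu'
    refine mem_ideal_smul_top_of_coeff (sub_mem hu hmem) fun α hα => ?_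
    refine (subset_homology hE ha ham hz (freeIndices w α)).2
      (fun σ => (u - hookD u') (σ, α)) (g α) ?_
    refine ha.coeff_mem_smul_top (fun α => ∑ σ ∈ (freeIndices w α).powerset,
        (u - hookD u') (σ, α) • z σ - d (g α)) ?_ hα
    convert hj using 1
    simp only [smul_sub, Finset.sum_sub_distrib]
    have h2 := congrArg d hg
    simp only [map_sub, map_sum, map_smul, hE.sq, hd1, smul_zero, sub_zero] at h2
    rw [← hookEval_eq_sum (sub_mem hu hmem), ← h2, map_sub, ← hyj, hz.d_hookEval]
    abel
  have h2 := map_mem_ideal_smul_top hookD h1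
  rwa [map_sub, hookD_hookD, sub_zero] at h2

end Core

/-! ### The Koszul differential in coordinates -/

section Exterior

variable {R : Type u} [CommRing R] {M : Type v} [AddCommGroup M] [Module R M] {n : ℕ}

/-- The Koszul differential on the whole exterior algebra. -/
abbrev extD (φ : Module.Dual R M) : ExteriorAlgebra R M →ₗ[R] ExteriorAlgebra R M :=
  CliffordAlgebra.contractLeft (Q := (0 : QuadraticForm R M)) φ

theorem extD_ι_mul (φ : Module.Dual R M) (v : M) (c : ExteriorAlgebra R M) :
    extD φ (ExteriorAlgebra.ι R v * c) = φ v • c - ExteriorAlgebra.ι R v * extD φ c :=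
  CliffordAlgebra.contractLeft_ι_mul _ _ _

theorem extD_one (φ : Module.Dual R M) : extD φ (1 : ExteriorAlgebra R M) = 0 :=
  CliffordAlgebra.contractLeft_one _ _

theorem extD_algebraMap (φ : Module.Dual R M) (r : R) :
    extD φ (algebraMap R (ExteriorAlgebra R M) r) = 0 :=
  CliffordAlgebra.contractLeft_algebraMap _ _ _

theorem extD_extD (φ : Module.Dual R M) (c : ExteriorAlgebra R M) : extD φ (extD φ c) = 0 :=
  CliffordAlgebra.contractLeft_contractLeft _ _

theorem extD_comm (φ φ' : Module.Dual R M) (c : ExteriorAlgebra R M) :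
    extD φ (extD φ' c) = -extD φ' (extD φ c) :=
  CliffordAlgebra.contractLeft_comm _ _ _

theorem extD_map {N : Type*} [AddCommGroup N] [Module R N] (φ : Module.Dual R N) (g : M →ₗ[R] N)
    (c : ExteriorAlgebra R M) :
    extD φ (ExteriorAlgebra.map g c) = ExteriorAlgebra.map g (extD (φ ∘ₗ g) c) := by
  induction c using CliffordAlgebra.left_induction with
  | algebraMap r =>
    change extD φ (ExteriorAlgebra.map g (algebraMap R (ExteriorAlgebra R M) r)) =
      ExteriorAlgebra.map g (extD (φ ∘ₗ g) (algebraMap R (ExteriorAlgebra R M) r))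
    rw [AlgHom.commutes, extD_algebraMap, extD_algebraMap, map_zero]
  | add x y hx hy => simp only [map_add, hx, hy]
  | ι_mul x v hx =>
    change extD φ (ExteriorAlgebra.map g (ExteriorAlgebra.ι R v * x)) =
      ExteriorAlgebra.map g (extD (φ ∘ₗ g) (ExteriorAlgebra.ι R v * x))
    rw [map_mul, ExteriorAlgebra.map_apply_ι, extD_ι_mul, extD_ι_mul, hx, map_sub, map_mul,
      map_smul, ExteriorAlgebra.map_apply_ι]
    rfl

variable (f : Module.Basis (Fin n) R M)

theorem extBasis_empty : f.ExteriorAlgebra ∅ = 1 := by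
  rw [ExteriorAlgebra.basis_apply_ofCard f (n := 0) (by simp), ExteriorAlgebra.ιMulti_family,
    ExteriorAlgebra.ιMulti_zero_apply]

theorem extBasis_insert {s : Fin n} {τ : Finset (Fin n)} (h : ∀ r ∈ τ, s < r) :
    f.ExteriorAlgebra (insert s τ) = ExteriorAlgebra.ι R (f s) * f.ExteriorAlgebra τ := by
  have hs : s ∉ τ := fun hs => lt_irrefl _ (h s hs)
  have hcard : (insert s τ).card = τ.card + 1 := Finset.card_insert_of_notMem hs
  rw [ExteriorAlgebra.basis_apply_ofCard f hcard, ExteriorAlgebra.basis_apply_ofCard f rfl,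
    ExteriorAlgebra.ιMulti_family, ExteriorAlgebra.ιMulti_family,
    ExteriorAlgebra.ιMulti_succ_apply]
  have key : (fun i : Fin (τ.card + 1) => (Fin.cons s (τ.orderEmbOfFin rfl) : Fin (τ.card + 1) → Fin n) i) =
      (insert s τ).orderEmbOfFin hcard := by
    refine Finset.orderEmbOfFin_unique hcard (fun i => ?_) ?_
    · refine Fin.cases ?_ (fun j => ?_) i
      · simp
      · simp
    · refine Fin.strictMono_iff_lt_succ.2 fun i => ?_
      have hlt : ∀ j : Fin (τ.card + 1), j < i.succ →
          (Fin.cons s (τ.orderEmbOfFin rfl) : Fin (τ.card + 1) → Fin n) j <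
            (Fin.cons s (τ.orderEmbOfFin rfl) : Fin (τ.card + 1) → Fin n) i.succ := by
        intro j
        refine Fin.cases ?_ (fun j => ?_) j
        · intro _
          simpa using h _ (Finset.orderEmbOfFin_mem τ rfl i)
        · intro hj
          simpa using hj
      exact hlt _ Fin.castSucc_lt_succ
  have h0 : ∀ i, (insert s τ).orderEmbOfFin hcard i =
    (Fin.cons s (τ.orderEmbOfFin rfl) : Fin (τ.card + 1) → Fin n) i := fun i =>
      (congrFun key i).symm
  congr 1
  · congr 1
    exact congrArg f (h0 0)
  · congr 1
    funext i
    change f ((insert s τ).orderEmbOfFin hcard i.succ) = _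
    rw [h0]
    rfl

theorem extD_extBasis (φ : Module.Dual R M) (σ : Finset (Fin n)) :
    extD φ (f.ExteriorAlgebra σ) =
      ∑ r ∈ σ, koszulSign R r σ • φ (f r) • f.ExteriorAlgebra (σ.erase r) := by
  induction σ using Finset.induction_on_min with
  | empty => rw [extBasis_empty, Finset.sum_empty, extD_one]
  | insert s τ hs ih =>
    have hsτ : s ∉ τ := fun h => lt_irrefl _ (hs s h)
    rw [extBasis_insert f hs, extD_ι_mul, ih, Finset.sum_insert hsτ, Finset.erase_insert hsτ,
      koszulSign_eq_one R (σ := insert s τ), one_smul, sub_eq_add_neg, Finset.mul_sum,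
      ← Finset.sum_neg_distrib]
    · congr 1
      refine Finset.sum_congr rfl fun r hr => ?_
      rw [koszulSign_insert_of_lt R hsτ (hs r hr), Finset.erase_insert_of_ne (hs r hr).ne,
        extBasis_insert f fun q hq => hs q (Finset.mem_of_mem_erase hq), neg_smul,
        mul_smul_comm, mul_smul_comm]
    · intro r hr
      rcases Finset.mem_insert.1 hr with rfl | hr
      exacts [le_rfl, (hs r hr).le]

theorem algebraMapInv_extBasis (σ : Finset (Fin n)) :
    ExteriorAlgebra.algebraMapInv (f.ExteriorAlgebra σ) = if σ = ∅ then 1 else 0 := by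
  induction σ using Finset.induction_on_min with
  | empty => rw [extBasis_empty, map_one, if_pos rfl]
  | insert s τ hs ih =>
    rw [extBasis_insert f hs, map_mul, if_neg (Finset.insert_ne_empty _ _)]
    simp [ExteriorAlgebra.algebraMapInv]

/-! ### Acyclicity of the Koszul complex of a regular sequence -/

/-- The part of the exterior algebra that is generated by the first `p` basis vectors. -/
def IsInitial (p : ℕ) (c : ExteriorAlgebra R M) : Prop :=
  ∀ j : Fin n, p ≤ j → extD (f.coord j) c = 0

variable {f}

theorem IsInitial.add {p : ℕ} {c c' : ExteriorAlgebra R M} (h : IsInitial f p c)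
    (h' : IsInitial f p c') : IsInitial f p (c + c') := fun j hj => by
  rw [map_add, h j hj, h' j hj, add_zero]

theorem IsInitial.smul {p : ℕ} {c : ExteriorAlgebra R M} (r : R) (h : IsInitial f p c) :
    IsInitial f p (r • c) := fun j hj => by
  rw [map_smul, h j hj, smul_zero]

theorem IsInitial.sub {p : ℕ} {c c' : ExteriorAlgebra R M} (h : IsInitial f p c)
    (h' : IsInitial f p c') : IsInitial f p (c - c') := fun j hj => by
  rw [map_sub, h j hj, h' j hj, sub_zero]

theorem IsInitial.extD {p : ℕ} {c : ExteriorAlgebra R M} (φ : Module.Dual R M)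
    (h : IsInitial f p c) : IsInitial f p (RestrictedPower.extD φ c) := fun j hj => by
  rw [extD_comm, h j hj, map_zero, neg_zero]

theorem IsInitial.mono {p q : ℕ} (hpq : p ≤ q) {c : ExteriorAlgebra R M} (h : IsInitial f p c) :
    IsInitial f q c := fun j hj => h j (hpq.trans hj)

theorem IsInitial.ι_mul {p : ℕ} {c : ExteriorAlgebra R M} (h : IsInitial f p c) {i : Fin n}
    (hi : (i : ℕ) < p) : IsInitial f p (ExteriorAlgebra.ι R (f i) * c) := fun j hj => by
  have : i ≠ j := fun h => by subst h; omega
  rw [extD_ι_mul, h j hj, mul_zero, sub_zero, Module.Basis.coord_apply, Module.Basis.repr_self,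
    Finsupp.single_eq_of_ne this.symm, zero_smul]

/-- Contraction with the coordinate `j` sends the basis element of `τ ∋ j` to that of `τ.erase j` up
to sign. The coefficient of `σ.erase j` in the contraction of `c` is therefore, up to sign, the
coefficient of `σ` in `c`. -/
theorem IsInitial.repr_eq_zero {p : ℕ} {c : ExteriorAlgebra R M} (h : IsInitial f p c)
    {σ : Finset (Fin n)} {j : Fin n} (hj : j ∈ σ) (hpj : p ≤ j) :
    f.ExteriorAlgebra.repr c σ = 0 := by
  have h1 := h j hpj
  rw [← f.ExteriorAlgebra.linearCombination_repr c, Finsupp.linearCombination_apply, Finsupp.sum,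
    map_sum] at h1
  have h2 : ∀ τ : Finset (Fin n), RestrictedPower.extD (f.coord j) (f.ExteriorAlgebra τ) =
      if j ∈ τ then koszulSign R j τ • f.ExteriorAlgebra (τ.erase j) else 0 := by
    intro τ
    rw [extD_extBasis]
    split_ifs with hjτ
    · rw [Finset.sum_eq_single_of_mem j hjτ]
      · simp
      · intro r _ hr
        simp [Finsupp.single_eq_of_ne hr.symm]
    · refine Finset.sum_eq_zero fun r hr => ?_
      have : j ≠ r := fun h => hjτ (h ▸ hr)
      simp [Finsupp.single_eq_of_ne this]
  have h3 := congrArg (fun e => f.ExteriorAlgebra.repr e (σ.erase j)) h1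
  simp only [map_smul, h2, map_sum, Finsupp.finsetSum_apply, Finsupp.smul_apply, map_zero,
    Finsupp.zero_apply] at h3
  by_cases hσ : σ ∈ (f.ExteriorAlgebra.repr c).support
  · rw [Finset.sum_eq_single_of_mem σ hσ] at h3
    · rw [if_pos hj, map_smul, Module.Basis.repr_self, Finsupp.smul_apply, Finsupp.single_eq_same,
        smul_eq_mul, smul_eq_mul, mul_one] at h3
      calc f.ExteriorAlgebra.repr c σ
          = f.ExteriorAlgebra.repr c σ * koszulSign R j σ * koszulSign R j σ := by
            rw [mul_assoc, koszulSign_mul_self, mul_one]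
        _ = 0 := by rw [h3, zero_mul]
    · intro τ _ hτ
      split_ifs with hjτ
      · have : σ.erase j ≠ τ.erase j := fun h => hτ (by
          rw [← Finset.insert_erase hj, h, Finset.insert_erase hjτ])
        simp [Finsupp.single_eq_of_ne this]
      · simp
  · exact Finsupp.notMem_support_iff.1 hσ

/-- The constant term of a boundary is a combination of the `φ (f j)`. This is how membership in
ideals is extracted from equations in the exterior algebra. -/
theorem algebraMapInv_extD (φ : Module.Dual R M) (c : ExteriorAlgebra R M) :
    ExteriorAlgebra.algebraMapInv (extD φ c) = ∑ j, f.ExteriorAlgebra.repr c {j} * φ (f j) := by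
  have : (ExteriorAlgebra.algebraMapInv (R := R) (M := M)).toLinearMap ∘ₗ extD φ =
      ∑ j, φ (f j) • f.ExteriorAlgebra.coord {j} := by
    refine f.ExteriorAlgebra.ext fun σ => ?_
    simp only [LinearMap.comp_apply, extD_extBasis, AlgHom.toLinearMap_apply, map_sum, map_smul,
      algebraMapInv_extBasis, LinearMap.sum_apply, LinearMap.smul_apply, Module.Basis.coord_apply,
      Module.Basis.repr_self]
    by_cases hσ : ∃ j, σ = {j}
    · obtain ⟨j, rfl⟩ := hσ
      rw [Finset.sum_singleton, koszulSign_eq_one R (by simp), Finset.sum_eq_single_of_mem j (by simp)]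
      · simp
      · intro i _ hi
        have : ({i} : Finset (Fin n)) ≠ {j} := by simpa using hi
        simp [Finsupp.single_eq_of_ne this]
    · push Not at hσ
      rw [Finset.sum_eq_zero, Finset.sum_eq_zero]
      · intro i _
        simp [Finsupp.single_eq_of_ne (hσ i).symm]
      · intro r hr
        have : σ.erase r ≠ ∅ := fun h => hσ r (by
          rw [← Finset.insert_erase hr, h]; rfl)
        simp [this]
  have h := LinearMap.congr_fun this c
  simpa [mul_comm] using h

theorem isInitial_zero_iff {c : ExteriorAlgebra R M} (h : IsInitial f 0 c) :
    c = ExteriorAlgebra.algebraMapInv c • (1 : ExteriorAlgebra R M) := by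
  have h1 : c = f.ExteriorAlgebra.repr c ∅ • (1 : ExteriorAlgebra R M) := by
    conv_lhs => rw [← f.ExteriorAlgebra.linearCombination_repr c,
      Finsupp.linearCombination_apply]
    rw [Finsupp.sum_eq_single ∅, extBasis_empty]
    · intro σ _ hσ
      obtain ⟨j, hj⟩ := Finset.nonempty_iff_ne_empty.2 hσ
      rw [h.repr_eq_zero hj (Nat.zero_le _), zero_smul]
    · simp
  conv_rhs => rw [h1, map_smul, map_one, smul_eq_mul, mul_one]
  exact h1

/-- Induction on the number of basis vectors involved. The coefficient of the last vector `f i` in a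
cycle is itself a cycle, so it is a constant `r` plus a boundary. Removing the boundary shows that
`φ (f i) * r` lies in the ideal of the earlier entries. Regularity then makes `r` a boundary too,
and the last vector can be eliminated. -/
theorem exact_of_regular (φ : Module.Dual R M)
    (hreg : ∀ i r, φ (f i) * r ∈ subsetIdeal (fun j => φ (f j)) (Finset.univ.filter (· < i)) →
      r ∈ subsetIdeal (fun j => φ (f j)) (Finset.univ.filter (· < i)))
    (p : ℕ) (hp : p ≤ n) : ∀ c, IsInitial f p c → extD φ c = 0 →
      ∃ (r : R) (b : ExteriorAlgebra R M), IsInitial f p b ∧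
        c = r • (1 : ExteriorAlgebra R M) + extD φ b := by
  induction p with
  | zero =>
    intro c hc _
    exact ⟨_, 0, fun j _ => map_zero _, by rw [map_zero, add_zero]; exact isInitial_zero_iff hc⟩
  | succ p ih =>
    intro c hc hdc
    set i : Fin n := ⟨p, hp⟩ with hi
    have hcoord : f.coord i (f i) = 1 := by simp
    -- the coefficient of the last basis vector
    have init_coef : IsInitial f p (extD (f.coord i) c) := fun j hj => by
      rcases Nat.eq_or_lt_of_le hj with h | h
      · have : j = i := Fin.ext h.symm
        rw [this, extD_extD]
      · rw [extD_comm, hc j h, map_zero, neg_zero]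
    have d_coef : extD φ (extD (f.coord i) c) = 0 := by rw [extD_comm, hdc, map_zero, neg_zero]
    -- subtracting the boundary of `e_i b`
    have step : ∀ b : ExteriorAlgebra R M, IsInitial f p b →
        IsInitial f (p + 1) (c + extD φ (ExteriorAlgebra.ι R (f i) * b)) ∧
        extD (f.coord i) (c + extD φ (ExteriorAlgebra.ι R (f i) * b)) =
          extD (f.coord i) c - extD φ b := by
      intro b hb
      refine ⟨hc.add (((hb.mono (Nat.le_succ p)).ι_mul (Nat.lt_succ_self p)).extD φ), ?_⟩
      rw [map_add, extD_comm, extD_ι_mul, hcoord, one_smul, hb i le_rfl, mul_zero, sub_zero,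
        sub_eq_add_neg]
    have descend : ∀ e : ExteriorAlgebra R M, IsInitial f (p + 1) e → extD (f.coord i) e = 0 →
        IsInitial f p e := fun e he h0 j hj => by
      rcases Nat.eq_or_lt_of_le hj with h | h
      · rw [show j = i from Fin.ext h.symm, h0]
      · exact he j h
    obtain ⟨r, b, hb, hrb⟩ := ih (by omega) _ init_coef d_coef
    -- the constant `r` is a boundary
    obtain ⟨g, hg, hgr⟩ : ∃ g : ExteriorAlgebra R M, IsInitial f p g ∧
        extD φ g = r • (1 : ExteriorAlgebra R M) := by
      obtain ⟨s1, s2⟩ := step b hb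
      set e := c + extD φ (ExteriorAlgebra.ι R (f i) * b) - r • ExteriorAlgebra.ι R (f i) with he
      have hιi : ExteriorAlgebra.ι R (f i) = ExteriorAlgebra.ι R (f i) * 1 := (mul_one _).symm
      have hone : ∀ q, IsInitial f q (1 : ExteriorAlgebra R M) := fun q j _ => extD_one _
      have he1 : IsInitial f p e := by
        refine descend e (s1.sub (IsInitial.smul r ?_)) ?_
        · rw [hιi]
          exact (hone _).ι_mul (Nat.lt_succ_self p)
        · rw [he, map_sub, s2, hrb, map_smul, hιi, extD_ι_mul, hcoord, extD_one]
          simp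
      have he2 : extD φ e = -(φ (f i) * r) • (1 : ExteriorAlgebra R M) := by
        rw [he, map_sub, map_add, hdc, extD_extD, map_smul, hιi, extD_ι_mul, extD_one, mul_zero,
          sub_zero, smul_smul, add_zero, zero_sub, neg_smul, mul_comm]
      have hmem : φ (f i) * r ∈ subsetIdeal (fun j => φ (f j)) (Finset.univ.filter (· < i)) := by
        have h1 := congrArg ExteriorAlgebra.algebraMapInv he2
        rw [algebraMapInv_extD (f := f), map_smul, map_one, smul_eq_mul, mul_one] at h1
        rw [← neg_mem_iff, ← h1]
        refine sum_mem fun j _ => ?_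
        by_cases hj : p ≤ j
        · rw [he1.repr_eq_zero (Finset.mem_singleton_self j) hj, zero_mul]
          exact zero_mem _
        · refine Ideal.mul_mem_left _ _ (mem_subsetIdeal (a := fun j => φ (f j)) ?_)
          simp only [Finset.mem_filter, Finset.mem_univ, true_and, Fin.lt_def, hi]
          omega
      have hr := hreg i r hmem
      rw [subsetIdeal] at hr
      refine Submodule.span_induction ?_ ?_ ?_ ?_ hr
      · rintro _ ⟨j, hj, rfl⟩
        have hj' : j < i := by simpa using hj
        refine ⟨ExteriorAlgebra.ι R (f j) * 1, (hone _).ι_mul hj', ?_⟩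
        rw [extD_ι_mul, extD_one, mul_zero, sub_zero]
      · exact ⟨0, fun j _ => map_zero _, by simp⟩
      · rintro x y _ _ ⟨g, hg, hgx⟩ ⟨g', hg', hgy⟩
        exact ⟨g + g', hg.add hg', by rw [map_add, hgx, hgy, add_smul]⟩
      · rintro x y _ ⟨g, hg, hgx⟩
        exact ⟨x • g, hg.smul x, by rw [map_smul, hgx, smul_assoc]⟩
    obtain ⟨s1, s2⟩ := step (g + b) (hg.add hb)
    rw [hrb, map_add (extD φ), hgr, sub_self] at s2
    obtain ⟨r', b', hb', hrb'⟩ := ih (by omega) _ (descend _ s1 s2)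
      (by rw [map_add, hdc, extD_extD, add_zero])
    refine ⟨r', b' - ExteriorAlgebra.ι R (f i) * (g + b), (hb'.mono (Nat.le_succ p)).sub
      (((hg.add hb).mono (Nat.le_succ p)).ι_mul (Nat.lt_succ_self p)), ?_⟩
    rw [map_sub, ← add_sub_assoc, ← hrb']
    abel

end Exterior

/-! ### Exact Koszul complexes as resolutions -/

section FormOf

variable {R : Type u} [CommRing R] {m : ℕ}

/-- Exactness of the Koszul complex in positive degrees. -/
def IsKoszulExact (x : Fin m → R) : Prop :=
  ∀ c, extD (formOf x) c = 0 → ∃ (r : R) (b : ExteriorAlgebra R (Fin m → R)),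
    c = r • (1 : ExteriorAlgebra R (Fin m → R)) + extD (formOf x) b

instance exteriorAlgebra_free : Module.Free R (ExteriorAlgebra R (Fin m → R)) :=
  Module.Free.of_basis (Pi.basisFun R (Fin m)).ExteriorAlgebra

theorem formOf_basisFun (x : Fin m → R) (j : Fin m) : formOf x (Pi.basisFun R (Fin m) j) = x j := by
  simp [formOf, Fintype.linearCombination_apply, Pi.single_apply]

theorem isKoszulExact_of_regular {x : Fin m → R}
    (hreg : ∀ i r, x i * r ∈ subsetIdeal x (Finset.univ.filter (· < i)) →
      r ∈ subsetIdeal x (Finset.univ.filter (· < i))) : IsKoszulExact x := by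
  intro c hc
  obtain ⟨r, b, -, h⟩ := exact_of_regular (f := Pi.basisFun R (Fin m)) (formOf x)
    (by simpa only [formOf_basisFun] using hreg) m le_rfl c (fun j hj => by omega) hc
  exact ⟨r, b, h⟩

/-- A linear change of coordinates induces an isomorphism of exterior algebras that intertwines the
two differentials. It is used for linear changes of variables in the polynomial ring. -/
theorem IsKoszulExact.comp_equiv {x y : Fin m → R} (hx : IsKoszulExact x)
    (g : (Fin m → R) ≃ₗ[R] (Fin m → R)) (hg : formOf x ∘ₗ g.toLinearMap = formOf y) :
    IsKoszulExact y := by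
  intro c hc
  have hinv : ∀ c, ExteriorAlgebra.map g.symm.toLinearMap
      (ExteriorAlgebra.map g.toLinearMap c) = c := fun c => by
    have := ExteriorAlgebra.map_comp_map g.toLinearMap g.symm.toLinearMap
    rw [← AlgHom.comp_apply, this]
    simp
  obtain ⟨r, b, h⟩ := hx (ExteriorAlgebra.map g.toLinearMap c) (by
    rw [extD_map, hg, hc, map_zero])
  refine ⟨r, ExteriorAlgebra.map g.symm.toLinearMap b, ?_⟩
  have h1 := congrArg (ExteriorAlgebra.map g.symm.toLinearMap) h
  rw [hinv, map_add, map_smul, map_one] at h1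
  rw [h1, extD_map, ← hg, LinearMap.comp_assoc]
  simp

theorem mem_span_range_iff {x : Fin m → R} {r : R} :
    r ∈ Ideal.span (Set.range x) ↔ ∃ g, formOf x g = r := by
  rw [← Set.mem_range, ← LinearMap.coe_range, Fintype.range_linearCombination]
  rfl

/-- An element of the ideal is `formOf x g` for some vector `g`, and left multiplication by `g` is a
null-homotopy of the multiplication by that element. -/
theorem IsKoszulExact.isResidueResolution {x : Fin m → R} (hx : IsKoszulExact x) :
    IsResidueResolution (Ideal.span (Set.range x)) (extD (formOf x)) 1 where
  sq := extD_extD _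
  exact := hx
  one_boundary r b h := by
    have h1 := congrArg ExteriorAlgebra.algebraMapInv h
    rw [map_smul, map_one, smul_eq_mul, mul_one,
      algebraMapInv_extD (f := Pi.basisFun R (Fin m))] at h1
    rw [h1]
    refine sum_mem fun j _ => Ideal.mul_mem_left _ _ (Ideal.subset_span ⟨j, ?_⟩)
    rw [formOf_basisFun]
  homotopy y hy := by
    obtain ⟨g, rfl⟩ := mem_span_range_iff.1 hy
    refine ⟨LinearMap.mulLeft R (ExteriorAlgebra.ι R g), fun c => ?_⟩
    rw [LinearMap.mulLeft_apply, LinearMap.mulLeft_apply, extD_ι_mul, sub_add_cancel]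

end FormOf

/-! ### Homogeneous components of the exterior algebra -/

section Components

variable {R : Type u} [CommRing R] {M : Type v} [AddCommGroup M] [Module R M]

/-- The component of degree `i` of an element of the exterior algebra. -/
def extComponent (R : Type u) [CommRing R] (M : Type v) [AddCommGroup M] [Module R M] (i : ℕ) :
    ExteriorAlgebra R M →ₗ[R] ⋀[R]^i M :=
  DirectSum.component R ℕ (fun i => ⋀[R]^i M) i ∘ₗ
    (DirectSum.decomposeLinearEquiv (fun i => ⋀[R]^i M)).toLinearMap

theorem extComponent_coe {i : ℕ} (y : ⋀[R]^i M) : extComponent R M i y = y := by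
  change (DirectSum.decompose (fun i => ⋀[R]^i M) (y : ExteriorAlgebra R M)) i = y
  rw [DirectSum.decompose_coe, DirectSum.of_eq_same]

theorem extComponent_of_ne {i j : ℕ} (h : j ≠ i) {y : ExteriorAlgebra R M} (hy : y ∈ ⋀[R]^j M) :
    extComponent R M i y = 0 := by
  change (DirectSum.decompose (fun i => ⋀[R]^i M) y) i = 0
  lift y to ⋀[R]^j M using hy
  rw [DirectSum.decompose_coe, DirectSum.of_eq_of_ne _ _ _ h.symm]

theorem extD_of_mem_zero (φ : Module.Dual R M) {y : ExteriorAlgebra R M} (hy : y ∈ ⋀[R]^0 M) :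
    extD φ y = 0 := by
  obtain ⟨r, rfl⟩ : ∃ r, algebraMap R (ExteriorAlgebra R M) r = y := by
    simpa [ExteriorAlgebra.exteriorPower, Submodule.mem_one] using hy
  exact extD_algebraMap _ _

/-- The arguments above run on the whole exterior algebra; this transports their conclusions to
single degrees. -/
theorem koszulD_extComponent (φ : Module.Dual R M) (i : ℕ) (c : ExteriorAlgebra R M) :
    koszulD φ i (extComponent R M (i + 1) c) = extComponent R M i (extD φ c) := by
  induction c using DirectSum.Decomposition.inductionOn (fun i => ⋀[R]^i M) with
  | zero => simp
  | add x y hx hy => simp only [map_add, hx, hy]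
  | @homogeneous j y =>
    by_cases hj : j = i + 1
    · subst hj
      rw [extComponent_coe]
      exact (extComponent_coe (koszulD φ i y)).symm
    · rw [extComponent_of_ne hj y.2, map_zero]
      cases j with
      | zero => rw [extD_of_mem_zero φ y.2, map_zero]
      | succ j =>
        rw [extComponent_of_ne (j := j) (by omega) (contractLeft_mem φ j y.2)]

theorem koszulD_coe (φ : Module.Dual R M) (i : ℕ) (y : ⋀[R]^(i + 1) M) :
    (koszulD φ i y : ExteriorAlgebra R M) = extD φ y := rfl

theorem coe_mem_ideal_smul_top_iff {J : Ideal R} {i : ℕ} {y : ⋀[R]^i M} :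
    (y : ExteriorAlgebra R M) ∈ J • (⊤ : Submodule R (ExteriorAlgebra R M)) ↔
      y ∈ J • (⊤ : Submodule R (⋀[R]^i M)) := by
  constructor
  · intro h
    have := map_mem_ideal_smul_top (extComponent R M i) h
    rwa [extComponent_coe] at this
  · exact fun h => map_mem_ideal_smul_top (⋀[R]^i M).subtype h

end Components

/-! ### Koszul homology modulo an ideal, in terms of representatives -/

section Homology

variable {R : Type u} [CommRing R] {M : Type v} [AddCommGroup M] [Module R M]

theorem one_tmul_eq_zero_iff {I : Ideal R} {y : M} :
    (1 : R ⧸ I) ⊗ₜ[R] y = 0 ↔ y ∈ I • (⊤ : Submodule R M) := by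
  rw [← (TensorProduct.quotTensorEquivQuotSMul M I).map_eq_zero_iff, ← map_one (Ideal.Quotient.mk I),
    TensorProduct.quotTensorEquivQuotSMul_mk_tmul, one_smul, Submodule.Quotient.mk_eq_zero]

theorem exists_one_tmul {M : Type*} [AddCommMonoid M] [Module R M] {I : Ideal R}
    (t : (R ⧸ I) ⊗[R] M) : ∃ y : M, t = 1 ⊗ₜ[R] y := by
  induction t using TensorProduct.induction_on with
  | zero => exact ⟨0, by simp⟩
  | tmul r y =>
    obtain ⟨r, rfl⟩ := Ideal.Quotient.mk_surjective r
    refine ⟨r • y, ?_⟩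
    rw [← TensorProduct.smul_tmul, Algebra.smul_def, mul_one]
    rfl
  | add t t' h h' =>
    obtain ⟨y, rfl⟩ := h
    obtain ⟨y', rfl⟩ := h'
    exact ⟨y + y', by rw [TensorProduct.tmul_add]⟩

variable {φ : Module.Dual R M} {I : Ideal R} {i : ℕ}

theorem one_tmul_mem_cycles_iff {y : ⋀[R]^i M} :
    (1 : R ⧸ I) ⊗ₜ[R] y ∈ koszulCycles φ (R ⧸ I) i ↔
      extD φ (y : ExteriorAlgebra R M) ∈ I • (⊤ : Submodule R (ExteriorAlgebra R M)) := by
  cases i with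
  | zero =>
    rw [extD_of_mem_zero φ y.2]
    exact ⟨fun _ => zero_mem _, fun _ => trivial⟩
  | succ i =>
    rw [koszulCycles, LinearMap.mem_ker, LinearMap.lTensor_tmul, one_tmul_eq_zero_iff,
      ← coe_mem_ideal_smul_top_iff, koszulD_coe]

/-- A bounding element in the whole exterior algebra may be inhomogeneous; its component of degree
`i + 1` already has the required boundary modulo `I`. -/
theorem one_tmul_mem_boundaries_iff {y : ⋀[R]^i M} :
    (1 : R ⧸ I) ⊗ₜ[R] y ∈ koszulBoundaries φ (R ⧸ I) i ↔
      (y : ExteriorAlgebra R M) ∈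
        LinearMap.range (extD φ) ⊔ I • (⊤ : Submodule R (ExteriorAlgebra R M)) := by
  rw [koszulBoundaries, LinearMap.mem_range]
  constructor
  · rintro ⟨t, ht⟩
    obtain ⟨b, rfl⟩ := exists_one_tmul t
    rw [LinearMap.lTensor_tmul, eq_comm, ← sub_eq_zero, ← TensorProduct.tmul_sub,
      one_tmul_eq_zero_iff, ← coe_mem_ideal_smul_top_iff] at ht
    have : (y : ExteriorAlgebra R M) = extD φ b + (y - koszulD φ i b : ⋀[R]^i M) := by
      rw [← koszulD_coe, AddSubgroupClass.coe_sub]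
      abel
    rw [this]
    exact Submodule.add_mem_sup ⟨_, rfl⟩ ht
  · intro h
    obtain ⟨_, ⟨b, rfl⟩, j, hj, hbj⟩ := Submodule.mem_sup.1 h
    refine ⟨1 ⊗ₜ extComponent R M (i + 1) b, ?_⟩
    rw [LinearMap.lTensor_tmul, koszulD_extComponent, eq_comm, ← sub_eq_zero,
      ← TensorProduct.tmul_sub, one_tmul_eq_zero_iff]
    have h1 := map_mem_ideal_smul_top (extComponent R M i) hj
    rw [eq_sub_of_add_eq' hbj, map_sub, extComponent_coe] at h1
    exact h1

variable (φ I i) in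
/-- The elements of degree `i` that are cycles modulo `I`. -/
def cyclesMod : Submodule R (⋀[R]^i M) :=
  (I • (⊤ : Submodule R (ExteriorAlgebra R M))).comap (extD φ ∘ₗ (⋀[R]^i M).subtype)

theorem mem_cyclesMod {y : ⋀[R]^i M} : y ∈ cyclesMod φ I i ↔
    extD φ (y : ExteriorAlgebra R M) ∈ I • (⊤ : Submodule R (ExteriorAlgebra R M)) := Iff.rfl

variable (φ I i) in
/-- The homology class of a cycle modulo `I`. -/
def classMap : cyclesMod φ I i →ₗ[R] KoszulHomology φ (R ⧸ I) i :=
  Submodule.mkQ _ ∘ₗ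
    ((TensorProduct.mk R (R ⧸ I) (⋀[R]^i M) 1) ∘ₗ (cyclesMod φ I i).subtype).codRestrict
      (koszulCycles φ (R ⧸ I) i) fun y => one_tmul_mem_cycles_iff.2 y.2

theorem classMap_eq_zero_iff {y : cyclesMod φ I i} :
    classMap φ I i y = 0 ↔ ((y : ⋀[R]^i M) : ExteriorAlgebra R M) ∈
      LinearMap.range (extD φ) ⊔ I • (⊤ : Submodule R (ExteriorAlgebra R M)) := by
  rw [← one_tmul_mem_boundaries_iff]
  exact Submodule.Quotient.mk_eq_zero _

theorem classMap_surjective : Function.Surjective (classMap φ I i) := by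
  intro h
  obtain ⟨⟨t, ht⟩, rfl⟩ := Submodule.Quotient.mk_surjective _ h
  obtain ⟨y, rfl⟩ := exists_one_tmul t
  exact ⟨⟨y, one_tmul_mem_cycles_iff.1 ht⟩, rfl⟩

theorem isClassOf_iff {y : ⋀[R]^i M} {h : KoszulHomology φ (R ⧸ I) i} :
    IsClassOf φ (1 ⊗ₜ[R] y) h ↔ ∃ hy : y ∈ cyclesMod φ I i, h = classMap φ I i ⟨y, hy⟩ :=
  ⟨fun ⟨hy, e⟩ => ⟨one_tmul_mem_cycles_iff.1 hy, e⟩,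
    fun ⟨hy, e⟩ => ⟨one_tmul_mem_cycles_iff.2 hy, e⟩⟩

theorem IsClassOf.unique {N : Type*} [AddCommGroup N] [Module R N] {y : N ⊗[R] ⋀[R]^i M}
    {h h' : KoszulHomology φ N i} (hy : IsClassOf φ y h) (hy' : IsClassOf φ y h') : h = h' := by
  obtain ⟨_, rfl⟩ := hy
  obtain ⟨_, rfl⟩ := hy'
  rfl

theorem exists_residueEquiv {𝔪 : Ideal R} {L H : Type*} [AddCommMonoid L] [Module R L]
    [AddCommGroup H] [Module R H] (Φ : L →ₗ[R] H) (hsurj : Function.Surjective Φ)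
    (hker : ∀ l, Φ l = 0 ↔ l ∈ 𝔪 • (⊤ : Submodule R L)) :
    ∃ e : ((R ⧸ 𝔪) ⊗[R] L) ≃ₗ[R] H, ∀ l, e (1 ⊗ₜ[R] l) = Φ l := by
  let : AddCommGroup L := Module.addCommMonoidToAddCommGroup R
  have hk : 𝔪 • (⊤ : Submodule R L) = LinearMap.ker Φ := by
    ext l
    rw [LinearMap.mem_ker, hker]
  refine ⟨(TensorProduct.quotTensorEquivQuotSMul L 𝔪).trans
    ((Submodule.quotEquivOfEq _ _ hk).trans (Φ.quotKerEquivOfSurjective hsurj)), fun l => ?_⟩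
  rw [← map_one (Ideal.Quotient.mk 𝔪), LinearEquiv.trans_apply,
    TensorProduct.quotTensorEquivQuotSMul_mk_tmul, one_smul]
  rfl

end Homology

/-! ### Lifts of the Koszul complex of ψ -/

section Lifts

variable {R : Type u} [CommRing R] {F : Type v} [AddCommGroup F] [Module R F] {n : ℕ}
  {G : Type*} [AddCommGroup G] [Module R G] (f : Module.Basis (Fin n) R F)
  {ψ : Module.Dual R F} {φ : Module.Dual R G}

theorem restrictedPower_eq (ψ : Module.Dual R F) (w : Fin n → ℕ) (d : ℕ) :
    restrictedPower f ψ w d = restrictedIdeal (fun j => ψ (f j)) w d := by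
  rw [restrictedPower, restrictedIdeal]
  congr 1
  ext r
  simp only [Set.mem_ofPred_eq, Set.mem_image, SetLike.mem_coe, mem_restrictedExponents]
  exact ⟨fun ⟨α, h1, h2, h3⟩ => ⟨α, ⟨h1, h2⟩, h3.symm⟩,
    fun ⟨α, ⟨h1, h2⟩, h3⟩ => ⟨α, h1, h2, h3.symm⟩⟩

theorem extBasis_mem (σ : Finset (Fin n)) : f.ExteriorAlgebra σ ∈ ⋀[R]^σ.card F := by
  have := ExteriorAlgebra.basis_eq_coe_basis f (Set.powersetCard.ofCard (s := σ) rfl)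
  change f.ExteriorAlgebra σ = _ at this
  rw [this]
  exact Subtype.property _

theorem wedge_coe {a : ℕ} (σ : Set.powersetCard (Fin n) a) :
    (wedge f σ : ExteriorAlgebra R F) = f.ExteriorAlgebra σ :=
  (ExteriorAlgebra.basis_apply_powersetCard f σ).symm

theorem wedge_eq_extComponent {a : ℕ} (σ : Set.powersetCard (Fin n) a) :
    wedge f σ = extComponent R F a (f.ExteriorAlgebra σ) := by
  rw [← wedge_coe, extComponent_coe]

/-- The elements `z_σ` of a lift, as elements of the exterior algebra. -/
def liftFamily (ℓ : KoszulLift ψ φ) (σ : Finset (Fin n)) : ExteriorAlgebra R G :=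
  ℓ.lift σ.card (extComponent R F σ.card (f.ExteriorAlgebra σ))

theorem liftFamily_mem (ℓ : KoszulLift ψ φ) (σ : Finset (Fin n)) :
    liftFamily f ℓ σ ∈ ⋀[R]^σ.card G := Subtype.property _

theorem liftFamily_coe (ℓ : KoszulLift ψ φ) {a : ℕ} (σ : Set.powersetCard (Fin n) a) :
    liftFamily f ℓ σ = (ℓ.lift a (wedge f σ) : ExteriorAlgebra R G) := by
  obtain ⟨σ, rfl⟩ := σ
  rw [wedge_eq_extComponent]
  rfl

theorem unit₀_coe : (unit₀ R F : ExteriorAlgebra R F) = 1 := by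
  have : unit₀ R F = exteriorPower.ιMulti R 0 (fun i => i.elim0) := by
    rw [unit₀, LinearEquiv.symm_apply_eq, exteriorPower.zeroEquiv_ιMulti]
  rw [this, exteriorPower.ιMulti_apply_coe, ExteriorAlgebra.ιMulti_zero_apply]

/-- The chain map equation evaluated on basis elements. No multiplicativity of the lift enters,
which is why the homology computation holds for every lift. -/
theorem isKoszulFamily_liftFamily (ℓ : KoszulLift ψ φ) :
    IsKoszulFamily (fun j => ψ (f j)) (extD φ) 1 (liftFamily f ℓ) where
  empty := by
    have h : extComponent R F 0 (1 : ExteriorAlgebra R F) = unit₀ R F := by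
      rw [← unit₀_coe, extComponent_coe]
    change (ℓ.lift 0 (extComponent R F 0 (f.ExteriorAlgebra ∅)) : ExteriorAlgebra R G) = 1
    rw [extBasis_empty, h, ℓ.lift_zero, unit₀_coe]
  apply σ := by
    cases hc : σ.card with
    | zero =>
      rw [extD_of_mem_zero φ (hc ▸ liftFamily_mem f ℓ σ), Finset.card_eq_zero.1 hc,
        Finset.sum_empty]
    | succ i =>
      have h1 : liftFamily f ℓ σ =
          (ℓ.lift (i + 1) (extComponent R F (i + 1) (f.ExteriorAlgebra σ)) :
            ExteriorAlgebra R G) := by rw [liftFamily, hc]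
      have h2 := LinearMap.congr_fun (ℓ.comm i) (extComponent R F (i + 1) (f.ExteriorAlgebra σ))
      rw [LinearMap.comp_apply, LinearMap.comp_apply, koszulD_extComponent, extD_extBasis] at h2
      rw [h1, ← koszulD_coe, h2]
      simp only [map_sum, map_smul, Submodule.coe_sum, Submodule.coe_smul]
      refine Finset.sum_congr rfl fun r hr => ?_
      rw [liftFamily, Finset.card_erase_of_mem hr, hc]
      rfl

theorem liftedElement_coe {m : ℕ} {x : Fin m → R} (ℓ : KoszulLift ψ (formOf x)) {i : ℕ}
    (σ : Set.powersetCard (Fin n) i) (α : Fin n →₀ ℕ) :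
    (liftedElement f ψ ℓ σ α : ExteriorAlgebra R (Fin m → R)) =
      hookEval (fun j => ψ (f j)) (liftFamily f ℓ) (hook σ α) := by
  rw [hookEval_hook, liftFamily_coe]
  rfl

theorem exteriorPower_map_coe (g : F →ₗ[R] G) (i : ℕ) (y : ⋀[R]^i F) :
    (exteriorPower.map i g y : ExteriorAlgebra R G) = ExteriorAlgebra.map g y := by
  have : (⋀[R]^i G).subtype ∘ₗ exteriorPower.map i g =
      (ExteriorAlgebra.map g).toLinearMap ∘ₗ (⋀[R]^i F).subtype := by
    refine exteriorPower.linearMap_ext ?_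
    ext v
    simp
  exact LinearMap.congr_fun this y

/-- A linear map over `R` induces a multiplicative lift. -/
def KoszulLift.ofLinearMap (g : F →ₗ[R] G) (hg : φ ∘ₗ g = ψ) : KoszulLift ψ φ where
  lift i := exteriorPower.map i g
  lift_zero := by
    apply Subtype.ext
    rw [exteriorPower_map_coe, unit₀_coe, unit₀_coe, map_one]
  comm i := by
    ext1
    ext v
    simp only [LinearMap.compAlternatingMap_apply, LinearMap.comp_apply, koszulD_coe,
      exteriorPower_map_coe, extD_map, hg]

theorem liftFamily_ofLinearMap (g : F →ₗ[R] G) (hg : φ ∘ₗ g = ψ) (σ : Finset (Fin n)) :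
    liftFamily f (KoszulLift.ofLinearMap g hg) σ =
      ExteriorAlgebra.map g (f.ExteriorAlgebra σ) := by
  change (exteriorPower.map σ.card g _ : ExteriorAlgebra R G) = _
  rw [exteriorPower_map_coe]
  congr 1
  have : f.ExteriorAlgebra σ = ((⟨f.ExteriorAlgebra σ, extBasis_mem f σ⟩ : ⋀[R]^σ.card F) :
    ExteriorAlgebra R F) := rfl
  rw [this, extComponent_coe]

/-- Since `F` is free, ψ factors through the form of `x`. The induced map of exterior algebras is a
multiplicative lift, so lifts exist. -/
theorem exists_linearMap_of_mem {m : ℕ} {x : Fin m → R}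
    (h : ∀ j, ψ (f j) ∈ Ideal.span (Set.range x)) :
    ∃ g : F →ₗ[R] (Fin m → R), formOf x ∘ₗ g = ψ := by
  choose g hg using fun j => mem_span_range_iff.1 (h j)
  refine ⟨f.constr R g, f.ext fun j => ?_⟩
  rw [LinearMap.comp_apply, Module.Basis.constr_basis, hg]

/-! ### Degrees of evaluated elements -/

theorem hookEval_mem_exteriorPower {a : Fin n → R} {z : Finset (Fin n) → ExteriorAlgebra R G}
    (hz : ∀ σ, z σ ∈ ⋀[R]^σ.card G) {i : ℕ} {u : HookModule R n}
    (hu : u ∈ Finsupp.supported R R (columnSet n i)) : hookEval a z u ∈ ⋀[R]^i G := by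
  rw [hookEval, Finsupp.linearCombination_apply]
  refine sum_mem fun p hp => Submodule.smul_mem _ _ (Submodule.smul_mem _ _ ?_)
  have : p.1.card = i := hu hp
  exact this ▸ hz p.1

open Classical in
theorem extComponent_hookEval {a : Fin n → R} {z : Finset (Fin n) → ExteriorAlgebra R G}
    (hz : ∀ σ, z σ ∈ ⋀[R]^σ.card G) (i : ℕ) (u : HookModule R n) :
    (extComponent R G i (hookEval a z u) : ExteriorAlgebra R G) =
      hookEval a z (u.filter (· ∈ columnSet n i)) := by
  have h1 : u.filter (· ∈ columnSet n i) ∈ Finsupp.supported R R (columnSet n i) := by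
    intro p hp
    rw [Finset.mem_coe, Finsupp.support_filter] at hp
    exact (Finset.mem_filter.1 hp).2
  have h2 : extComponent R G i (hookEval a z (u.filter (· ∉ columnSet n i))) = 0 := by
    rw [hookEval, Finsupp.linearCombination_apply, Finsupp.sum, map_sum]
    refine Finset.sum_eq_zero fun p hp => ?_
    rw [Finsupp.support_filter] at hp
    rw [map_smul, map_smul, extComponent_of_ne (Finset.mem_filter.1 hp).2 (hz p.1), smul_zero,
      smul_zero]
  conv_lhs => rw [← Finsupp.filter_add_filter_not u (· ∈ columnSet n i), map_add, map_add, h2,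
    add_zero]
  have h3 : hookEval a z (u.filter (· ∈ columnSet n i)) =
    ((⟨_, hookEval_mem_exteriorPower (a := a) hz h1⟩ : ⋀[R]^i G) : ExteriorAlgebra R G) := rfl
  rw [h3, extComponent_coe]

end Lifts

/-! ### Coordinates on ⋀F ⊗ S and the modules L -/

section TensorTerms

variable {R : Type u} [CommRing R] {F : Type v} [AddCommGroup F] [Module R F] {n : ℕ}
  (f : Module.Basis (Fin n) R F)

/-- The component in `⋀^a F ⊗ S` of a combination of the symbols `f_σ ⊗ f^α`. -/
def ofHook (a : ℕ) : HookModule R n →ₗ[R] ⋀[R]^a F ⊗[R] MvPolynomial (Fin n) R :=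
  Finsupp.linearCombination R fun p =>
    extComponent R F a (f.ExteriorAlgebra p.1) ⊗ₜ[R] MvPolynomial.monomial p.2 1

/-- The coordinates of an element of `⋀^a F ⊗ S`. -/
def toHook (a : ℕ) : ⋀[R]^a F ⊗[R] MvPolynomial (Fin n) R →ₗ[R] HookModule R n :=
  Finsupp.lmapDomain R R (fun p : Set.powersetCard (Fin n) a × (Fin n →₀ ℕ) =>
      ((p.1 : Finset (Fin n)), p.2)) ∘ₗ
    ((f.exteriorPower a).tensorProduct (MvPolynomial.basisMonomials (Fin n) R)).repr.toLinearMap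

theorem ofHook_hook {a : ℕ} (σ : Finset (Fin n)) (α : Fin n →₀ ℕ) :
    ofHook f a (hook σ α) =
      extComponent R F a (f.ExteriorAlgebra σ) ⊗ₜ[R] MvPolynomial.monomial α 1 := by
  simp [ofHook]

theorem ofHook_hook_coe {a : ℕ} (σ : Set.powersetCard (Fin n) a) (α : Fin n →₀ ℕ) :
    ofHook f a (hook σ α) = wedgeMonomial f σ α := by
  rw [ofHook_hook, wedgeMonomial, wedge_eq_extComponent]

theorem ofHook_hook_of_card_ne {a : ℕ} {σ : Finset (Fin n)} (h : σ.card ≠ a) (α : Fin n →₀ ℕ) :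
    ofHook f a (hook σ α) = 0 := by
  rw [ofHook_hook, extComponent_of_ne h (extBasis_mem f σ), TensorProduct.zero_tmul]

theorem basis_eq_wedgeMonomial {a : ℕ} (p : Set.powersetCard (Fin n) a × (Fin n →₀ ℕ)) :
    (f.exteriorPower a).tensorProduct (MvPolynomial.basisMonomials (Fin n) R) p =
      wedgeMonomial f p.1 p.2 := by
  rw [Module.Basis.tensorProduct_apply', exteriorPower.basis_apply,
    MvPolynomial.coe_basisMonomials]
  rfl

theorem toHook_wedgeMonomial {a : ℕ} (σ : Set.powersetCard (Fin n) a) (α : Fin n →₀ ℕ) :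
    toHook f a (wedgeMonomial f σ α) = hook σ α := by
  rw [← basis_eq_wedgeMonomial f (σ, α), toHook, LinearMap.comp_apply, LinearEquiv.coe_coe,
    Module.Basis.repr_self, Finsupp.lmapDomain_apply, Finsupp.mapDomain_single]

theorem ofHook_toHook {a : ℕ} (t : ⋀[R]^a F ⊗[R] MvPolynomial (Fin n) R) :
    ofHook f a (toHook f a t) = t := by
  have : ofHook f a ∘ₗ toHook f a = LinearMap.id := by
    refine ((f.exteriorPower a).tensorProduct (MvPolynomial.basisMonomials (Fin n) R)).ext
      fun p => ?_
    rw [basis_eq_wedgeMonomial, LinearMap.comp_apply, toHook_wedgeMonomial, ofHook_hook_coe]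
    rfl
  exact LinearMap.congr_fun this t

theorem toHook_mem_column {a : ℕ} (t : ⋀[R]^a F ⊗[R] MvPolynomial (Fin n) R) :
    toHook f a t ∈ Finsupp.supported R R (columnSet n a) := by
  rw [← ((f.exteriorPower a).tensorProduct
    (MvPolynomial.basisMonomials (Fin n) R)).linearCombination_repr t,
    Finsupp.linearCombination_apply, Finsupp.sum, map_sum]
  refine sum_mem fun p _ => ?_
  rw [map_smul, basis_eq_wedgeMonomial, toHook_wedgeMonomial]
  exact Submodule.smul_mem _ _ (Finsupp.single_mem_supported R 1 p.1.2)

theorem toHook_ofHook {a : ℕ} {u : HookModule R n}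
    (hu : u ∈ Finsupp.supported R R (columnSet n a)) : toHook f a (ofHook f a u) = u := by
  rw [Finsupp.supported_eq_span_single] at hu
  have : Submodule.span R ((fun i => Finsupp.single i (1 : R)) '' columnSet n a) ≤
      LinearMap.eqLocus (toHook f a ∘ₗ ofHook f a) LinearMap.id := by
    rw [Submodule.span_le]
    rintro _ ⟨⟨σ, α⟩, hp, rfl⟩
    change toHook f a (ofHook f a (hook σ α)) = hook σ α
    rw [ofHook_hook_coe f ⟨σ, hp⟩, toHook_wedgeMonomial]
  exact this hu

theorem kappa_ofHook {a : ℕ} (u : HookModule R n) :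
    kappa f a (ofHook f (a + 1) u) = ofHook f a (hookD u) := by
  have : kappa f a ∘ₗ ofHook f (a + 1) = ofHook f a ∘ₗ hookD := by
    refine Finsupp.lhom_ext' fun p => LinearMap.ext_ring ?_
    obtain ⟨σ, α⟩ := p
    change kappa f a (ofHook f (a + 1) (hook σ α)) = ofHook f a (hookD (hook σ α))
    rw [hookD_hook, ofHook_hook, kappa, LinearMap.sum_apply, map_sum]
    simp only [TensorProduct.map_tmul, koszulD_extComponent, extD_extBasis, map_sum, map_smul,
      TensorProduct.sum_tmul]
    rw [Finset.sum_comm]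
    refine Finset.sum_congr rfl fun r _ => ?_
    rw [Finset.sum_eq_single_of_mem r (Finset.mem_univ r)]
    · rw [ofHook_hook, Module.Basis.coord_apply, Module.Basis.repr_self, Finsupp.single_eq_same,
        one_smul, ← TensorProduct.smul_tmul', LinearMap.mulLeft_apply, MvPolynomial.X,
        MvPolynomial.monomial_mul, one_mul, add_comm]
    · intro j _ hj
      rw [Module.Basis.coord_apply, Module.Basis.repr_self, Finsupp.single_eq_of_ne hj, zero_smul,
        smul_zero, TensorProduct.zero_tmul]
  exact LinearMap.congr_fun this u

theorem kosTensor_ofHook_hook (ψ : Module.Dual R F) {a : ℕ} (σ : Finset (Fin n))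
    (α : Fin n →₀ ℕ) :
    kosTensor ψ n a (ofHook f (a + 1) (hook σ α)) =
      ∑ r ∈ σ, koszulSign R r σ • ψ (f r) • ofHook f a (hook (σ.erase r) α) := by
  rw [ofHook_hook, kosTensor, LinearMap.rTensor_tmul, koszulD_extComponent, extD_extBasis, map_sum,
    TensorProduct.sum_tmul]
  refine Finset.sum_congr rfl fun r _ => ?_
  rw [map_smul, map_smul, ofHook_hook, ← TensorProduct.smul_tmul', ← TensorProduct.smul_tmul']

/-- Both maps are built from contractions on the exterior factor, and contractions anticommute. -/
theorem kosTensor_kappa (ψ : Module.Dual R F) (a : ℕ)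
    (t : ⋀[R]^(a + 2) F ⊗[R] MvPolynomial (Fin n) R) :
    kosTensor ψ n a (kappa f (a + 1) t) + kappa f a (kosTensor ψ n (a + 1) t) = 0 := by
  induction t using TensorProduct.induction_on with
  | zero => simp
  | add t t' h h' =>
    rw [map_add, map_add, map_add, map_add, add_add_add_comm, h, h', add_zero]
  | tmul y s =>
    simp only [kappa, kosTensor, LinearMap.sum_apply, TensorProduct.map_tmul, map_sum,
      LinearMap.rTensor_tmul]
    rw [← Finset.sum_add_distrib]
    refine Finset.sum_eq_zero fun j _ => ?_
    rw [← TensorProduct.add_tmul]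
    have : koszulD ψ a (koszulD (f.coord j) (a + 1) y) +
        koszulD (f.coord j) a (koszulD ψ (a + 1) y) = 0 := by
      apply Subtype.ext
      rw [Submodule.coe_add, koszulD_coe, koszulD_coe, koszulD_coe, koszulD_coe, extD_comm,
        neg_add_cancel]
      rfl
    rw [this, TensorProduct.zero_tmul]

theorem restrictedTerm_eq (w : Fin n → ℕ) (a b : ℕ) :
    restrictedTerm f w a b = (hookTerm R w b).map (ofHook f a) := by
  apply le_antisymm
  · rw [restrictedTerm, Submodule.span_le]
    rintro _ ⟨σ, α, hα, hσ, rfl⟩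
    exact ⟨hook σ α, Finsupp.single_mem_supported R 1 ⟨hα, hσ⟩, ofHook_hook_coe f σ α⟩
  · rw [hookTerm, Finsupp.supported_eq_span_single, Submodule.map_span, Submodule.span_le]
    rintro _ ⟨_, ⟨⟨σ, α⟩, hp, rfl⟩, rfl⟩
    change ofHook f a (hook σ α) ∈ restrictedTerm f w a b
    by_cases hσ : σ.card = a
    · exact Submodule.subset_span ⟨⟨σ, hσ⟩, α, hp.1, hp.2, ofHook_hook_coe f ⟨σ, hσ⟩ α⟩
    · rw [ofHook_hook_of_card_ne f hσ]
      exact zero_mem _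

theorem toHook_mem_hookTerm {w : Fin n → ℕ} {a b : ℕ}
    {t : ⋀[R]^a F ⊗[R] MvPolynomial (Fin n) R} (ht : t ∈ restrictedTerm f w a b) :
    toHook f a t ∈ hookTerm R w b := by
  have : restrictedTerm f w a b ≤ (hookTerm R w b).comap (toHook f a) := by
    rw [restrictedTerm, Submodule.span_le]
    rintro _ ⟨σ, α, hα, hσ, rfl⟩
    rw [SetLike.mem_coe, Submodule.mem_comap, toHook_wedgeMonomial]
    exact Finsupp.single_mem_supported R 1 ⟨hα, hσ⟩
  exact this ht

theorem hookD_of_column_zero {u : HookModule R n}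
    (hu : u ∈ Finsupp.supported R R (columnSet n 0)) : hookD u = 0 := by
  rw [hookD, Finsupp.linearCombination_apply]
  refine Finset.sum_eq_zero fun p hp => ?_
  have : p.1 = ∅ := Finset.card_eq_zero.1 (hu hp)
  simp [this]

theorem mem_LTerm_iff {w : Fin n → ℕ} {a b : ℕ} {t : ⋀[R]^a F ⊗[R] MvPolynomial (Fin n) R} :
    t ∈ LTerm f w b a ↔ toHook f a t ∈ hookTerm R w b ∧ hookD (toHook f a t) = 0 := by
  have h1 : t ∈ restrictedTerm f w a b ↔ toHook f a t ∈ hookTerm R w b := by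
    refine ⟨toHook_mem_hookTerm f, fun h => ?_⟩
    rw [restrictedTerm_eq]
    exact ⟨_, h, ofHook_toHook f t⟩
  cases a with
  | zero =>
    rw [LTerm, h1, and_iff_left]
    exact hookD_of_column_zero (toHook_mem_column f t)
  | succ a =>
    rw [LTerm, Submodule.mem_inf, h1, LinearMap.mem_ker]
    refine and_congr_right fun _ => ?_
    conv_lhs => rw [← ofHook_toHook f t, kappa_ofHook]
    constructor
    · intro h
      rw [← toHook_ofHook f (hookD_mem_column (toHook_mem_column f t)), h, map_zero]
    · intro h
      rw [h, map_zero]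

theorem ofHook_hookD_mem_LTerm {w : Fin n → ℕ} {a b : ℕ} {u : HookModule R n}
    (hu : u ∈ hookTerm R w b) (hua : u ∈ Finsupp.supported R R (columnSet n (a + 1))) :
    ofHook f a (hookD u) ∈ LTerm f w (b + 1) a := by
  rw [mem_LTerm_iff, toHook_ofHook f (hookD_mem_column hua)]
  exact ⟨hookD_mem hu, hookD_hookD u⟩

/-- The preimage of an element of `L^a` under the tautological Koszul differential. -/
theorem exists_preimage {w : Fin n → ℕ} {a b : ℕ} {t : ⋀[R]^a F ⊗[R] MvPolynomial (Fin n) R}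
    (ht : t ∈ LTerm f w (b + 1) a) :
    hookH (toHook f a t) ∈ hookTerm R w b ∧
      hookH (toHook f a t) ∈ Finsupp.supported R R (columnSet n (a + 1)) ∧
      hookD (hookH (toHook f a t)) = toHook f a t := by
  obtain ⟨h1, h2⟩ := (mem_LTerm_iff f).1 ht
  refine ⟨hookH_mem_hookTerm h1, hookH_mem_column (toHook_mem_column f t), ?_⟩
  have := homotopy_apply_of_mem h1
  rwa [h2, map_zero, add_zero] at this

/-- A combination of the `κ(f_σ ⊗ f^α)` with coefficients in an ideal. -/
theorem ofHook_hookD_mem_smul {w : Fin n → ℕ} {a b : ℕ} {u : HookModule R n} {J : Ideal R}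
    (hu : u ∈ hookTerm R w b) (hua : u ∈ Finsupp.supported R R (columnSet n (a + 1)))
    (hJ : ∀ p, u p ∈ J) : ofHook f a (hookD u) ∈ J • LTerm f w (b + 1) a := by
  have : u = u.sum fun p r => r • hook p.1 p.2 := by
    conv_lhs => rw [← Finsupp.sum_single u]
    simp
  rw [this, Finsupp.sum, map_sum, map_sum]
  refine sum_mem fun p hp => ?_
  rw [map_smul, map_smul]
  exact Submodule.smul_mem_smul (hJ p) (ofHook_hookD_mem_LTerm f
    (Finsupp.single_mem_supported R 1 (hu hp)) (Finsupp.single_mem_supported R 1 (hua hp)))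

/-- Stated for an additive commutative monoid; the scalar `-1` of `R` supplies the negative. -/
theorem mem_of_add_eq_zero {M : Type*} [AddCommMonoid M] [Module R M] {N : Submodule R M}
    {y z : M} (h : y + z = 0) (hz : z ∈ N) : y ∈ N := by
  have h1 : z + (-1 : R) • z = 0 := by
    have := (add_smul (1 : R) (-1) z).symm
    rwa [one_smul, add_neg_cancel, zero_smul] at this
  have h2 : y = (-1 : R) • z := by
    rw [← add_zero y, ← h1, ← add_assoc, h, zero_add]
  rw [h2]
  exact Submodule.smul_mem _ _ hz

/-- `L^w(ψ, d) ⊗ k` has zero differential. -/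
theorem kosTensor_LTerm_le {𝔪 : Ideal R} {ψ : Module.Dual R F} (hψ : ∀ j, ψ (f j) ∈ 𝔪)
    (w : Fin n → ℕ) (a b : ℕ) :
    (LTerm f w (b + 1) (a + 1)).map (kosTensor ψ n a) ≤ 𝔪 • LTerm f w (b + 1) a := by
  rintro _ ⟨t, ht, rfl⟩
  obtain ⟨h1, h2, h3⟩ := exists_preimage f ht
  set u := hookH (toHook f (a + 1) t)
  have hu : u = u.sum fun p r => r • hook p.1 p.2 := by
    conv_lhs => rw [← Finsupp.sum_single u]
    simp
  rw [← ofHook_toHook f t, ← h3, ← kappa_ofHook, hu, Finsupp.sum, map_sum, map_sum, map_sum]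
  refine sum_mem fun p hp => ?_
  rw [map_smul, map_smul, map_smul]
  refine Submodule.smul_mem _ _ ?_
  -- An element of L is κ(v), and `kosTensor` of it is minus κ of `kosTensor` of v. The latter has
  -- coefficients `ψ (f r)` in `𝔪` on symbols whose column has shrunk, so the bound `w` persists.
  refine mem_of_add_eq_zero (kosTensor_kappa f ψ a _) ?_
  rw [kosTensor_ofHook_hook, map_sum]
  refine sum_mem fun r hr => ?_
  rw [map_smul, map_smul, kappa_ofHook]
  refine Submodule.smul_mem _ _ (Submodule.smul_mem_smul (hψ r)
    (ofHook_hookD_mem_LTerm f (Finsupp.single_mem_supported R 1 ?_)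
      (Finsupp.single_mem_supported R 1 ?_)))
  · obtain ⟨hp1, hp2⟩ := mem_hookSet_iff.1 (h1 hp)
    exact mem_hookSet_iff.2 ⟨hp1, (Finset.erase_subset _ _).trans hp2⟩
  · change (p.1.erase r).card = a + 1
    rw [Finset.card_erase_of_mem hr, show p.1.card = a + 1 + 1 from h2 hp]
    rfl

theorem augmentation_LTerm_le {𝔪 : Ideal R} {ψ : Module.Dual R F} (hψ : ∀ j, ψ (f j) ∈ 𝔪)
    (w : Fin n → ℕ) (b : ℕ) : (LTerm f w (b + 1) 0).map (augmentation f ψ) ≤ 𝔪 := by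
  rw [LTerm, restrictedTerm, Submodule.map_span, Submodule.span_le]
  rintro _ ⟨_, ⟨σ, α, hα, -, rfl⟩, rfl⟩
  rw [wedgeMonomial, augmentation, LinearMap.comp_apply, TensorProduct.map_tmul,
    LinearEquiv.coe_coe, TensorProduct.lid_tmul]
  refine Ideal.mul_mem_left _ _ ?_
  rw [AlgHom.toLinearMap_apply, MvPolynomial.aeval_monomial, map_one, one_mul,
    Finsupp.prod_fintype _ _ (by simp)]
  refine evalMonomial_mem_maximal (a := fun j => ψ (f j)) hψ ?_
  rintro rfl
  simp at hα

end TensorTerms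

/-! ### The isomorphism L ⊗ k with homology, and the semistandard basis -/

section Description

variable {R : Type u} [CommRing R] {F : Type v} [AddCommGroup F] [Module R F] {n m : ℕ}
  {f : Module.Basis (Fin n) R F} {ψ : Module.Dual R F} {x : Fin m → R} {w : Fin n → ℕ} {b : ℕ}

theorem hookEval_mem_cyclesMod (ℓ : KoszulLift ψ (formOf x)) {i : ℕ} {u : HookModule R n}
    (hu : u ∈ hookTerm R w b) (hui : u ∈ Finsupp.supported R R (columnSet n i)) :
    (⟨_, hookEval_mem_exteriorPower (a := fun j => ψ (f j)) (liftFamily_mem f ℓ) hui⟩ :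
      ⋀[R]^i (Fin m → R)) ∈ cyclesMod (formOf x) (restrictedPower f ψ w (b + 1)) i := by
  rw [mem_cyclesMod, (isKoszulFamily_liftFamily f ℓ).d_hookEval, restrictedPower_eq]
  exact hookEval_mem (hookD_mem hu)

variable (w b) in
/-- The class of a combination of the `ψ(f^α) z_σ` with `|σ| = i`. -/
def hookClass (f : Module.Basis (Fin n) R F) (ℓ : KoszulLift ψ (formOf x)) (i : ℕ) :
    (hookTerm R w b ⊓ Finsupp.supported R R (columnSet n i) : Submodule R (HookModule R n)) →ₗ[R]
      KoszulHomology (formOf x) (R ⧸ restrictedPower f ψ w (b + 1)) i :=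
  classMap (formOf x) (restrictedPower f ψ w (b + 1)) i ∘ₗ
    LinearMap.codRestrict (cyclesMod (formOf x) (restrictedPower f ψ w (b + 1)) i)
      (LinearMap.codRestrict (⋀[R]^i (Fin m → R))
        (hookEval (fun j => ψ (f j)) (liftFamily f ℓ) ∘ₗ Submodule.subtype _)
        fun u => hookEval_mem_exteriorPower (liftFamily_mem f ℓ) u.2.2)
      fun u => hookEval_mem_cyclesMod ℓ u.2.1 u.2.2

theorem hookClass_eq_zero_iff (ℓ : KoszulLift ψ (formOf x)) {i : ℕ}
    {u : (hookTerm R w b ⊓ Finsupp.supported R R (columnSet n i) :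
      Submodule R (HookModule R n))} :
    hookClass w b f ℓ i u = 0 ↔ hookEval (fun j => ψ (f j)) (liftFamily f ℓ) u ∈
      LinearMap.range (extD (formOf x)) ⊔ restrictedIdeal (fun j => ψ (f j)) w (b + 1) •
        (⊤ : Submodule R (ExteriorAlgebra R (Fin m → R))) := by
  rw [← restrictedPower_eq]
  exact classMap_eq_zero_iff

theorem isClassOf_hookClass (ℓ : KoszulLift ψ (formOf x)) {i : ℕ}
    (σ : Set.powersetCard (Fin n) i) (α : Fin n →₀ ℕ) (h : hook (σ : Finset (Fin n)) α ∈
      (hookTerm R w b ⊓ Finsupp.supported R R (columnSet n i) : Submodule R (HookModule R n))) :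
    IsClassOf (formOf x) (1 ⊗ₜ[R] liftedElement f ψ ℓ σ α)
      (hookClass w b f ℓ i ⟨hook σ α, h⟩) := by
  have h1 : liftedElement f ψ ℓ σ α = ⟨_, hookEval_mem_exteriorPower (a := fun j => ψ (f j))
      (liftFamily_mem f ℓ) h.2⟩ := Subtype.ext (liftedElement_coe f ℓ σ α)
  rw [isClassOf_iff, h1]
  exact ⟨hookEval_mem_cyclesMod ℓ h.1 h.2, rfl⟩

theorem hook_mem {i : ℕ} {σ : Set.powersetCard (Fin n) i} {α : Fin n →₀ ℕ}
    (hα : α.degree = b) (hσ : MultidegreeLE w σ α) : hook (σ : Finset (Fin n)) α ∈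
      (hookTerm R w b ⊓ Finsupp.supported R R (columnSet n i) : Submodule R (HookModule R n)) :=
  ⟨Finsupp.single_mem_supported R 1 ⟨hα, hσ⟩, Finsupp.single_mem_supported R 1 σ.2⟩

open Classical in
/-- Every class of positive degree is represented by a combination of the `ψ(f^α) z_σ`. -/
theorem hookClass_surjective (hx : IsKoszulExact x)
    (ha : IsPermutablyRegular fun j => ψ (f j))
    (ham : ∀ j, ψ (f j) ∈ Ideal.span (Set.range x)) (ℓ : KoszulLift ψ (formOf x)) (a : ℕ) :
    Function.Surjective (hookClass w b f ℓ (a + 1)) := by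
  intro h
  obtain ⟨⟨c, hc⟩, rfl⟩ := classMap_surjective h
  have hc' := mem_cyclesMod.1 hc
  rw [restrictedPower_eq] at hc'
  obtain ⟨u, hu, e, r, hj⟩ := exists_hookEval_of_cycle hx.isResidueResolution ha ham
    (isKoszulFamily_liftFamily f ℓ) w (b + 1) _ hc'
  -- The combination found may mix column sizes. Only its part of column size `a + 1` matters for a
  -- cycle of that degree, and the multiple of 1 lives in degree 0.
  have hu' : u.filter (· ∈ columnSet n (a + 1)) ∈ (hookTerm R w b ⊓
      Finsupp.supported R R (columnSet n (a + 1)) : Submodule R (HookModule R n)) := by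
    refine ⟨fun p hp => ?_, fun p hp => ?_⟩
    all_goals rw [Finset.mem_coe, Finsupp.support_filter] at hp
    · exact mem_hookTerm_of_mem_prev hu (Finset.mem_filter.1 hp).1
    · exact (Finset.mem_filter.1 hp).2
  refine ⟨⟨_, hu'⟩, ?_⟩
  rw [eq_comm, ← sub_eq_zero, hookClass, LinearMap.comp_apply, ← map_sub, classMap_eq_zero_iff]
  have h1 := map_mem_ideal_smul_top ((⋀[R]^(a + 1) (Fin m → R)).subtype ∘ₗ
    extComponent R (Fin m → R) (a + 1)) hj
  have h2 : extComponent R (Fin m → R) (a + 1) 1 = 0 := by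
    refine extComponent_of_ne (j := 0) (by omega) ?_
    rw [← unit₀_coe]
    exact Subtype.property _
  simp only [LinearMap.comp_apply, map_sub, map_smul, h2, smul_zero, sub_zero,
    Submodule.coe_subtype, extComponent_coe, extComponent_hookEval (liftFamily_mem f ℓ),
    ← koszulD_extComponent, koszulD_coe, ZeroMemClass.coe_zero] at h1
  rw [← restrictedPower_eq f] at h1
  change (c : ExteriorAlgebra R (Fin m → R)) - hookEval (fun j => ψ (f j)) (liftFamily f ℓ)
    (u.filter (· ∈ columnSet n (a + 1))) ∈ _
  exact Submodule.mem_sup.2 ⟨_, ⟨extComponent R (Fin m → R) (a + 1 + 1) e, rfl⟩, _, h1, by abel⟩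

/-- The class of a combination depends only on its image under `κ`. -/
theorem hookClass_hookH_hookD (ℓ : KoszulLift ψ (formOf x)) {a : ℕ}
    (u : (hookTerm R w b ⊓ Finsupp.supported R R (columnSet n (a + 1)) :
      Submodule R (HookModule R n)))
    (h : hookH (hookD (u : HookModule R n)) ∈ (hookTerm R w b ⊓
      Finsupp.supported R R (columnSet n (a + 1)) : Submodule R (HookModule R n))) :
    hookClass w b f ℓ (a + 1) ⟨_, h⟩ = hookClass w b f ℓ (a + 1) u := by
  rw [eq_comm, ← sub_eq_zero, ← map_sub, hookClass_eq_zero_iff]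
  have h1 : ((u - ⟨_, h⟩ : (hookTerm R w b ⊓ Finsupp.supported R R (columnSet n (a + 1)) :
      Submodule R (HookModule R n))) : HookModule R n) = hookD (hookH (u : HookModule R n)) := by
    have h2 := homotopy_apply (u := (u : HookModule R n)) fun p hp => by
      have : p.1.card = a + 1 := u.2.2 hp
      omega
    rw [AddSubgroupClass.coe_sub, sub_eq_iff_eq_add, h2]
  rw [h1, ← (isKoszulFamily_liftFamily f ℓ).d_hookEval]
  exact Submodule.mem_sup_left ⟨_, rfl⟩

theorem hookH_hookD_mem {a : ℕ} {u : HookModule R n}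
    (hu : u ∈ (hookTerm R w b ⊓ Finsupp.supported R R (columnSet n (a + 1)) :
      Submodule R (HookModule R n))) :
    hookH (hookD u) ∈ (hookTerm R w b ⊓ Finsupp.supported R R (columnSet n (a + 1)) :
      Submodule R (HookModule R n)) :=
  ⟨hookH_mem_hookTerm (hookD_mem hu.1), hookH_mem_column (hookD_mem_column hu.2)⟩

/-- The map `L^a → H_(a+1)` that induces the isomorphism after tensoring with `k`. -/
def LTermClass (f : Module.Basis (Fin n) R F) (w : Fin n → ℕ) (b : ℕ)
    (ℓ : KoszulLift ψ (formOf x)) (a : ℕ) : LTerm f w (b + 1) a →ₗ[R]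
      KoszulHomology (formOf x) (R ⧸ restrictedPower f ψ w (b + 1)) (a + 1) :=
  hookClass w b f ℓ (a + 1) ∘ₗ
    LinearMap.codRestrict _ (hookH ∘ₗ toHook f a ∘ₗ Submodule.subtype _)
      fun t => ⟨(exists_preimage f t.2).1, (exists_preimage f t.2).2.1⟩

theorem LTermClass_apply (ℓ : KoszulLift ψ (formOf x)) {a : ℕ}
    (u : (hookTerm R w b ⊓ Finsupp.supported R R (columnSet n (a + 1)) :
      Submodule R (HookModule R n))) :
    LTermClass f w b ℓ a ⟨_, ofHook_hookD_mem_LTerm f u.2.1 u.2.2⟩ =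
      hookClass w b f ℓ (a + 1) u := by
  rw [← hookClass_hookH_hookD ℓ u (hookH_hookD_mem u.2), LTermClass, LinearMap.comp_apply]
  congr 1
  apply Subtype.ext
  change hookH (toHook f a (ofHook f a (hookD (u : HookModule R n)))) = _
  rw [toHook_ofHook f (hookD_mem_column u.2.2)]

theorem smul_homology_eq_zero (hx : IsKoszulExact x) {I : Ideal R} {i : ℕ} {r : R}
    (hr : r ∈ Ideal.span (Set.range x)) (h : KoszulHomology (formOf x) (R ⧸ I) i) : r • h = 0 := by
  obtain ⟨c, rfl⟩ := classMap_surjective h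
  rw [← map_smul, classMap_eq_zero_iff]
  exact hx.isResidueResolution.smul_mem hr c.2

/-- A zero class forces κ(u) into the `𝔪`-multiples, and the homotopy is linear. This one statement
gives both the kernel of `LTermClass` and the independence of the semistandard classes. -/
theorem coeff_mem_of_hookClass_eq_zero (hx : IsKoszulExact x)
    (ha : IsPermutablyRegular fun j => ψ (f j))
    (ham : ∀ j, ψ (f j) ∈ Ideal.span (Set.range x)) (ℓ : KoszulLift ψ (formOf x)) {i : ℕ}
    {u : (hookTerm R w b ⊓ Finsupp.supported R R (columnSet n i) :
      Submodule R (HookModule R n))} (h : hookClass w b f ℓ i u = 0) (p) :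
    hookH (hookD (u : HookModule R n)) p ∈ Ideal.span (Set.range x) := by
  have h1 := hookD_mem_of_hookEval_mem hx.isResidueResolution ha ham
    (isKoszulFamily_liftFamily f ℓ) u.2.1 ((hookClass_eq_zero_iff ℓ).1 h)
  exact mem_ideal_smul_top_finsupp.1
    (map_mem_ideal_smul_top (N := HookModule R n) hookH h1) p

/-- If the class vanishes, the chosen preimage of `t` under κ has all coefficients in `𝔪`, because
the homotopy reproduces it from `t`; applying κ gives `t` in `𝔪 • L`. The converse is annihilation
of homology by `𝔪`. -/
theorem LTermClass_eq_zero_iff (hx : IsKoszulExact x)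
    (ha : IsPermutablyRegular fun j => ψ (f j))
    (ham : ∀ j, ψ (f j) ∈ Ideal.span (Set.range x)) (ℓ : KoszulLift ψ (formOf x)) {a : ℕ}
    (t : LTerm f w (b + 1) a) : LTermClass f w b ℓ a t = 0 ↔
      t ∈ Ideal.span (Set.range x) • (⊤ : Submodule R (LTerm f w (b + 1) a)) := by
  constructor
  · intro h
    rw [Submodule.mem_smul_top_iff]
    obtain ⟨h1, h2, h3⟩ := exists_preimage f t.2
    have h4 := coeff_mem_of_hookClass_eq_zero hx ha ham ℓ (u := ⟨_, h1, h2⟩) h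
    simp only [h3] at h4
    have h5 := ofHook_hookD_mem_smul f h1 h2 h4
    rwa [h3, ofHook_toHook] at h5
  · intro h
    refine Submodule.smul_induction_on h (fun r hr t _ => ?_) fun t t' h h' => ?_
    · rw [map_smul, smul_homology_eq_zero hx hr]
    · rw [map_add, h, h', add_zero]

theorem LTermClass_surjective (hx : IsKoszulExact x)
    (ha : IsPermutablyRegular fun j => ψ (f j))
    (ham : ∀ j, ψ (f j) ∈ Ideal.span (Set.range x)) (ℓ : KoszulLift ψ (formOf x)) (a : ℕ) :
    Function.Surjective (LTermClass f w b ℓ a) := by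
  intro h
  obtain ⟨u, rfl⟩ := hookClass_surjective hx ha ham ℓ a h
  exact ⟨_, LTermClass_apply ℓ u⟩

theorem isClassOf_LTermClass (ℓ : KoszulLift ψ (formOf x)) {a : ℕ}
    (σ : Set.powersetCard (Fin n) (a + 1)) (α : Fin n →₀ ℕ) (hα : α.degree = b)
    (hσ : MultidegreeLE w σ α) :
    ∃ hu : kappa f a (wedgeMonomial f σ α) ∈ LTerm f w (b + 1) a,
      IsClassOf (formOf x) (1 ⊗ₜ[R] liftedElement f ψ ℓ σ α)
        (LTermClass f w b ℓ a ⟨kappa f a (wedgeMonomial f σ α), hu⟩) := by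
  have hmem := hook_mem (R := R) (σ := σ) hα hσ
  have h1 : kappa f a (wedgeMonomial f σ α) = ofHook f a (hookD (hook σ α)) := by
    rw [← ofHook_hook_coe, kappa_ofHook]
  have h2 := LTermClass_apply (f := f) ℓ ⟨_, hmem⟩
  refine ⟨h1 ▸ ofHook_hookD_mem_LTerm f hmem.1 hmem.2, ?_⟩
  have h3 := isClassOf_hookClass (f := f) ℓ σ α hmem
  rw [← h2] at h3
  simpa only [h1] using h3

/-- The images under κ of the symbols generate L, as the homotopy provides preimages. This yields
uniqueness of the isomorphism. -/
theorem LTerm_hom_ext {N : Type*} [AddCommGroup N] [Module R N] {a : ℕ}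
    {g g' : LTerm f w (b + 1) a →ₗ[R] N}
    (h : ∀ (σ : Set.powersetCard (Fin n) (a + 1)) (α : Fin n →₀ ℕ), α.degree = b →
      MultidegreeLE w σ α → ∀ hu : kappa f a (wedgeMonomial f σ α) ∈ LTerm f w (b + 1) a,
        g ⟨_, hu⟩ = g' ⟨_, hu⟩) : g = g' := by
  have key : ∀ u : HookModule R n, ∀ (h1 : u ∈ hookTerm R w b)
      (h2 : u ∈ Finsupp.supported R R (columnSet n (a + 1))),
      g ⟨_, ofHook_hookD_mem_LTerm f h1 h2⟩ = g' ⟨_, ofHook_hookD_mem_LTerm f h1 h2⟩ := by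
    intro u
    induction u using Finsupp.induction with
    | zero =>
      intro h1 h2
      have : (⟨_, ofHook_hookD_mem_LTerm f h1 h2⟩ : LTerm f w (b + 1) a) = 0 := by
        apply Subtype.ext
        simp
      rw [this, map_zero, map_zero]
    | single_add p r u hp hr ih =>
      intro h1 h2
      have hsup : p ∈ (Finsupp.single p r + u).support := by
        have : u p = 0 := Finsupp.notMem_support_iff.1 hp
        simpa [this] using hr
      have hu : u.support ⊆ (Finsupp.single p r + u).support := by
        intro q hq
        have : q ≠ p := fun h => hp (h ▸ hq)
        have : (Finsupp.single p r) q = 0 := Finsupp.single_eq_of_ne this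
        simpa [this] using hq
      have h1' : u ∈ hookTerm R w b := fun q hq => h1 (hu hq)
      have h2' : u ∈ Finsupp.supported R R (columnSet n (a + 1)) := fun q hq => h2 (hu hq)
      obtain ⟨σ, α⟩ := p
      have hα : α.degree = b := (h1 hsup).1
      have hc : σ.card = a + 1 := h2 hsup
      have hw : MultidegreeLE w (⟨σ, hc⟩ : Set.powersetCard (Fin n) (a + 1)) α := (h1 hsup).2
      have e1 : kappa f a (wedgeMonomial f ⟨σ, hc⟩ α) = ofHook f a (hookD (hook σ α)) := by
        rw [← ofHook_hook_coe, kappa_ofHook]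
      have hmem := hook_mem (R := R) hα hw
      have hk : kappa f a (wedgeMonomial f ⟨σ, hc⟩ α) ∈ LTerm f w (b + 1) a :=
        e1 ▸ ofHook_hookD_mem_LTerm f hmem.1 hmem.2
      have e2 : (⟨_, ofHook_hookD_mem_LTerm f h1 h2⟩ : LTerm f w (b + 1) a) =
          r • ⟨_, hk⟩ + ⟨_, ofHook_hookD_mem_LTerm f h1' h2'⟩ := by
        apply Subtype.ext
        change _ = r • kappa f a (wedgeMonomial f ⟨σ, hc⟩ α) + ofHook f a (hookD u)
        have : Finsupp.single (σ, α) r = r • (hook σ α : HookModule R n) := by simp [hook]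
        rw [e1, ← map_smul, ← map_smul, ← this, ← map_add, ← map_add]
      rw [e2, map_add, map_add, map_smul, map_smul, h _ _ hα hw, ih h1' h2']
  ext t
  obtain ⟨h1, h2, h3⟩ := exists_preimage f t.2
  have e : t = ⟨_, ofHook_hookD_mem_LTerm f h1 h2⟩ := by
    apply Subtype.ext
    change _ = ofHook f a (hookD (hookH (toHook f a t)))
    rw [h3, ofHook_toHook]
  rw [e]
  exact key _ h1 h2

/-- The isomorphism `L^a ⊗ k ≅ H_(a+1)`. -/
theorem existsUnique_iso (hx : IsKoszulExact x)
    (ha : IsPermutablyRegular fun j => ψ (f j))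
    (ham : ∀ j, ψ (f j) ∈ Ideal.span (Set.range x)) (ℓ : KoszulLift ψ (formOf x)) (a : ℕ) :
    ∃! e : ((R ⧸ Ideal.span (Set.range x)) ⊗[R] LTerm f w (b + 1) a) ≃ₗ[R]
        KoszulHomology (formOf x) (R ⧸ restrictedPower f ψ w (b + 1)) (a + 1),
      ∀ (σ : Set.powersetCard (Fin n) (a + 1)) (α : Fin n →₀ ℕ),
        α.degree + 1 = b + 1 → MultidegreeLE w σ α →
        ∃ hu : kappa f a (wedgeMonomial f σ α) ∈ LTerm f w (b + 1) a,
          IsClassOf (formOf x) (1 ⊗ₜ[R] liftedElement f ψ ℓ σ α)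
            (e (1 ⊗ₜ[R] ⟨kappa f a (wedgeMonomial f σ α), hu⟩)) := by
  obtain ⟨e, he⟩ := exists_residueEquiv (LTermClass f w b ℓ a)
    (LTermClass_surjective hx ha ham ℓ a) (LTermClass_eq_zero_iff hx ha ham ℓ)
  refine ⟨e, fun σ α hα hσ => ?_, fun e' he' => ?_⟩
  · obtain ⟨hu, h⟩ := isClassOf_LTermClass (f := f) ℓ σ α (by omega : α.degree = b) hσ
    exact ⟨hu, by rwa [he]⟩
  · apply LinearEquiv.toLinearMap_injective
    refine TensorProduct.ext' fun r t => ?_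
    obtain ⟨y, hy⟩ := exists_one_tmul (r ⊗ₜ[R] t)
    rw [hy]
    refine LinearMap.congr_fun (LTerm_hom_ext (g := e'.toLinearMap ∘ₗ TensorProduct.mk R _ _ 1)
      (g' := e.toLinearMap ∘ₗ TensorProduct.mk R _ _ 1) fun σ α hα hσ hu => ?_) y
    obtain ⟨_, h1⟩ := he' σ α (by rw [hα]) hσ
    obtain ⟨_, h2⟩ := isClassOf_LTermClass (f := f) ℓ σ α hα hσ
    exact h1.unique (by rwa [← he] at h2)

theorem isLeastIndex_of_standard {i : ℕ} (hi : 1 ≤ i) (p : StandardPair n w (b + 1) i) :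
    (((p.1.1 : Finset (Fin n)), p.1.2) : Finset (Fin n) × (Fin n →₀ ℕ)) ∈ standardSet n := by
  obtain ⟨⟨σ, α⟩, hα, hw, hs⟩ := p
  have hne : (σ : Finset (Fin n)).Nonempty := by
    rw [← Finset.card_pos, show (σ : Finset (Fin n)).card = i from σ.2]
    omega
  refine ⟨(σ : Finset (Fin n)).min' hne, Finset.min'_mem _ _, Or.inl (Finset.min'_mem _ _),
    fun r hr => Finset.min'_le _ _ hr, fun r hr => ?_⟩
  obtain ⟨q, hq, hqr⟩ := hs r (Finsupp.mem_support_iff.2 hr)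
  exact (Finset.min'_le _ _ hq).trans hqr

theorem standardPair_hook_mem {i : ℕ} (p : StandardPair n w (b + 1) i) :
    hook (p.1.1 : Finset (Fin n)) p.1.2 ∈ (hookTerm R w b ⊓
      Finsupp.supported R R (columnSet n i) : Submodule R (HookModule R n)) :=
  hook_mem (by have := p.2.1; omega) p.2.2.1

/-- The basis of `H_i` given by the semistandard tableaux. -/
theorem isResidueBasis_hookClass (hx : IsKoszulExact x)
    (ha : IsPermutablyRegular fun j => ψ (f j))
    (ham : ∀ j, ψ (f j) ∈ Ideal.span (Set.range x)) (ℓ : KoszulLift ψ (formOf x)) (a : ℕ) :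
    IsResidueBasis (Ideal.span (Set.range x)) fun p : StandardPair n w (b + 1) (a + 1) =>
      hookClass w b f ℓ (a + 1) ⟨_, standardPair_hook_mem p⟩ where
  annihilated r hr h := smul_homology_eq_zero hx hr h
  span_eq_top := by
    rw [eq_top_iff]
    rintro h -
    obtain ⟨u, rfl⟩ := hookClass_surjective hx ha ham ℓ a h
    rw [← hookClass_hookH_hookD ℓ u (hookH_hookD_mem u.2)]
    -- Replacing `u` by the homotopy applied to κ(u) does not change the class, and the replacement
    -- is supported on semistandard symbols.
    have hst := hookH_mem (hookD_mem u.2.1)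
    have hmem := hookH_hookD_mem u.2
    set v := hookH (hookD (u : HookModule R n))
    have hterm : ∀ p ∈ v.support, hook p.1 p.2 ∈ (hookTerm R w b ⊓
        Finsupp.supported R R (columnSet n (a + 1)) : Submodule R (HookModule R n)) :=
      fun p hp => ⟨Finsupp.single_mem_supported R 1 (hmem.1 hp),
        Finsupp.single_mem_supported R 1 (hmem.2 hp)⟩
    have hv : (⟨v, hmem⟩ : (hookTerm R w b ⊓ Finsupp.supported R R (columnSet n (a + 1)) :
        Submodule R (HookModule R n))) = ∑ p ∈ v.support.attach, v p • ⟨_, hterm p p.2⟩ := by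
      apply Subtype.ext
      rw [Submodule.coe_sum]
      simp only [Submodule.coe_smul]
      rw [Finset.sum_attach v.support fun p => v p • hook p.1 p.2]
      conv_lhs => rw [← Finsupp.sum_single v]
      simp [Finsupp.sum]
    rw [hv, map_sum]
    refine sum_mem fun p _ => ?_
    rw [map_smul]
    refine Submodule.smul_mem _ _ (Submodule.subset_span ?_)
    obtain ⟨⟨σ, α⟩, hp⟩ := p
    obtain ⟨s, hs, hs'⟩ := (hst hp).2
    refine ⟨⟨(⟨σ, hmem.2 hp⟩, α), ?_, (hmem.1 hp).2, fun r hr => ⟨s, hs, hs'.2.2 r ?_⟩⟩, rfl⟩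
    · have := (hmem.1 hp).1
      simp only at this ⊢
      omega
    · exact Finsupp.mem_support_iff.1 hr
  independent c hc p := by
    set v : (hookTerm R w b ⊓ Finsupp.supported R R (columnSet n (a + 1)) :
        Submodule R (HookModule R n)) := Finsupp.linearCombination R
      (fun p : StandardPair n w (b + 1) (a + 1) => ⟨_, standardPair_hook_mem p⟩) c with hv
    have h1 : hookClass w b f ℓ (a + 1) v = 0 := by
      rw [← hc, hv, Finsupp.linearCombination_apply, Finsupp.linearCombination_apply, Finsupp.sum,
        map_sum]
      exact Finset.sum_congr rfl fun p _ => map_smul _ _ _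
    have hinj : Function.Injective fun p : StandardPair n w (b + 1) (a + 1) =>
        (((p.1.1 : Finset (Fin n)), p.1.2) : Finset (Fin n) × (Fin n →₀ ℕ)) := by
      rintro ⟨⟨⟨σ, _⟩, α⟩, _⟩ ⟨⟨⟨τ, _⟩, β⟩, _⟩ h
      simp only [Prod.mk.injEq] at h
      obtain ⟨rfl, rfl⟩ := h
      rfl
    have h2 : (v : HookModule R n) = c.mapDomain fun p : StandardPair n w (b + 1) (a + 1) =>
        (((p.1.1 : Finset (Fin n)), p.1.2) : Finset (Fin n) × (Fin n →₀ ℕ)) := by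
      rw [hv, Finsupp.linearCombination_apply, Finsupp.sum, Submodule.coe_sum, Finsupp.mapDomain,
        Finsupp.sum]
      refine Finset.sum_congr rfl fun p _ => ?_
      simp
    -- The homotopy kills semistandard symbols, so `v` is recovered from κ(v) by the homotopy, and
    -- those coefficients are known to be in `𝔪`.
    have h3 : hookH (v : HookModule R n) = 0 := by
      refine hookH_eq_zero_of_standard fun q hq => ?_
      rw [h2] at hq
      obtain ⟨p, -, rfl⟩ := Finset.mem_image.1 (Finsupp.mapDomain_support hq)
      exact isLeastIndex_of_standard (by omega) p
    have h4 := coeff_mem_of_hookClass_eq_zero hx ha ham ℓ h1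
      ((p.1.1 : Finset (Fin n)), p.1.2)
    have h5 := homotopy_apply (u := (v : HookModule R n)) fun p hp => by
      have : p.1.card = a + 1 := v.2.2 hp
      omega
    rw [h3, map_zero, zero_add] at h5
    rw [h5, h2] at h4
    rwa [Finsupp.mapDomain_apply hinj c p] at h4

/-- Constants that bound modulo the restricted power lie in `𝔪`: the constant term of a boundary
does, and the restricted power is contained in `𝔪`. -/
theorem existsUnique_iso_zero (ham : ∀ j, ψ (f j) ∈ Ideal.span (Set.range x))
    (hx : IsKoszulExact x) (w : Fin n → ℕ) (b : ℕ) :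
    ∃! e : ((R ⧸ Ideal.span (Set.range x)) ⊗[R] R) ≃ₗ[R]
      KoszulHomology (formOf x) (R ⧸ restrictedPower f ψ w (b + 1)) 0,
    IsClassOf (formOf x) (1 ⊗ₜ[R] unit₀ R (Fin m → R)) (e (1 ⊗ₜ[R] 1)) := by
  have hI : restrictedPower f ψ w (b + 1) ≤ Ideal.span (Set.range x) := by
    rw [restrictedPower_eq, restrictedIdeal, Ideal.span_le]
    rintro _ ⟨α, hα, rfl⟩
    refine evalMonomial_mem_maximal ham ?_
    rintro rfl
    have := (mem_restrictedExponents.1 hα).2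
    simp at this
  have hunit : unit₀ R (Fin m → R) ∈
      cyclesMod (formOf x) (restrictedPower f ψ w (b + 1)) 0 := by
    rw [mem_cyclesMod, unit₀_coe, extD_one]
    exact zero_mem _
  set Φ : R →ₗ[R] KoszulHomology (formOf x) (R ⧸ restrictedPower f ψ w (b + 1)) 0 :=
    LinearMap.toSpanSingleton R _ (classMap (formOf x) _ 0 ⟨_, hunit⟩) with hΦ
  have hΦr : ∀ r, Φ r = classMap (formOf x) (restrictedPower f ψ w (b + 1)) 0
      (r • ⟨_, hunit⟩) := fun r => by rw [map_smul]; rfl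
  have hsurj : Function.Surjective Φ := by
    intro h
    obtain ⟨⟨c, hc⟩, rfl⟩ := classMap_surjective h
    refine ⟨exteriorPower.zeroEquiv R (Fin m → R) c, ?_⟩
    rw [hΦr]
    congr 1
    apply Subtype.ext
    change exteriorPower.zeroEquiv R (Fin m → R) c • unit₀ R (Fin m → R) = c
    rw [unit₀, ← map_smul, smul_eq_mul, mul_one, LinearEquiv.symm_apply_apply]
  have hker : ∀ r, Φ r = 0 ↔ r ∈ Ideal.span (Set.range x) • (⊤ : Submodule R R) := by
    intro r
    have htop : Ideal.span (Set.range x) • (⊤ : Submodule R R) = Ideal.span (Set.range x) := by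
      rw [smul_eq_mul, Ideal.mul_top]
    rw [htop]
    constructor
    · intro h
      rw [hΦr, classMap_eq_zero_iff] at h
      have h' : r • (1 : ExteriorAlgebra R (Fin m → R)) ∈ LinearMap.range (extD (formOf x)) ⊔
          restrictedPower f ψ w (b + 1) • (⊤ : Submodule R (ExteriorAlgebra R (Fin m → R))) := by
        rw [← unit₀_coe]
        exact h
      obtain ⟨_, ⟨y, rfl⟩, j, hj, hyj⟩ := Submodule.mem_sup.1 h'
      have h1 := congrArg (ExteriorAlgebra.algebraMapInv (R := R) (M := Fin m → R)) hyj
      rw [map_add, map_smul, map_one, smul_eq_mul, mul_one,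
        algebraMapInv_extD (f := Pi.basisFun R (Fin m))] at h1
      rw [← h1]
      refine add_mem (sum_mem fun j _ => Ideal.mul_mem_left _ _ (Ideal.subset_span ⟨j, ?_⟩)) (hI ?_)
      · rw [formOf_basisFun]
      · have h2 := map_mem_ideal_smul_top
          (ExteriorAlgebra.algebraMapInv (R := R) (M := Fin m → R)).toLinearMap hj
        rw [smul_eq_mul, Ideal.mul_top] at h2
        exact h2
    · intro h
      exact smul_homology_eq_zero hx h _
  obtain ⟨e, he⟩ := exists_residueEquiv Φ hsurj hker
  refine ⟨e, ?_, fun e' he' => ?_⟩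
  · simp only
    rw [he, isClassOf_iff]
    exact ⟨hunit, one_smul _ _⟩
  · apply LinearEquiv.toLinearMap_injective
    refine TensorProduct.ext' fun r t => ?_
    obtain ⟨y, hy⟩ := exists_one_tmul (r ⊗ₜ[R] t)
    have hy1 : (1 : R ⧸ Ideal.span (Set.range x)) ⊗ₜ[R] y = y • (1 ⊗ₜ[R] (1 : R)) := by
      rw [← TensorProduct.tmul_smul, smul_eq_mul, mul_one]
    rw [hy, hy1, LinearEquiv.coe_coe, LinearEquiv.coe_coe, map_smul, map_smul, he]
    congr 1
    obtain ⟨_, h⟩ := isClassOf_iff.1 he'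
    rw [h]
    exact (one_smul _ _).symm

end Description

/-! ### The Leibniz rule and products of cycles -/

section Leibniz

variable {R : Type u} [CommRing R] {M : Type v} [AddCommGroup M] [Module R M]

theorem extD_mul (φ : Module.Dual R M) (c c' : ExteriorAlgebra R M) :
    extD φ (c * c') = extD φ c * c' + CliffordAlgebra.involute c * extD φ c' := by
  induction c using CliffordAlgebra.left_induction with
  | algebraMap r =>
    rw [← Algebra.smul_def, map_smul, CliffordAlgebra.contractLeft_algebraMap, zero_mul, zero_add,
      AlgHom.commutes, ← Algebra.smul_def]
  | add c₁ c₂ h₁ h₂ =>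
    rw [add_mul, map_add, h₁, h₂, map_add, map_add]
    noncomm_ring
  | ι_mul c v h =>
    rw [mul_assoc, CliffordAlgebra.contractLeft_ι_mul, h, CliffordAlgebra.contractLeft_ι_mul,
      map_mul, CliffordAlgebra.involute_ι, sub_mul, smul_mul_assoc, mul_add, neg_mul, neg_mul,
      mul_assoc, mul_assoc]
    abel

theorem extD_involute (φ : Module.Dual R M) (c : ExteriorAlgebra R M) :
    extD φ (CliffordAlgebra.involute c) = -CliffordAlgebra.involute (extD φ c) := by
  induction c using CliffordAlgebra.left_induction with
  | algebraMap r =>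
    rw [AlgHom.commutes, CliffordAlgebra.contractLeft_algebraMap, map_zero, neg_zero]
  | add c₁ c₂ h₁ h₂ => rw [map_add, map_add, h₁, h₂, map_add, map_add, neg_add]
  | ι_mul c v h =>
    rw [map_mul, CliffordAlgebra.involute_ι, neg_mul, map_neg, CliffordAlgebra.contractLeft_ι_mul,
      h, CliffordAlgebra.contractLeft_ι_mul, map_sub, map_smul, map_mul,
      CliffordAlgebra.involute_ι, neg_mul, mul_neg]

variable {φ : Module.Dual R M} {I : Ideal R}

theorem mul_mem_ideal_smul_top_left {A : Type*} [Ring A] [Algebra R A] {c : A}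
    (hc : c ∈ I • (⊤ : Submodule R A)) (c' : A) :
    c * c' ∈ I • (⊤ : Submodule R A) :=
  map_mem_ideal_smul_top (LinearMap.mulRight R c') hc

theorem mul_mem_ideal_smul_top_right {A : Type*} [Ring A] [Algebra R A] {c' : A}
    (hc : c' ∈ I • (⊤ : Submodule R A)) (c : A) :
    c * c' ∈ I • (⊤ : Submodule R A) :=
  map_mem_ideal_smul_top (LinearMap.mulLeft R c) hc

theorem extD_mul_mem (b : ExteriorAlgebra R M) {c : ExteriorAlgebra R M}
    (hc : extD φ c ∈ I • (⊤ : Submodule R (ExteriorAlgebra R M))) :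
    extD φ b * c ∈ LinearMap.range (extD φ) ⊔ I • (⊤ : Submodule R (ExteriorAlgebra R M)) := by
  rw [eq_sub_of_add_eq (extD_mul φ b c).symm]
  exact sub_mem (Submodule.mem_sup_left ⟨_, rfl⟩)
    (Submodule.mem_sup_right (mul_mem_ideal_smul_top_right hc _))

theorem mul_extD_mem (b : ExteriorAlgebra R M) {c : ExteriorAlgebra R M}
    (hc : extD φ c ∈ I • (⊤ : Submodule R (ExteriorAlgebra R M))) :
    c * extD φ b ∈ LinearMap.range (extD φ) ⊔ I • (⊤ : Submodule R (ExteriorAlgebra R M)) := by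
  have h := extD_mul φ (CliffordAlgebra.involute c) b
  rw [CliffordAlgebra.involute_involute, extD_involute] at h
  rw [eq_sub_of_add_eq' h.symm]
  refine sub_mem (Submodule.mem_sup_left ⟨_, rfl⟩)
    (Submodule.mem_sup_right (mul_mem_ideal_smul_top_left (neg_mem ?_) _))
  exact map_mem_ideal_smul_top (CliffordAlgebra.involute (Q := (0 : QuadraticForm R M))).toLinearMap
    hc

/-- Products depend only on homology classes. With the splitting `c * c' = e * e' + (c - e) * e' + c
* (c' - e')`, only `c` and `e'` need to be cycles. -/
theorem mul_mem_of_sub_mem {c c' e e' : ExteriorAlgebra R M}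
    (hc : extD φ c ∈ I • (⊤ : Submodule R (ExteriorAlgebra R M)))
    (he' : extD φ e' ∈ I • (⊤ : Submodule R (ExteriorAlgebra R M)))
    (h : c - e ∈ LinearMap.range (extD φ) ⊔ I • (⊤ : Submodule R (ExteriorAlgebra R M)))
    (h' : c' - e' ∈ LinearMap.range (extD φ) ⊔ I • (⊤ : Submodule R (ExteriorAlgebra R M)))
    (hee : e * e' ∈ LinearMap.range (extD φ) ⊔ I • (⊤ : Submodule R (ExteriorAlgebra R M))) :
    c * c' ∈ LinearMap.range (extD φ) ⊔ I • (⊤ : Submodule R (ExteriorAlgebra R M)) := by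
  have key : c * c' = e * e' + (c - e) * e' + c * (c' - e') := by noncomm_ring
  rw [key]
  refine add_mem (add_mem hee ?_) ?_
  · obtain ⟨_, ⟨b, rfl⟩, j, hj, hbj⟩ := Submodule.mem_sup.1 h
    rw [← hbj, add_mul]
    exact add_mem (extD_mul_mem b he') (Submodule.mem_sup_right (mul_mem_ideal_smul_top_left hj _))
  · obtain ⟨_, ⟨b, rfl⟩, j, hj, hbj⟩ := Submodule.mem_sup.1 h'
    rw [← hbj, mul_add]
    exact add_mem (mul_extD_mem b hc) (Submodule.mem_sup_right (mul_mem_ideal_smul_top_right hj _))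

theorem one_tmul_mem_range_lTensor {c : ExteriorAlgebra R M}
    (h : c ∈ LinearMap.range (extD φ) ⊔ I • (⊤ : Submodule R (ExteriorAlgebra R M))) :
    (1 : R ⧸ I) ⊗ₜ[R] c ∈ LinearMap.range ((extD φ).lTensor (R ⧸ I)) := by
  obtain ⟨_, ⟨b, rfl⟩, j, hj, rfl⟩ := Submodule.mem_sup.1 h
  refine ⟨1 ⊗ₜ b, ?_⟩
  rw [LinearMap.lTensor_tmul, TensorProduct.tmul_add, one_tmul_eq_zero_iff.2 hj, add_zero]

end Leibniz

/-! ### Vanishing of products for a multiplicative lift -/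

section Products

variable {R : Type u} [CommRing R] {n : ℕ}

/-- The positive entries of `α` are maximal. -/
def IsSaturated (w : Fin n → ℕ) (α : Fin n →₀ ℕ) : Prop :=
  ∀ s, α s ≠ 0 → w s ≤ α s

/-- If `β` has an index `s` that is free in `α`, one factor `a s` moves over and produces a
restricted monomial of degree `b + 1`. Otherwise `α` is maximal wherever `β` is positive. Then `β ≤
α`, and equality of degrees gives `α = β`. -/
theorem evalMonomial_mul_mem (a : Fin n → R) {w : Fin n → ℕ} {b : ℕ} {α β : Fin n →₀ ℕ}
    (hα : α ∈ restrictedExponents w b) (hβ : β ∈ restrictedExponents w b)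
    (h : ¬(α = β ∧ IsSaturated w α)) :
    evalMonomial a α * evalMonomial a β ∈ restrictedIdeal a w (b + 1) := by
  rw [mem_restrictedExponents] at hα hβ
  by_cases hs : ∃ s, β s ≠ 0 ∧ α s < w s
  · obtain ⟨s, hs, hs'⟩ := hs
    rw [evalMonomial_of_pos a hs, ← mul_assoc, ← evalMonomial_single a s, ← evalMonomial_add]
    refine Ideal.mul_mem_right _ _ (evalMonomial_mem_restrictedIdeal (fun j => ?_) ?_)
    · rw [Finsupp.add_apply]
      rcases eq_or_ne j s with rfl | hj
      · rw [Finsupp.single_eq_same]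
        exact hs'
      · rw [Finsupp.single_eq_of_ne hj, add_zero]
        exact hα.1 j
    · simp [hα.2]
  · push Not at hs
    refine absurd ?_ h
    have hle : β ≤ α := fun s => by
      by_cases hs0 : β s = 0
      · rw [hs0]
        exact Nat.zero_le _
      · exact (hβ.1 s).trans (hs s hs0)
    have heq : α = β := by
      have h1 : β + (α - β) = α := add_tsub_cancel_of_le hle
      have h2 : (α - β).degree = 0 := by
        have := congrArg Finsupp.degree h1
        rw [map_add] at this
        omega
      rw [Finsupp.degree_eq_zero_iff] at h2
      rw [← h1, h2, add_zero]
    subst heq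
    exact ⟨rfl, hs⟩

variable {F : Type v} [AddCommGroup F] [Module R F] {f : Module.Basis (Fin n) R F}
  {G : Type*} [AddCommGroup G] [Module R G] {ψ : Module.Dual R F} {φ : Module.Dual R G}

theorem extD_map_extBasis_mul_mem {g : F →ₗ[R] G} (hg : φ ∘ₗ g = ψ) {U σ τ : Finset (Fin n)}
    (hσ : σ ⊆ U) (hτ : τ ⊆ U) :
    extD φ (ExteriorAlgebra.map g (f.ExteriorAlgebra σ) *
      ExteriorAlgebra.map g (f.ExteriorAlgebra τ)) ∈
        subsetIdeal (fun j => ψ (f j)) U • (⊤ : Submodule R (ExteriorAlgebra R G)) := by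
  induction σ using Finset.induction_on_min with
  | empty =>
    rw [extBasis_empty, map_one, one_mul, extD_map, hg, extD_extBasis, map_sum]
    refine sum_mem fun r hr => ?_
    rw [map_smul, map_smul]
    exact Submodule.smul_mem _ _ (Submodule.smul_mem_smul (mem_subsetIdeal (hτ hr)) trivial)
  | insert s σ hs ih =>
    rw [extBasis_insert f hs, map_mul (ExteriorAlgebra.map g), ExteriorAlgebra.map_apply_ι,
      mul_assoc, extD_ι_mul, ← LinearMap.comp_apply φ g, hg]
    refine sub_mem (Submodule.smul_mem_smul (mem_subsetIdeal (hσ (Finset.mem_insert_self _ _)))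
      trivial) (mul_mem_ideal_smul_top_right (ih fun r hr => hσ (Finset.mem_insert_of_mem hr)) _)

/-- Unless the exponents agree and are saturated, the coefficient is already in the restricted
ideal. In the remaining case a factor `ψ (f s)` of the coefficient is the boundary of `g (f s)`, so
the product is a boundary up to `a^α` times the boundary of the product of the two wedges. The
latter has coefficients in the free indices of `α`. The assumption `b ≠ 0` provides the factor. -/
theorem evalMonomial_mul_extBasis_mem {g : F →ₗ[R] G} (hg : φ ∘ₗ g = ψ) {w : Fin n → ℕ} {b : ℕ}
    (hb : b ≠ 0) {σ τ : Finset (Fin n)} {α β : Fin n →₀ ℕ} (hα : (σ, α) ∈ hookSet w b)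
    (hβ : (τ, β) ∈ hookSet w b) :
    (evalMonomial (fun j => ψ (f j)) α • ExteriorAlgebra.map g (f.ExteriorAlgebra σ)) *
      (evalMonomial (fun j => ψ (f j)) β • ExteriorAlgebra.map g (f.ExteriorAlgebra τ)) ∈
      LinearMap.range (extD φ) ⊔ restrictedIdeal (fun j => ψ (f j)) w (b + 1) •
        (⊤ : Submodule R (ExteriorAlgebra R G)) := by
  obtain ⟨hα, hσ⟩ := mem_hookSet_iff.1 hα
  obtain ⟨hβ, hτ⟩ := mem_hookSet_iff.1 hβ
  rw [smul_mul_smul_comm]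
  by_cases h : α = β ∧ IsSaturated w α
  · obtain ⟨rfl, -⟩ := h
    obtain ⟨s, hs⟩ : ∃ s, α s ≠ 0 := by
      by_contra! h
      have : α = 0 := Finsupp.ext h
      rw [this, mem_restrictedExponents] at hα
      exact hb (by simpa using hα.2.symm)
    have h1 := extD_ι_mul φ (g (f s)) (ExteriorAlgebra.map g (f.ExteriorAlgebra σ) *
      ExteriorAlgebra.map g (f.ExteriorAlgebra τ))
    rw [← LinearMap.comp_apply φ g, hg] at h1
    -- One `a^α` is kept whole, to carry the error term into the restricted ideal of degree `b + 1`;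
    -- the factor `ψ (f s)` is split off the other.
    have h2 : ∀ c : ExteriorAlgebra R G,
        (evalMonomial (fun j => ψ (f j)) α * evalMonomial (fun j => ψ (f j)) α) • c =
        (evalMonomial (fun j => ψ (f j)) α *
          evalMonomial (fun j => ψ (f j)) (α - Finsupp.single s 1)) • ψ (f s) • c := fun c => by
      rw [smul_smul]
      congr 1
      conv_lhs => rw [evalMonomial_of_pos (fun j => ψ (f j)) hs]
      conv_rhs => rw [evalMonomial_of_pos (fun j => ψ (f j)) hs]
      ring
    rw [h2, eq_add_of_sub_eq h1.symm, smul_add, ← map_smul]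
    refine Submodule.add_mem_sup ⟨_, rfl⟩ ?_
    rw [mul_comm, mul_smul]
    exact Submodule.smul_mem _ _ (evalMonomial_smul_mem hα
      (mul_mem_ideal_smul_top_right (extD_map_extBasis_mul_mem hg hσ hτ) _))
  · exact Submodule.mem_sup_right
      (Submodule.smul_mem_smul (evalMonomial_mul_mem _ hα hβ h) trivial)

theorem hookEval_mul_mem {g : F →ₗ[R] G} (hg : φ ∘ₗ g = ψ) {w : Fin n → ℕ} {b : ℕ}
    (hb : b ≠ 0) {u u' : HookModule R n} (hu : u ∈ hookTerm R w b) (hu' : u' ∈ hookTerm R w b) :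
    hookEval (fun j => ψ (f j)) (liftFamily f (KoszulLift.ofLinearMap g hg)) u *
      hookEval (fun j => ψ (f j)) (liftFamily f (KoszulLift.ofLinearMap g hg)) u' ∈
      LinearMap.range (extD φ) ⊔ restrictedIdeal (fun j => ψ (f j)) w (b + 1) •
        (⊤ : Submodule R (ExteriorAlgebra R G)) := by
  rw [hookEval, Finsupp.linearCombination_apply, Finsupp.linearCombination_apply, Finsupp.sum,
    Finsupp.sum, Finset.sum_mul]
  refine sum_mem fun p hp => ?_
  rw [Finset.mul_sum]
  refine sum_mem fun q hq => ?_
  rw [smul_mul_smul_comm, liftFamily_ofLinearMap, liftFamily_ofLinearMap]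
  exact Submodule.smul_mem _ _ (evalMonomial_mul_extBasis_mem hg hb (hu hp) (hu' hq))

end Products

/-! ### Products for arbitrary lifts, and assembly of the description -/

section Description

variable {R : Type u} [CommRing R] {F : Type v} [AddCommGroup F] [Module R F] {n m : ℕ}
  {f : Module.Basis (Fin n) R F} {ψ : Module.Dual R F} {x : Fin m → R} {w : Fin n → ℕ} {b : ℕ}

theorem exists_hookEval_sub_mem (hx : IsKoszulExact x)
    (ha : IsPermutablyRegular fun j => ψ (f j))
    (ham : ∀ j, ψ (f j) ∈ Ideal.span (Set.range x)) (ℓ : KoszulLift ψ (formOf x)) {i : ℕ}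
    (hi : 1 ≤ i) {c : ⋀[R]^i (Fin m → R)}
    (hc : c ∈ cyclesMod (formOf x) (restrictedPower f ψ w (b + 1)) i) :
    ∃ u ∈ hookTerm R w b, (c : ExteriorAlgebra R (Fin m → R)) -
      hookEval (fun j => ψ (f j)) (liftFamily f ℓ) u ∈
        LinearMap.range (extD (formOf x)) ⊔ restrictedIdeal (fun j => ψ (f j)) w (b + 1) •
          (⊤ : Submodule R (ExteriorAlgebra R (Fin m → R))) := by
  obtain ⟨a, rfl⟩ : ∃ a, i = a + 1 := ⟨i - 1, by omega⟩
  obtain ⟨u, hu⟩ := hookClass_surjective hx ha ham ℓ a (classMap _ _ _ ⟨c, hc⟩)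
  refine ⟨u, u.2.1, ?_⟩
  rw [eq_comm, ← sub_eq_zero, hookClass, LinearMap.comp_apply, ← map_sub, classMap_eq_zero_iff] at hu
  rw [← restrictedPower_eq f]
  exact hu

/-- Every cycle of positive degree is homologous to a combination formed with a multiplicative lift,
so the vanishing there gives it for all cycles, in particular for those of any other lift. -/
theorem product_mem (hx : IsKoszulExact x)
    (ha : IsPermutablyRegular fun j => ψ (f j))
    (ham : ∀ j, ψ (f j) ∈ Ideal.span (Set.range x)) (hb : b ≠ 0) {i j : ℕ} (hi : 1 ≤ i)
    (hj : 1 ≤ j) {c : ⋀[R]^i (Fin m → R)} {c' : ⋀[R]^j (Fin m → R)}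
    (hc : c ∈ cyclesMod (formOf x) (restrictedPower f ψ w (b + 1)) i)
    (hc' : c' ∈ cyclesMod (formOf x) (restrictedPower f ψ w (b + 1)) j) :
    (c * c' : ExteriorAlgebra R (Fin m → R)) ∈
        LinearMap.range (extD (formOf x)) ⊔ restrictedPower f ψ w (b + 1) •
          (⊤ : Submodule R (ExteriorAlgebra R (Fin m → R))) := by
  obtain ⟨g, hg⟩ := exists_linearMap_of_mem f ham
  obtain ⟨u, hu, hcu⟩ := exists_hookEval_sub_mem hx ha ham (KoszulLift.ofLinearMap g hg) hi hc
  obtain ⟨u', hu', hcu'⟩ := exists_hookEval_sub_mem hx ha ham (KoszulLift.ofLinearMap g hg) hj hc'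
  rw [mem_cyclesMod] at hc
  rw [restrictedPower_eq] at hc ⊢
  refine mul_mem_of_sub_mem hc ?_ hcu hcu' (hookEval_mul_mem hg hb hu hu')
  rw [(isKoszulFamily_liftFamily f (KoszulLift.ofLinearMap g hg)).d_hookEval]
  exact hookEval_mem (hookD_mem hu')

theorem koszulHomologyDescription (hx : IsKoszulExact x)
    (ha : IsPermutablyRegular fun j => ψ (f j))
    (ham : ∀ j, ψ (f j) ∈ Ideal.span (Set.range x)) (w : Fin n → ℕ) {d : ℕ} (hd : 1 ≤ d) :
    KoszulHomologyDescription f ψ w d x := by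
  obtain ⟨b, rfl⟩ : ∃ b, d = b + 1 := ⟨d - 1, by omega⟩
  refine ⟨augmentation_LTerm_le f ham w b, fun a => kosTensor_LTerm_le f ham w a b, ?_,
    existsUnique_iso_zero ham hx w b, existsUnique_iso hx ha ham, fun ℓ i hi => ?_,
    fun hd ℓ i j hi hj σ α τ β hα hσ hβ hτ => ?_⟩
  · obtain ⟨g, hg⟩ := exists_linearMap_of_mem f ham
    exact ⟨KoszulLift.ofLinearMap g hg⟩
  · obtain ⟨a, rfl⟩ : ∃ a, i = a + 1 := ⟨i - 1, by omega⟩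
    exact ⟨_, fun p => isClassOf_hookClass ℓ _ _ (standardPair_hook_mem p),
      isResidueBasis_hookClass hx ha ham ℓ a⟩
  · refine one_tmul_mem_range_lTensor (product_mem hx ha ham (by omega) hi hj ?_ ?_)
    · exact (isClassOf_iff.1 (isClassOf_hookClass (f := f) ℓ σ α
        (hook_mem (by omega : α.degree = b) hσ))).1
    · exact (isClassOf_iff.1 (isClassOf_hookClass (f := f) ℓ τ β
        (hook_mem (by omega : β.degree = b) hτ))).1

end Description

/-! ### Passage from ⋀R^m to ⋀Q^m -/

section BaseChange

variable {R : Type u} [CommRing R] {Q : Type u} [CommRing Q] [Algebra R Q] {m : ℕ}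

variable (R Q m) in
/-- The base change map `⋀ R^m → ⋀ Q^m` along an algebra map `R → Q`. -/
def baseMap : ExteriorAlgebra R (Fin m → R) →ₐ[R] ExteriorAlgebra Q (Fin m → Q) :=
  ExteriorAlgebra.lift R ⟨(ExteriorAlgebra.ι Q (M := Fin m → Q)).restrictScalars R ∘ₗ
    (Algebra.linearMap R Q).compLeft (Fin m), fun _ => ExteriorAlgebra.ι_sq_zero _⟩

theorem baseMap_ι (v : Fin m → R) : baseMap R Q m (ExteriorAlgebra.ι R v) =
    ExteriorAlgebra.ι Q (fun j => algebraMap R Q (v j)) :=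
  ExteriorAlgebra.lift_ι_apply R _ _ _

theorem baseMap_smul (r : R) (c : ExteriorAlgebra R (Fin m → R)) :
    baseMap R Q m (r • c) = algebraMap R Q r • baseMap R Q m c := by
  rw [map_smul, algebraMap_smul]

theorem baseMap_algebraMap (r : R) :
    baseMap R Q m (algebraMap R _ r) = algebraMap Q _ (algebraMap R Q r) := by
  rw [AlgHom.commutes, IsScalarTower.algebraMap_apply R Q]

theorem formOf_algebraMap (x : Fin m → R) (v : Fin m → R) :
    formOf (fun i => algebraMap R Q (x i)) (fun j => algebraMap R Q (v j)) =
      algebraMap R Q (formOf x v) := by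
  simp [formOf, Fintype.linearCombination_apply]

theorem extD_baseMap (x : Fin m → R) (c : ExteriorAlgebra R (Fin m → R)) :
    extD (formOf fun i => algebraMap R Q (x i)) (baseMap R Q m c) =
      baseMap R Q m (extD (formOf x) c) := by
  induction c using CliffordAlgebra.left_induction with
  | algebraMap r =>
    change extD _ (baseMap R Q m (algebraMap R (ExteriorAlgebra R (Fin m → R)) r)) =
      baseMap R Q m (extD _ (algebraMap R (ExteriorAlgebra R (Fin m → R)) r))
    rw [baseMap_algebraMap, extD_algebraMap, extD_algebraMap, map_zero]
  | add c₁ c₂ h₁ h₂ => simp only [map_add, h₁, h₂]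
  | ι_mul c v h =>
    change extD _ (baseMap R Q m (ExteriorAlgebra.ι R v * c)) =
      baseMap R Q m (extD _ (ExteriorAlgebra.ι R v * c))
    rw [map_mul (baseMap R Q m), baseMap_ι, extD_ι_mul, extD_ι_mul, h, formOf_algebraMap,
      map_sub (baseMap R Q m), baseMap_smul, map_mul (baseMap R Q m), baseMap_ι]

theorem baseMap_extBasis (σ : Finset (Fin m)) :
    baseMap R Q m ((Pi.basisFun R (Fin m)).ExteriorAlgebra σ) =
      (Pi.basisFun Q (Fin m)).ExteriorAlgebra σ := by
  induction σ using Finset.induction_on_min with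
  | empty => rw [extBasis_empty, extBasis_empty, map_one]
  | insert s σ hs ih =>
    rw [extBasis_insert _ hs, extBasis_insert _ hs, map_mul, ih, baseMap_ι]
    congr 2
    ext j
    simp [Pi.single_apply, apply_ite (algebraMap R Q)]

theorem baseMap_eq_sum (c : ExteriorAlgebra R (Fin m → R)) :
    baseMap R Q m c = ∑ σ, algebraMap R Q ((Pi.basisFun R (Fin m)).ExteriorAlgebra.repr c σ) •
      (Pi.basisFun Q (Fin m)).ExteriorAlgebra σ := by
  conv_lhs => rw [← (Pi.basisFun R (Fin m)).ExteriorAlgebra.sum_repr c, map_sum]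
  exact Finset.sum_congr rfl fun σ _ => by rw [baseMap_smul, baseMap_extBasis]

/-- Standard basis elements map to standard basis elements, so vanishing is tested on coordinates.
-/
theorem baseMap_eq_zero_iff {I : Ideal R} (hI : ∀ r, algebraMap R Q r = 0 ↔ r ∈ I)
    {c : ExteriorAlgebra R (Fin m → R)} : baseMap R Q m c = 0 ↔
      c ∈ I • (⊤ : Submodule R (ExteriorAlgebra R (Fin m → R))) := by
  rw [mem_ideal_smul_top_iff_repr (Pi.basisFun R (Fin m)).ExteriorAlgebra, baseMap_eq_sum]
  simp only [← hI]
  constructor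
  · exact fun h => Fintype.linearIndependent_iff.1
      (Pi.basisFun Q (Fin m)).ExteriorAlgebra.linearIndependent _ h
  · exact fun h => Finset.sum_eq_zero fun σ _ => by rw [h, zero_smul]

theorem baseMap_surjective (hs : Function.Surjective (algebraMap R Q)) :
    Function.Surjective (baseMap R Q m) := by
  intro y
  choose s hs using hs
  refine ⟨∑ σ, s ((Pi.basisFun Q (Fin m)).ExteriorAlgebra.repr y σ) •
    (Pi.basisFun R (Fin m)).ExteriorAlgebra σ, ?_⟩
  conv_rhs => rw [← (Pi.basisFun Q (Fin m)).ExteriorAlgebra.sum_repr y]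
  rw [map_sum]
  exact Finset.sum_congr rfl fun σ _ => by rw [baseMap_smul, baseMap_extBasis, hs]

theorem baseMap_mem {i : ℕ} {c : ExteriorAlgebra R (Fin m → R)} (hc : c ∈ ⋀[R]^i (Fin m → R)) :
    baseMap R Q m c ∈ ⋀[Q]^i (Fin m → Q) := by
  have h : ⋀[R]^i (Fin m → R) ≤ ((⋀[Q]^i (Fin m → Q)).restrictScalars R).comap
      (baseMap R Q m).toLinearMap := by
    clear hc
    induction i with
    | zero =>
      intro c hc
      obtain ⟨r, rfl⟩ : ∃ r, algebraMap R (ExteriorAlgebra R (Fin m → R)) r = c := by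
        simpa [ExteriorAlgebra.exteriorPower, Submodule.mem_one] using hc
      change baseMap R Q m (algebraMap R (ExteriorAlgebra R (Fin m → R)) r) ∈ ⋀[Q]^0 (Fin m → Q)
      rw [baseMap_algebraMap]
      simp [ExteriorAlgebra.exteriorPower, Submodule.mem_one]
    | succ i ih =>
      rw [ExteriorAlgebra.exteriorPower, pow_succ', Submodule.mul_le]
      rintro _ ⟨v, rfl⟩ c hc
      change baseMap R Q m (ExteriorAlgebra.ι R v * c) ∈ ⋀[Q]^(i + 1) (Fin m → Q)
      rw [map_mul, baseMap_ι, ExteriorAlgebra.exteriorPower, pow_succ']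
      exact Submodule.mul_mem_mul ⟨_, rfl⟩ (ih hc)
  exact h hc

theorem baseMap_extComponent (i : ℕ) (c : ExteriorAlgebra R (Fin m → R)) :
    baseMap R Q m (extComponent R (Fin m → R) i c) =
      extComponent Q (Fin m → Q) i (baseMap R Q m c) := by
  induction c using DirectSum.Decomposition.inductionOn (fun i => ⋀[R]^i (Fin m → R)) with
  | zero => simp
  | add c c' h h' => simp only [map_add, Submodule.coe_add, h, h']
  | @homogeneous j y =>
    by_cases hj : j = i
    · subst hj
      rw [extComponent_coe]
      have : baseMap R Q m y = ((⟨_, baseMap_mem y.2⟩ : ⋀[Q]^j (Fin m → Q)) :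
        ExteriorAlgebra Q (Fin m → Q)) := rfl
      rw [this, extComponent_coe]
    · rw [extComponent_of_ne hj y.2, extComponent_of_ne hj (baseMap_mem y.2)]
      simp

theorem exists_baseMap_eq (hs : Function.Surjective (algebraMap R Q)) {i : ℕ}
    (y : ⋀[Q]^i (Fin m → Q)) : ∃ c : ⋀[R]^i (Fin m → R),
      baseMap R Q m c = (y : ExteriorAlgebra Q (Fin m → Q)) := by
  obtain ⟨c, hc⟩ := baseMap_surjective hs (y : ExteriorAlgebra Q (Fin m → Q))
  exact ⟨extComponent R _ i c, by rw [baseMap_extComponent, hc, extComponent_coe]⟩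

end BaseChange

/-! ### Koszul homology with coefficients in the ring itself -/

section SelfHomology

variable {Q : Type u} [CommRing Q] {M : Type v} [AddCommGroup M] [Module Q M]
  {φ : Module.Dual Q M} {i : ℕ}

theorem one_tmul_self_eq_zero_iff {M : Type*} [AddCommGroup M] [Module Q M] {y : M} :
    (1 : Q) ⊗ₜ[Q] y = 0 ↔ y = 0 := by
  rw [← (TensorProduct.lid Q M).map_eq_zero_iff, TensorProduct.lid_tmul, one_smul]

theorem exists_one_tmul_self {M : Type*} [AddCommGroup M] [Module Q M] (t : Q ⊗[Q] M) :
    ∃ y : M, t = 1 ⊗ₜ[Q] y :=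
  ⟨TensorProduct.lid Q M t, (TensorProduct.lid Q M).injective (by simp)⟩

theorem one_tmul_mem_cycles_self_iff {y : ⋀[Q]^i M} :
    (1 : Q) ⊗ₜ[Q] y ∈ koszulCycles φ Q i ↔ extD φ (y : ExteriorAlgebra Q M) = 0 := by
  cases i with
  | zero =>
    rw [extD_of_mem_zero φ y.2]
    exact ⟨fun _ => rfl, fun _ => trivial⟩
  | succ i =>
    rw [koszulCycles, LinearMap.mem_ker, LinearMap.lTensor_tmul, one_tmul_self_eq_zero_iff,
      ← koszulD_coe, ZeroMemClass.coe_eq_zero]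

theorem one_tmul_mem_boundaries_self_iff {y : ⋀[Q]^i M} :
    (1 : Q) ⊗ₜ[Q] y ∈ koszulBoundaries φ Q i ↔
      (y : ExteriorAlgebra Q M) ∈ LinearMap.range (extD φ) := by
  rw [koszulBoundaries, LinearMap.mem_range]
  constructor
  · rintro ⟨t, ht⟩
    obtain ⟨b, rfl⟩ := exists_one_tmul_self t
    rw [LinearMap.lTensor_tmul, eq_comm, ← sub_eq_zero, ← TensorProduct.tmul_sub,
      one_tmul_self_eq_zero_iff, sub_eq_zero] at ht
    exact ⟨b, by rw [ht, koszulD_coe]⟩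
  · rintro ⟨b, hb⟩
    refine ⟨1 ⊗ₜ extComponent Q M (i + 1) b, ?_⟩
    rw [LinearMap.lTensor_tmul, koszulD_extComponent, hb, extComponent_coe]

variable (φ i) in
/-- The homology class of a cycle of degree `i`. -/
def selfClass : LinearMap.ker (extD φ ∘ₗ (⋀[Q]^i M).subtype) →ₗ[Q] KoszulHomology φ Q i :=
  Submodule.mkQ _ ∘ₗ
    ((TensorProduct.mk Q Q (⋀[Q]^i M) 1) ∘ₗ Submodule.subtype _).codRestrict
      (koszulCycles φ Q i) fun y => one_tmul_mem_cycles_self_iff.2 y.2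

theorem selfClass_eq_zero_iff {y : LinearMap.ker (extD φ ∘ₗ (⋀[Q]^i M).subtype)} :
    selfClass φ i y = 0 ↔
      ((y : ⋀[Q]^i M) : ExteriorAlgebra Q M) ∈ LinearMap.range (extD φ) := by
  rw [← one_tmul_mem_boundaries_self_iff]
  exact Submodule.Quotient.mk_eq_zero _

theorem selfClass_surjective : Function.Surjective (selfClass φ i) := by
  intro h
  obtain ⟨⟨t, ht⟩, rfl⟩ := Submodule.Quotient.mk_surjective _ h
  obtain ⟨y, rfl⟩ := exists_one_tmul_self t
  exact ⟨⟨y, one_tmul_mem_cycles_self_iff.1 ht⟩, rfl⟩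

end SelfHomology

/-! ### Transfer of residue bases from coefficients R/I to the ring Q = R/I -/

section Transfer

variable {R : Type u} [CommRing R] {Q : Type u} [CommRing Q] [Algebra R Q] {m : ℕ}

theorem IsResidueBasis.comp_equiv {𝔪 : Ideal R} {H : Type*} [AddCommGroup H] [Module R H]
    {ι ι' : Type*} {v : ι → H} (hv : IsResidueBasis 𝔪 v) (e : ι' ≃ ι) :
    IsResidueBasis 𝔪 (v ∘ e) where
  annihilated := hv.annihilated
  span_eq_top := by rw [e.surjective.range_comp, hv.span_eq_top]
  independent c hc i := by
    have := hv.independent (c.equivMapDomain e) (by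
      rwa [Finsupp.linearCombination_equivMapDomain]) (e i)
    simpa using this

theorem coe_linearCombination_cyclesMod {I : Ideal R} {x : Fin m → R} {i : ℕ} {ι : Type*}
    {c : ι → ⋀[R]^i (Fin m → R)} (hc : ∀ p, c p ∈ cyclesMod (formOf x) I i) (s : ι →₀ R) :
    ((Finsupp.linearCombination R (fun p => (⟨c p, hc p⟩ : cyclesMod (formOf x) I i)) s :
      ⋀[R]^i (Fin m → R)) : ExteriorAlgebra R (Fin m → R)) =
      Finsupp.linearCombination R (fun p => (c p : ExteriorAlgebra R (Fin m → R))) s := by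
  simp only [Finsupp.linearCombination_apply, Finsupp.sum, Submodule.coe_sum, Submodule.coe_smul]

theorem IsResidueBasis.exists_sub_mem {I : Ideal R} {x : Fin m → R} {i : ℕ} {ι : Type*}
    {c : ι → ⋀[R]^i (Fin m → R)} {hc : ∀ p, c p ∈ cyclesMod (formOf x) I i}
    (hb : IsResidueBasis (Ideal.span (Set.range x)) fun p => classMap (formOf x) I i ⟨c p, hc p⟩)
    {e : ⋀[R]^i (Fin m → R)} (he : e ∈ cyclesMod (formOf x) I i) :
    ∃ s : ι →₀ R, (e : ExteriorAlgebra R (Fin m → R)) -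
      Finsupp.linearCombination R (fun p => (c p : ExteriorAlgebra R (Fin m → R))) s ∈
      LinearMap.range (extD (formOf x)) ⊔
        I • (⊤ : Submodule R (ExteriorAlgebra R (Fin m → R))) := by
  obtain ⟨s, hs⟩ := Finsupp.mem_span_range_iff_exists_finsupp.1
    (hb.span_eq_top.symm ▸ Submodule.mem_top : classMap (formOf x) I i ⟨e, he⟩ ∈
      Submodule.span R (Set.range fun p => classMap (formOf x) I i ⟨c p, hc p⟩))
  refine ⟨s, ?_⟩
  have h1 : classMap (formOf x) I i (Finsupp.linearCombination R (fun p => ⟨c p, hc p⟩) s) =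
      classMap (formOf x) I i ⟨e, he⟩ := by
    rw [Finsupp.apply_linearCombination, ← hs, Finsupp.linearCombination_apply]
    rfl
  rw [eq_comm, ← sub_eq_zero, ← map_sub, classMap_eq_zero_iff] at h1
  rw [← coe_linearCombination_cyclesMod hc]
  exact h1

theorem IsResidueBasis.coeff_mem {I : Ideal R} {x : Fin m → R} {i : ℕ} {ι : Type*}
    {c : ι → ⋀[R]^i (Fin m → R)} {hc : ∀ p, c p ∈ cyclesMod (formOf x) I i}
    (hb : IsResidueBasis (Ideal.span (Set.range x)) fun p => classMap (formOf x) I i ⟨c p, hc p⟩)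
    {s : ι →₀ R}
    (hs : Finsupp.linearCombination R (fun p => (c p : ExteriorAlgebra R (Fin m → R))) s ∈
      LinearMap.range (extD (formOf x)) ⊔
        I • (⊤ : Submodule R (ExteriorAlgebra R (Fin m → R)))) (p : ι) :
    s p ∈ Ideal.span (Set.range x) := by
  refine hb.independent s ?_ p
  rw [← coe_linearCombination_cyclesMod hc, ← classMap_eq_zero_iff,
    Finsupp.apply_linearCombination] at hs
  exact hs

theorem isResidueBasis_selfClass {x : Fin m → Q} {i : ℕ} {ι : Type*}
    {z : ι → LinearMap.ker (extD (formOf x) ∘ₗ (⋀[Q]^i (Fin m → Q)).subtype)}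
    (h₁ : ∀ y : ⋀[Q]^i (Fin m → Q), extD (formOf x) (y : ExteriorAlgebra Q (Fin m → Q)) = 0 →
      ∃ s : ι →₀ Q, (y : ExteriorAlgebra Q (Fin m → Q)) - Finsupp.linearCombination Q
        (fun p => ((z p : ⋀[Q]^i (Fin m → Q)) : ExteriorAlgebra Q (Fin m → Q))) s ∈
          LinearMap.range (extD (formOf x)))
    (h₂ : ∀ s : ι →₀ Q, Finsupp.linearCombination Q
        (fun p => ((z p : ⋀[Q]^i (Fin m → Q)) : ExteriorAlgebra Q (Fin m → Q))) s ∈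
          LinearMap.range (extD (formOf x)) → ∀ p, s p ∈ Ideal.span (Set.range x)) :
    IsResidueBasis (Ideal.span (Set.range x)) fun p => selfClass (formOf x) i (z p) := by
  have hcoe : ∀ s : ι →₀ Q, ((Finsupp.linearCombination Q z s : ⋀[Q]^i (Fin m → Q)) :
      ExteriorAlgebra Q (Fin m → Q)) = Finsupp.linearCombination Q
        (fun p => ((z p : ⋀[Q]^i (Fin m → Q)) : ExteriorAlgebra Q (Fin m → Q))) s := by
    intro s
    simp only [Finsupp.linearCombination_apply, Finsupp.sum, Submodule.coe_sum, Submodule.coe_smul]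
  refine ⟨?_, ?_, ?_⟩
  · intro r hr h
    obtain ⟨y, rfl⟩ := selfClass_surjective h
    obtain ⟨v, rfl⟩ := mem_span_range_iff.1 hr
    rw [← map_smul, selfClass_eq_zero_iff]
    have hy : extD (formOf x)
      ((y : ⋀[Q]^i (Fin m → Q)) : ExteriorAlgebra Q (Fin m → Q)) = 0 := y.2
    exact ⟨ExteriorAlgebra.ι Q v * _, by rw [extD_ι_mul, hy, mul_zero, sub_zero]; rfl⟩
  · rw [eq_top_iff]
    rintro h -
    obtain ⟨⟨y, hy⟩, rfl⟩ := selfClass_surjective h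
    obtain ⟨s, hs⟩ := h₁ y hy
    rw [Finsupp.mem_span_range_iff_exists_finsupp]
    refine ⟨s, ?_⟩
    have h3 : selfClass (formOf x) i (Finsupp.linearCombination Q z s) =
        selfClass (formOf x) i ⟨y, hy⟩ := by
      rw [eq_comm, ← sub_eq_zero, ← map_sub, selfClass_eq_zero_iff]
      rw [← hcoe] at hs
      exact hs
    rw [← h3, Finsupp.apply_linearCombination]
    rfl
  · intro s hs
    refine h₂ s ?_
    rw [← hcoe, ← selfClass_eq_zero_iff, Finsupp.apply_linearCombination]
    exact hs

/-- A basis of the homology modulo `I` gives a basis of the homology over `Q = R/I`. -/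
theorem exists_isResidueBasis_baseMap {I : Ideal R} (hs : Function.Surjective (algebraMap R Q))
    (hI : ∀ r, algebraMap R Q r = 0 ↔ r ∈ I) {x : Fin m → R} {i : ℕ} {ι : Type*}
    {c : ι → ⋀[R]^i (Fin m → R)} {h : ι → KoszulHomology (formOf x) (R ⧸ I) i}
    (hc : ∀ p, IsClassOf (formOf x) (1 ⊗ₜ[R] c p) (h p))
    (hb : IsResidueBasis (Ideal.span (Set.range x)) h) :
    ∃ h' : ι → KoszulHomology (formOf fun j => algebraMap R Q (x j)) Q i,
      (∀ p, ∃ z : ⋀[Q]^i (Fin m → Q),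
        (z : ExteriorAlgebra Q (Fin m → Q)) = baseMap R Q m (c p) ∧
          IsClassOf (formOf fun j => algebraMap R Q (x j)) ((1 : Q) ⊗ₜ[Q] z) (h' p)) ∧
      IsResidueBasis (Ideal.span (Set.range fun j => algebraMap R Q (x j))) h' := by
  choose hcyc hh using fun p => isClassOf_iff.1 (hc p)
  obtain rfl : h = fun p => classMap (formOf x) I i ⟨c p, hcyc p⟩ := funext hh
  have hker : ∀ p, extD (formOf fun j => algebraMap R Q (x j)) (baseMap R Q m (c p)) = 0 :=
    fun p => by rw [extD_baseMap, baseMap_eq_zero_iff hI]; exact hcyc p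
  have hcoe : ∀ s : ι →₀ R, Finsupp.linearCombination Q (fun p => baseMap R Q m (c p))
      (s.mapRange (algebraMap R Q) (map_zero _)) = baseMap R Q m (Finsupp.linearCombination R
        (fun p => (c p : ExteriorAlgebra R (Fin m → R))) s) := by
    intro s
    rw [Finsupp.linearCombination_apply, Finsupp.sum_mapRange_index (by simp),
      Finsupp.linearCombination_apply, Finsupp.sum, Finsupp.sum, map_sum]
    simp only [baseMap_smul]
  refine ⟨fun p => selfClass _ i ⟨⟨_, baseMap_mem (c p).2⟩, hker p⟩,
    fun p => ⟨⟨_, baseMap_mem (c p).2⟩, rfl, one_tmul_mem_cycles_self_iff.2 (hker p), rfl⟩,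
    isResidueBasis_selfClass (fun y hy => ?_) fun s hs0 p => ?_⟩
  · obtain ⟨e, he⟩ := exists_baseMap_eq hs y
    have hcyce : e ∈ cyclesMod (formOf x) I i := by
      rw [mem_cyclesMod, ← baseMap_eq_zero_iff (Q := Q) hI, ← extD_baseMap, he, hy]
    obtain ⟨s, hs⟩ := hb.exists_sub_mem hcyce
    refine ⟨s.mapRange (algebraMap R Q) (map_zero _), ?_⟩
    obtain ⟨_, ⟨b, rfl⟩, j, hj, hbj⟩ := Submodule.mem_sup.1 hs
    refine ⟨baseMap R Q m b, ?_⟩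
    rw [hcoe, extD_baseMap, eq_sub_of_add_eq hbj, map_sub, (baseMap_eq_zero_iff hI).2 hj, sub_zero,
      map_sub, he]
  · obtain ⟨s, rfl⟩ := Finsupp.mapRange_surjective (algebraMap R Q) (map_zero _) hs s
    rw [hcoe] at hs0
    obtain ⟨b, hb'⟩ := hs0
    obtain ⟨b, rfl⟩ := baseMap_surjective hs b
    rw [extD_baseMap, eq_comm, ← sub_eq_zero, ← map_sub, baseMap_eq_zero_iff hI] at hb'
    have h1 := hb.coeff_mem (Submodule.mem_sup.2 ⟨_, ⟨b, rfl⟩, _, hb', by abel⟩) p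
    have h2 := Ideal.mem_map_of_mem (algebraMap R Q) h1
    rw [Ideal.map_span, ← Set.range_comp] at h2
    rw [Finsupp.mapRange_apply]
    exact h2

end Transfer

/-! ### A Massey operation that vanishes on words of length at least three -/

section Massey

variable {Q : Type u} [CommRing Q] {M : Type v} [AddCommGroup M] [Module Q M]

theorem mul_ι_of_mem {i : ℕ} {c : ExteriorAlgebra Q M} (hc : c ∈ ⋀[Q]^i M) (v : M) :
    c * ExteriorAlgebra.ι Q v = (-1 : Q) ^ i • (ExteriorAlgebra.ι Q v * c) := by
  induction i generalizing c with
  | zero =>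
    obtain ⟨r, rfl⟩ : ∃ r, algebraMap Q (ExteriorAlgebra Q M) r = c := by
      simpa [ExteriorAlgebra.exteriorPower, Submodule.mem_one] using hc
    rw [pow_zero, one_smul, Algebra.commutes]
  | succ i ih =>
    rw [ExteriorAlgebra.exteriorPower, pow_succ'] at hc
    induction hc using Submodule.mul_induction_on' with
    | mem_mul_mem a ha c hc =>
      obtain ⟨v', rfl⟩ := ha
      have h := eq_neg_of_add_eq_zero_left (ExteriorAlgebra.ι_add_mul_swap (R := Q) v' v)
      rw [mul_assoc, ih hc, mul_smul_comm, ← mul_assoc, h, pow_succ, mul_neg_one, neg_mul,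
        smul_neg, neg_smul, mul_assoc]
    | add a _ c _ h₁ h₂ => rw [add_mul, h₁, h₂, mul_add, smul_add]

theorem mul_ι_mul_of_mem {i : ℕ} {c : ExteriorAlgebra Q M} (hc : c ∈ ⋀[Q]^i M) (v : M)
    (e : ExteriorAlgebra Q M) : c * (ExteriorAlgebra.ι Q v * e) =
      (-1 : Q) ^ i • (ExteriorAlgebra.ι Q v * (c * e)) := by
  rw [← mul_assoc, mul_ι_of_mem hc, smul_mul_assoc, mul_assoc]

theorem mul_mem_exteriorPower {i j k : ℕ} (h : i + j = k) {c e : ExteriorAlgebra Q M}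
    (hc : c ∈ ⋀[Q]^i M) (he : e ∈ ⋀[Q]^j M) : c * e ∈ ⋀[Q]^k M := by
  subst h
  exact SetLike.mul_mem_graded hc he

theorem ι_mem_exteriorPower (v : M) : ExteriorAlgebra.ι Q v ∈ ⋀[Q]^1 M := by
  rw [ExteriorAlgebra.exteriorPower, pow_one]
  exact ⟨v, rfl⟩

variable {Λ A : Type} (deg : Λ → ℕ) (Z : Λ → ExteriorAlgebra Q M) (ex : Λ → A)
  (p q : A → Q) (v : A → M) (good : A → Prop)

open Classical in
/-- A trivial Massey operation that vanishes on the words of length at least `3`. The cycles are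
the `p_α Z`; the products with different exponents vanish, and the others are boundaries of
multiples of the `v_α`. -/
def shortMassey : List Λ → ExteriorAlgebra Q M
  | [l] => p (ex l) • Z l
  | [l, l'] => if ex l = ex l' ∧ good (ex l) then
      ((-1) ^ (deg l + 1) * (p (ex l) * q (ex l))) •
        (ExteriorAlgebra.ι Q (v (ex l)) * (Z l * Z l')) else 0
  | _ => 0

theorem shortMassey_of_three_le {l : List Λ} (h : 3 ≤ l.length) :
    shortMassey deg Z ex p q v good l = 0 := by
  match l, h with
  | _ :: _ :: _ :: _, _ => rfl

variable {deg Z ex p q v good} {φ : Module.Dual Q M}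

theorem shortMassey_mem (hZ : ∀ l, Z l ∈ ⋀[Q]^(deg l) M) {l : List Λ} (hl : l ≠ []) :
    shortMassey deg Z ex p q v good l ∈ ⋀[Q]^(masseyDegree deg l) M := by
  match l with
  | [l] =>
    refine Submodule.smul_mem _ _ ?_
    have : masseyDegree deg [l] = deg l := by simp [masseyDegree]
    rw [this]
    exact hZ l
  | [l, l'] =>
    rw [shortMassey]
    split_ifs
    · refine Submodule.smul_mem _ _ (mul_mem_exteriorPower ?_ (ι_mem_exteriorPower _)
        (mul_mem_exteriorPower rfl (hZ l) (hZ l')))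
      simp [masseyDegree]
      omega
    · exact zero_mem _
  | _ :: _ :: _ :: _ => exact zero_mem _

/-- On two letters, `v` bounds one factor of the coefficient, and `hD` kills the remaining term of
the Leibniz rule. On three letters the two products cancel or have coefficient zero. On four letters
only the product of two pairs could survive, and it vanishes because the vector `v` occurs twice or
the coefficients multiply to zero. On longer words every splitting has a part of length at least
three. -/
theorem extD_shortMassey (hZ : ∀ l, Z l ∈ ⋀[Q]^(deg l) M)
    (hv : ∀ l, φ (v (ex l)) * q (ex l) = p (ex l))
    (hp : ∀ l l', ¬(ex l = ex l' ∧ good (ex l)) → p (ex l) * p (ex l') = 0)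
    (hD : ∀ l l', ex l = ex l' → p (ex l) • extD φ (Z l * Z l') = 0)
    {l : List Λ} (hl : 2 ≤ l.length) :
    extD φ (shortMassey deg Z ex p q v good l) = ∑ j ∈ Finset.Ico 1 l.length,
      (-1 : Q) ^ (masseyDegree deg (l.take j) + 1) •
        (shortMassey deg Z ex p q v good (l.take j) *
          shortMassey deg Z ex p q v good (l.drop j)) := by
  match l, hl with
  | [l₁, l₂], _ =>
    have hsum : ∀ g : ℕ → ExteriorAlgebra Q M, ∑ j ∈ Finset.Ico 1 [l₁, l₂].length, g j = g 1 :=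
      fun g => by simp
    rw [hsum]
    simp only [List.take_succ_cons, List.take_zero, List.drop_succ_cons, List.drop_zero,
      shortMassey, masseyDegree, List.map_cons, List.map_nil, List.sum_cons, List.sum_nil,
      List.length_cons, List.length_nil, add_zero, zero_add, Nat.sub_self]
    by_cases h : ex l₁ = ex l₂ ∧ good (ex l₁)
    · have h1 : ((-1) ^ (deg l₁ + 1) * (p (ex l₁) * q (ex l₁))) •
          (ExteriorAlgebra.ι Q (v (ex l₁)) * extD φ (Z l₁ * Z l₂)) = 0 := by
        rw [show (-1) ^ (deg l₁ + 1) * (p (ex l₁) * q (ex l₁)) =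
            (-1) ^ (deg l₁ + 1) * q (ex l₁) * p (ex l₁) by ring, mul_smul, ← mul_smul_comm,
          hD _ _ h.1, mul_zero, smul_zero]
      rw [if_pos h, map_smul, extD_ι_mul, smul_sub, h1, sub_zero, smul_mul_smul_comm, ← h.1,
        smul_smul, smul_smul]
      congr 1
      rw [mul_assoc, mul_assoc, mul_comm (q _), hv l₁]
    · rw [if_neg h, map_zero, smul_mul_smul_comm, hp _ _ h, zero_smul, smul_zero]
  | [l₁, l₂, l₃], _ =>
    have hsum : ∀ g : ℕ → ExteriorAlgebra Q M,
        ∑ j ∈ Finset.Ico 1 [l₁, l₂, l₃].length, g j = g 1 + g 2 := fun g => by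
      simp [Finset.sum_Ico_succ_top]
    rw [hsum, shortMassey_of_three_le _ _ _ _ _ _ _ (by simp), map_zero]
    simp only [List.take_succ_cons, List.take_zero, List.drop_succ_cons, List.drop_zero,
      shortMassey, masseyDegree, List.map_cons, List.map_nil, List.sum_cons, List.sum_nil,
      List.length_cons, List.length_nil, add_zero, zero_add, Nat.sub_self]
    by_cases h₁ : ex l₁ = ex l₂ ∧ good (ex l₁)
    · by_cases h₂ : ex l₂ = ex l₃ ∧ good (ex l₂)
      -- All three exponents agree. Moving the vector past `Z l₁` contributes the sign that makes
      -- the two products cancel.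
      · rw [if_pos h₁, if_pos h₂, smul_mul_smul_comm, smul_mul_smul_comm, mul_ι_mul_of_mem (hZ l₁),
          smul_smul, smul_smul, smul_smul, ← h₂.1, ← h₁.1, mul_assoc (ExteriorAlgebra.ι Q _),
          mul_assoc (Z l₁), ← add_smul]
        convert (zero_smul Q _).symm using 2
        simp only [Nat.reduceAdd, Nat.reduceSub]
        ring
      · have h3 : p (ex l₁) * p (ex l₃) = 0 := by
          rw [h₁.1]
          exact hp _ _ h₂
        rw [if_pos h₁, if_neg h₂, mul_zero, smul_zero, zero_add, smul_mul_smul_comm,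
          show (-1) ^ (deg l₁ + 1) * (p (ex l₁) * q (ex l₁)) * p (ex l₃) =
            (-1) ^ (deg l₁ + 1) * q (ex l₁) * (p (ex l₁) * p (ex l₃)) by ring, h3, mul_zero,
          zero_smul, smul_zero]
    · rw [if_neg h₁, zero_mul, smul_zero, add_zero]
      by_cases h₂ : ex l₂ = ex l₃ ∧ good (ex l₂)
      · rw [if_pos h₂, smul_mul_smul_comm,
          show p (ex l₁) * ((-1) ^ (deg l₂ + 1) * (p (ex l₂) * q (ex l₂))) =
            (-1) ^ (deg l₂ + 1) * q (ex l₂) * (p (ex l₁) * p (ex l₂)) by ring, hp _ _ h₁, mul_zero,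
          zero_smul, smul_zero]
      · rw [if_neg h₂, mul_zero, smul_zero]
  | [l₁, l₂, l₃, l₄], _ =>
    have hsum : ∀ g : ℕ → ExteriorAlgebra Q M,
        ∑ j ∈ Finset.Ico 1 [l₁, l₂, l₃, l₄].length, g j = g 1 + g 2 + g 3 := fun g => by
      simp [Finset.sum_Ico_succ_top]
    rw [hsum, shortMassey_of_three_le _ _ _ _ _ _ _ (by simp), map_zero]
    simp only [List.take_succ_cons, List.take_zero, List.drop_succ_cons, List.drop_zero,
      shortMassey, mul_zero, zero_mul, smul_zero, add_zero, zero_add]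
    by_cases h₁ : ex l₁ = ex l₂ ∧ good (ex l₁)
    · by_cases h₂ : ex l₃ = ex l₄ ∧ good (ex l₃)
      · rw [if_pos h₁, if_pos h₂, smul_mul_smul_comm]
        by_cases h₃ : ex l₁ = ex l₃ ∧ good (ex l₁)
        -- Equal exponents mean equal vectors `v`, and the square of a vector is zero.
        · rw [← h₃.1, mul_assoc (ExteriorAlgebra.ι Q _),
            mul_ι_mul_of_mem (mul_mem_exteriorPower rfl (hZ l₁) (hZ l₂)), mul_smul_comm,
            ← mul_assoc (ExteriorAlgebra.ι Q _), ExteriorAlgebra.ι_sq_zero, zero_mul, smul_zero,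
            smul_zero, smul_zero]
        · rw [show (-1) ^ (deg l₁ + 1) * (p (ex l₁) * q (ex l₁)) *
              ((-1) ^ (deg l₃ + 1) * (p (ex l₃) * q (ex l₃))) =
            (-1) ^ (deg l₁ + 1) * q (ex l₁) * (-1) ^ (deg l₃ + 1) * q (ex l₃) *
              (p (ex l₁) * p (ex l₃)) by ring, hp _ _ h₃, mul_zero, zero_smul, smul_zero]
      · rw [if_neg h₂, mul_zero, smul_zero]
    · rw [if_neg h₁, zero_mul, smul_zero]
  | l₁ :: l₂ :: l₃ :: l₄ :: l₅ :: l, _ =>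
    rw [shortMassey_of_three_le _ _ _ _ _ _ _ (by simp), map_zero]
    refine (Finset.sum_eq_zero fun j hj => ?_).symm
    rw [Finset.mem_Ico] at hj
    by_cases h : 3 ≤ j
    · rw [shortMassey_of_three_le (l := List.take j _), zero_mul, smul_zero]
      rw [List.length_take]
      simp only [List.length_cons]
      omega
    · rw [shortMassey_of_three_le (l := List.drop j _), mul_zero, smul_zero]
      rw [List.length_drop]
      simp only [List.length_cons]
      omega

end Massey

/-! ### The Golod property modulo a restricted power -/

section Golod

variable {R : Type u} [CommRing R] {F : Type v} [AddCommGroup F] [Module R F] {n m : ℕ}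

/-- The semistandard pairs of positive degree. -/
def StandardHook (w : Fin n → ℕ) (b : ℕ) : Type :=
  {p : Finset (Fin n) × (Fin n →₀ ℕ) // p.1.Nonempty ∧ p ∈ hookSet w b ∧
    ∀ s ∈ p.2.support, ∃ r ∈ p.1, r ≤ s}

/-- The semistandard pairs of a given positive degree. -/
def standardHookEquiv (w : Fin n → ℕ) (b : ℕ) {i : ℕ} (hi : 1 ≤ i) :
    {l : StandardHook w b // l.1.1.card = i} ≃ StandardPair n w (b + 1) i where
  toFun l := ⟨(⟨l.1.1.1, l.2⟩, l.1.1.2), congrArg (· + 1) l.1.2.2.1.1, l.1.2.2.1.2, l.1.2.2.2⟩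
  invFun p := ⟨⟨((p.1.1 : Finset (Fin n)), p.1.2),
    Finset.card_pos.1 (by rw [show (p.1.1 : Finset (Fin n)).card = i from p.1.1.2]; omega),
    ⟨Nat.succ_injective p.2.1, p.2.2.1⟩, p.2.2.2⟩, p.1.1.2⟩
  left_inv _ := rfl
  right_inv _ := rfl

/-- The letters are the semistandard symbols, whose classes for a multiplicative lift form a basis.
The hypotheses of `extD_shortMassey` are the product rules for restricted monomials, read in the
quotient ring. -/
theorem admitsTrivialMasseyOperation {f : Module.Basis (Fin n) R F} {ψ : Module.Dual R F}
    {x : Fin m → R} (hx : IsKoszulExact x) (ha : IsPermutablyRegular fun j => ψ (f j))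
    (ham : ∀ j, ψ (f j) ∈ Ideal.span (Set.range x)) (w : Fin n → ℕ) {d : ℕ} (hd : 2 ≤ d) :
    AdmitsTrivialMasseyOperation
      fun i => Ideal.Quotient.mk (restrictedPower f ψ w d) (x i) := by
  obtain ⟨b, rfl⟩ : ∃ b, d = b + 1 := ⟨d - 1, by omega⟩
  obtain ⟨g, hg⟩ := exists_linearMap_of_mem f ham
  have hI : ∀ r, algebraMap R (R ⧸ restrictedPower f ψ w (b + 1)) r = 0 ↔
      r ∈ restrictedPower f ψ w (b + 1) := fun r => Ideal.Quotient.eq_zero_iff_mem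
  have hs : Function.Surjective (algebraMap R (R ⧸ restrictedPower f ψ w (b + 1))) :=
    Ideal.Quotient.mk_surjective
  let π := baseMap R (R ⧸ restrictedPower f ψ w (b + 1)) m
  have hα : ∀ l : StandardHook w b, ∃ s, l.1.2 s ≠ 0 := fun l => by
    by_contra! h
    have h1 : l.1.2 = 0 := Finsupp.ext h
    have h2 : l.1.2.degree = b := l.2.2.1.1
    rw [h1] at h2
    simp at h2
    omega
  -- `q α` and `v α` split one factor `a s` off `a^α`, with the same chosen `s` in both. The default
  -- 0 is never reached on letters, since their exponents have degree `b ≥ 1`.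
  let q : (Fin n →₀ ℕ) → R := fun α => open Classical in if h : ∃ s, α s ≠ 0 then
    evalMonomial (fun j => ψ (f j)) (α - Finsupp.single h.choose 1) else 0
  let v : (Fin n →₀ ℕ) → (Fin m → R) := fun α => open Classical in if h : ∃ s, α s ≠ 0 then
    g (f h.choose) else 0
  have hqv : ∀ α : Fin n →₀ ℕ, (∃ s, α s ≠ 0) →
      formOf x (v α) * q α = evalMonomial (fun j => ψ (f j)) α := fun α h => by
    simp only [q, v, dif_pos h]
    rw [evalMonomial_of_pos (fun j => ψ (f j)) h.choose_spec, ← LinearMap.comp_apply, hg]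
  let Z : StandardHook w b → ExteriorAlgebra R (Fin m → R) := fun l =>
    ExteriorAlgebra.map g (f.ExteriorAlgebra l.1.1)
  have hZ : ∀ l, Z l ∈ ⋀[R]^l.1.1.card (Fin m → R) := fun l => by
    change ExteriorAlgebra.map g (f.ExteriorAlgebra l.1.1) ∈ _
    rw [← liftFamily_ofLinearMap f g hg]
    exact liftFamily_mem f _ _
  refine ⟨StandardHook w b, fun l => l.1.1.card,
    shortMassey (fun l => l.1.1.card) (fun l => π (Z l)) (fun l => l.1.2)
      (fun α => algebraMap R _ (evalMonomial (fun j => ψ (f j)) α)) (fun α => algebraMap R _ (q α))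
      (fun α j => algebraMap R _ (v α j)) (IsSaturated w), fun l => Finset.card_pos.2 l.2.1,
    fun l hl => shortMassey_mem (fun l => baseMap_mem (hZ l)) hl, fun i hi => ?_, fun l hl => ?_⟩
  · obtain ⟨h, hc, hb⟩ := (koszulHomologyDescription hx ha ham w (by omega : 1 ≤ b + 1)).basis
      (KoszulLift.ofLinearMap g hg) i hi
    obtain ⟨h', hc', hb'⟩ := exists_isResidueBasis_baseMap hs hI
      (fun p => hc (standardHookEquiv w b hi p)) (hb.comp_equiv (standardHookEquiv w b hi))
    refine ⟨h', fun l => ?_, hb'⟩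
    obtain ⟨z, hz, hzc⟩ := hc' l
    refine ⟨z, ?_, hzc⟩
    rw [hz, liftedElement_coe, hookEval_hook, liftFamily_ofLinearMap, baseMap_smul]
    rfl
  · refine extD_shortMassey (fun l => baseMap_mem (hZ l)) (fun l => ?_) (fun l l' h => ?_)
      (fun l l' h => ?_) hl
    · change formOf (fun i => algebraMap R (R ⧸ restrictedPower f ψ w (b + 1)) (x i)) _ * _ = _
      rw [formOf_algebraMap, ← map_mul, hqv _ (hα l)]
    · rw [← map_mul, hI, restrictedPower_eq]
      exact evalMonomial_mul_mem _ (mem_hookSet_iff.1 l.2.2.1).1 (mem_hookSet_iff.1 l'.2.2.1).1 h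
    · change _ • extD (formOf fun i => algebraMap R (R ⧸ restrictedPower f ψ w (b + 1)) (x i))
        (π (Z l) * π (Z l')) = 0
      rw [← map_mul π, extD_baseMap, ← baseMap_smul, baseMap_eq_zero_iff hI, restrictedPower_eq]
      exact evalMonomial_smul_mem (mem_hookSet_iff.1 l.2.2.1).1 (extD_map_extBasis_mul_mem hg
        (mem_hookSet_iff.1 l.2.2.1).2 
          ((mem_hookSet_iff.1 l'.2.2.1).2.trans_eq (congrArg (freeIndices w) h.symm)))

end Golod

/-! ### Regular sequences given as lists -/

section RegularSequences

variable {R : Type u} [CommRing R] {n : ℕ}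

theorem ofList_take_ofFn (a : Fin n → R) (i : Fin n) :
    Ideal.ofList ((List.ofFn a).take i) = subsetIdeal a (Finset.univ.filter (· < i)) := by
  rw [Ideal.ofList, subsetIdeal]
  congr 1
  ext r
  simp only [Set.mem_ofPred_eq, Set.mem_image, Finset.coe_filter, Finset.mem_univ, true_and,
    List.mem_take_iff_getElem, List.length_ofFn, List.getElem_ofFn]
  constructor
  · rintro ⟨j, hj, rfl⟩
    exact ⟨⟨j, by omega⟩, by rw [Fin.lt_def]; simp only; omega, rfl⟩
  · rintro ⟨j, hj, rfl⟩
    exact ⟨j, by rw [Fin.lt_def] at hj; omega, rfl⟩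

theorem mem_of_isWeaklyRegular {a : Fin n → R}
    (h : RingTheory.Sequence.IsWeaklyRegular R (List.ofFn a)) (i : Fin n) (r : R)
    (hr : a i * r ∈ subsetIdeal a (Finset.univ.filter (· < i))) :
    r ∈ subsetIdeal a (Finset.univ.filter (· < i)) := by
  have h1 := (RingTheory.Sequence.isWeaklyRegular_iff_Fin R _).1 h ⟨i, by simp⟩
  rw [isSMulRegular_iff_right_eq_zero_of_smul] at h1
  have h2 := h1 (Submodule.Quotient.mk r)
  rw [← Submodule.Quotient.mk_smul, Submodule.Quotient.mk_eq_zero,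
    Submodule.Quotient.mk_eq_zero] at h2
  simp only [smul_eq_mul, Ideal.mul_top, ofList_take_ofFn, Fin.getElem_fin,
    List.getElem_ofFn] at h2
  exact h2 hr

theorem span_range_ne_top_of_isRegular {a : Fin n → R}
    (h : RingTheory.Sequence.IsRegular R (List.ofFn a)) : Ideal.span (Set.range a) ≠ ⊤ := by
  intro h'
  refine h.top_ne_smul ?_
  rw [smul_eq_mul, Ideal.mul_top, eq_comm, ← h', Ideal.ofList]
  congr 1
  ext r
  simp [List.mem_ofFn]

end RegularSequences

/-! ### Local rings -/

section LocalRing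

variable {R : Type u} [CommRing R] [IsLocalRing R] {n : ℕ}

/-- In a Noetherian local ring, regular sequences are permutable. -/
theorem isPermutablyRegular_of_isRegular [IsNoetherianRing R] {a : Fin n → R}
    (h : RingTheory.Sequence.IsRegular R (List.ofFn a)) : IsPermutablyRegular a := by
  refine isPermutablyRegular_of_separated (mem_of_isWeaklyRegular h.toIsWeaklyRegular) ?_
  intro U s r hr
  have hs : Ideal.span {a s} ≠ ⊤ := fun h' => span_range_ne_top_of_isRegular h (by
    rw [eq_top_iff, ← h']
    exact Ideal.span_mono (Set.singleton_subset_iff.2 ⟨s, rfl⟩))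
  -- Krull's intersection theorem for the module `R ⧸ subsetIdeal a U` gives the closedness needed
  -- to permute the sequence.
  have h1 := Ideal.iInf_pow_smul_eq_bot_of_isLocalRing (M := R ⧸ subsetIdeal a U) _ hs
  rw [← Submodule.Quotient.mk_eq_zero (p := subsetIdeal a U), ← Submodule.mem_bot R, ← h1,
    Submodule.mem_iInf]
  intro k
  obtain ⟨j, hj, c, hc, rfl⟩ := Submodule.mem_sup.1 (hr k)
  obtain ⟨c, rfl⟩ := Ideal.mem_span_singleton'.1 hc
  rw [Submodule.Quotient.mk_add, (Submodule.Quotient.mk_eq_zero _).2 hj, zero_add, mul_comm,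
    ← smul_eq_mul, Submodule.Quotient.mk_smul, Ideal.span_singleton_pow]
  exact Submodule.smul_mem_smul (Ideal.mem_span_singleton_self _) trivial

theorem mem_maximalIdeal_of_isRegular {a : Fin n → R}
    (h : RingTheory.Sequence.IsRegular R (List.ofFn a)) (j : Fin n) :
    a j ∈ IsLocalRing.maximalIdeal R :=
  IsLocalRing.le_maximalIdeal (span_range_ne_top_of_isRegular h) (Ideal.subset_span ⟨j, rfl⟩)

theorem le_of_le_add_natCast {a b : ℕ} {d : WithBot ℕ∞} (h : (a : WithBot ℕ∞) ≤ d + b) :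
    ((a - b : ℕ) : WithBot ℕ∞) ≤ d := by
  induction d with
  | bot => simp at h
  | coe d =>
    induction d with
    | top => exact le_top
    | coe d =>
      have h' : a ≤ d + b := by exact_mod_cast h
      exact WithBot.coe_le_coe.2 (Nat.cast_le.2 (by omega : a - b ≤ d))

theorem map_mk_maximalIdeal {I : Ideal R} [IsLocalRing (R ⧸ I)] :
    (IsLocalRing.maximalIdeal R).map (Ideal.Quotient.mk I) = IsLocalRing.maximalIdeal (R ⧸ I) := by
  have hI : I ≤ IsLocalRing.maximalIdeal R :=
    IsLocalRing.le_maximalIdeal (Ideal.Quotient.nontrivial_iff.1 inferInstance)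
  rcases Ideal.map_eq_top_or_isMaximal_of_surjective (Ideal.Quotient.mk I)
    Ideal.Quotient.mk_surjective (IsLocalRing.maximalIdeal.isMaximal R) with h | h
  · have h1 := congrArg (Ideal.comap (Ideal.Quotient.mk I)) h
    rw [Ideal.comap_map_of_surjective _ Ideal.Quotient.mk_surjective, ← RingHom.ker_eq_comap_bot,
      Ideal.mk_ker, sup_eq_left.2 hI, Ideal.comap_top] at h1
    exact absurd h1 (IsLocalRing.maximalIdeal.isMaximal R).ne_top
  · exact IsLocalRing.eq_maximalIdeal h

/-- Otherwise the maximal ideal would be covered by its square and the finitely many minimal primes.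
Prime avoidance, which tolerates a non-prime member such as the square, puts it inside one of them.
The square is excluded by Nakayama and a minimal prime by height, as the dimension is positive. -/
theorem exists_mem_not_mem_sq_minimalPrimes [IsNoetherianRing R] (hdim : 1 ≤ ringKrullDim R) :
    ∃ z ∈ IsLocalRing.maximalIdeal R, z ∉ IsLocalRing.maximalIdeal R ^ 2 ∧
      ∀ P ∈ minimalPrimes R, z ∉ P := by
  classical
  by_contra! hcon
  have hfin := minimalPrimes.finite_of_isNoetherianRing R
  have hle : ∀ P ∈ minimalPrimes R, ¬ IsLocalRing.maximalIdeal R ≤ P := by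
    intro P hP hle
    have hPp : P.IsPrime := hP.1.1
    have : IsLocalRing.maximalIdeal R = P :=
      le_antisymm hle (IsLocalRing.le_maximalIdeal hPp.ne_top)
    rw [← IsLocalRing.maximalIdeal_height_eq_ringKrullDim,
      Ideal.height_eq_zero_iff.2 (this ▸ hP)] at hdim
    norm_num at hdim
  have h1 : ((IsLocalRing.maximalIdeal R : Ideal R) : Set R) ⊆
      ⋃ J ∈ ((insert (IsLocalRing.maximalIdeal R ^ 2) hfin.toFinset : Finset (Ideal R)) :
        Set (Ideal R)), (J : Set R) := by
    intro z hz
    rw [Set.mem_iUnion₂]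
    by_cases hz2 : z ∈ IsLocalRing.maximalIdeal R ^ 2
    · exact ⟨_, Finset.mem_coe.2 (Finset.mem_insert_self _ _), hz2⟩
    · obtain ⟨P, hP, hzP⟩ := hcon z hz hz2
      exact ⟨P, Finset.mem_coe.2 (Finset.mem_insert_of_mem (hfin.mem_toFinset.2 hP)), hzP⟩
  obtain ⟨J, hJ, hle'⟩ := (Ideal.subset_union_prime (f := fun J : Ideal R => J)
    (IsLocalRing.maximalIdeal R ^ 2) (IsLocalRing.maximalIdeal R ^ 2) fun J hJ hne _ =>
      (hfin.mem_toFinset.1 (Finset.mem_of_mem_insert_of_ne hJ hne)).1.1).1 h1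
  rcases Finset.mem_insert.1 hJ with rfl | hJ
  · have h0 : IsLocalRing.maximalIdeal R = ⊥ :=
      Submodule.eq_bot_of_le_smul_of_le_jacobson_bot (IsLocalRing.maximalIdeal R) _
        (IsNoetherian.noetherian _) (by rw [smul_eq_mul, ← sq]; exact hle')
        (IsLocalRing.jacobson_eq_maximalIdeal ⊥ bot_ne_top).ge
    obtain ⟨P, hP, -⟩ := Ideal.exists_minimalPrimes_le (bot_le : ⊥ ≤ IsLocalRing.maximalIdeal R)
    exact hle P hP (h0 ▸ bot_le)
  · exact hle J (hfin.mem_toFinset.1 hJ) hle'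

/-- A Noetherian local ring whose maximal ideal is generated by at most `dim R` elements is a
domain. -/
theorem isDomain_of_card_le (k : ℕ) : ∀ (R : Type u) [CommRing R] [IsLocalRing R]
    [IsNoetherianRing R] (S : Finset R),
    Ideal.span (S : Set R) = IsLocalRing.maximalIdeal R → S.card ≤ k →
    (k : WithBot ℕ∞) ≤ ringKrullDim R → IsDomain R := by
  classical
  induction k with
  | zero =>
    intro R _ _ _ S hS hc _
    rw [Finset.card_eq_zero.1 (Nat.le_zero.1 hc), Finset.coe_empty, Ideal.span_empty] at hS
    exact (IsLocalRing.isField_iff_maximalIdeal_eq.2 hS.symm).isDomain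
  | succ k ih =>
    intro R _ _ _ S hS hc hdim
    obtain ⟨z, hz, hz2, hzP⟩ := exists_mem_not_mem_sq_minimalPrimes (R := R)
      (le_trans (by exact_mod_cast Nat.succ_le_succ (Nat.zero_le k)) hdim)
    have hne : Ideal.span {z} ≠ ⊤ := fun h => (IsLocalRing.maximalIdeal.isMaximal R).ne_top
      (eq_top_iff.2 (h ▸ (Ideal.span_singleton_le_iff_mem _).2 hz))
    have : Nontrivial (R ⧸ Ideal.span {z}) := Ideal.Quotient.nontrivial_iff.2 hne
    have : IsLocalRing (R ⧸ Ideal.span {z}) :=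
      IsLocalRing.of_surjective' (Ideal.Quotient.mk _) Ideal.Quotient.mk_surjective
    obtain ⟨c, hcz⟩ : ∃ c : R → R, ∑ s ∈ S, c s * s = z := by
      rw [← hS] at hz
      obtain ⟨c, -, hc⟩ := Submodule.mem_span_finset.1 hz
      exact ⟨c, hc⟩
    -- As `z` is outside the square of the maximal ideal, some generator has a unit coefficient in
    -- `z` and becomes redundant modulo `z`.
    obtain ⟨s, hs, hu⟩ : ∃ s ∈ S, IsUnit (c s) := by
      by_contra! hcon
      refine hz2 (hcz ▸ sum_mem fun s hs => ?_)
      rw [sq]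
      exact Ideal.mul_mem_mul ((IsLocalRing.mem_maximalIdeal _).2 (hcon s hs))
        (hS ▸ Ideal.subset_span hs)
    have hdom := ih (R ⧸ Ideal.span {z}) ((S.erase s).image (Ideal.Quotient.mk _)) (by
        rw [← map_mk_maximalIdeal, Finset.coe_image, ← Ideal.map_span, ← hS]
        refine le_antisymm (Ideal.map_mono (Ideal.span_mono (by simp))) ?_
        rw [Ideal.map_le_iff_le_comap, Ideal.span_le]
        intro t ht
        rw [SetLike.mem_coe, Ideal.mem_comap]
        have herase : ∀ t ∈ S.erase s, Ideal.Quotient.mk (Ideal.span {z}) t ∈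
            (Ideal.span ((S.erase s : Finset R) : Set R)).map (Ideal.Quotient.mk (Ideal.span {z})) :=
          fun t ht => Ideal.mem_map_of_mem _ (Ideal.subset_span ht)
        by_cases hts : t = s
        · subst hts
          have h1 : Ideal.Quotient.mk (Ideal.span {z}) (∑ s ∈ S, c s * s) = 0 := by
            rw [hcz]
            exact Ideal.Quotient.eq_zero_iff_mem.2 (Ideal.mem_span_singleton_self z)
          rw [← Finset.add_sum_erase S _ hs, map_add, map_mul, map_sum] at h1
          have h2 := eq_neg_of_add_eq_zero_left h1
          rw [← Ideal.unit_mul_mem_iff_mem _ (hu.map (Ideal.Quotient.mk (Ideal.span {z}))), h2]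
          refine neg_mem (sum_mem fun t ht => ?_)
          rw [map_mul]
          exact Ideal.mul_mem_left _ _ (herase t ht)
        · exact herase t (Finset.mem_erase.2 ⟨hts, ht⟩))
      (Finset.card_image_le.trans (by rw [Finset.card_erase_of_mem hs]; omega)) (by
        have := ringKrullDim_le_ringKrullDim_quotient_add_card {z} (by
          rw [IsLocalRing.ringJacobson_eq_maximalIdeal]
          simpa using hz)
        rw [Finset.coe_singleton, Finset.card_singleton] at this
        simpa using le_of_le_add_natCast (hdim.trans this))
    have hprime : (Ideal.span {z}).IsPrime := (Ideal.Quotient.isDomain_iff_prime _).1 hdom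
    obtain ⟨P, hP, hPz⟩ := Ideal.exists_minimalPrimes_le (bot_le : ⊥ ≤ Ideal.span {z})
    have hPp : P.IsPrime := hP.1.1
    -- A minimal prime `P` inside the prime ideal `(z)` satisfies `P = zP`, because `z ∉ P`;
    -- Nakayama gives `P = 0`.
    have hP0 : P = ⊥ := by
      refine Submodule.eq_bot_of_le_smul_of_le_jacobson_bot (IsLocalRing.maximalIdeal R) P
        (IsNoetherian.noetherian _) (fun p hp => ?_)
        (IsLocalRing.jacobson_eq_maximalIdeal ⊥ bot_ne_top).ge
      obtain ⟨r, rfl⟩ := Ideal.mem_span_singleton'.1 (hPz hp)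
      rw [mul_comm]
      exact Submodule.smul_mem_smul hz ((hPp.mem_or_mem hp).resolve_right (hzP P hP))
    rw [hP0] at hPp
    exact IsDomain.of_bot_isPrime R

/-- In a regular local ring the Koszul complex on minimal generators of the maximal ideal is
exact. -/
theorem isKoszulExact_of_le_ringKrullDim [IsNoetherianRing R] {m : ℕ} {x : Fin m → R}
    (hx : Ideal.span (Set.range x) = IsLocalRing.maximalIdeal R)
    (hm : (m : WithBot ℕ∞) ≤ ringKrullDim R) : IsKoszulExact x := by
  classical
  refine isKoszulExact_of_regular fun i r hr => ?_
  set U := Finset.univ.filter (· < i) with hU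
  have hiU : i ∉ U := by simp [hU]
  have hxm : ∀ j, x j ∈ IsLocalRing.maximalIdeal R := fun j => hx ▸ Ideal.subset_span ⟨j, rfl⟩
  have hJ : subsetIdeal x U ≤ IsLocalRing.maximalIdeal R := by
    rw [subsetIdeal, Ideal.span_le]
    rintro _ ⟨j, -, rfl⟩
    exact hxm j
  have hne : subsetIdeal x U ≠ ⊤ := fun h =>
    (IsLocalRing.maximalIdeal.isMaximal R).ne_top (eq_top_iff.2 (h ▸ hJ))
  have : Nontrivial (R ⧸ subsetIdeal x U) := Ideal.Quotient.nontrivial_iff.2 hne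
  have : IsLocalRing (R ⧸ subsetIdeal x U) :=
    IsLocalRing.of_surjective' (Ideal.Quotient.mk _) Ideal.Quotient.mk_surjective
  -- Generators are counted as finite sets of values, so no injectivity of `x` is needed; each
  -- element of the image of `U` lowers the dimension by at most one.
  have hdom := isDomain_of_card_le (m - (U.image x).card) (R ⧸ subsetIdeal x U)
    ((Finset.univ.image x \ U.image x).image (Ideal.Quotient.mk _)) (by
      rw [← map_mk_maximalIdeal, ← hx, Finset.coe_image, ← Ideal.map_span]
      refine le_antisymm (Ideal.map_mono (Ideal.span_mono (by
        intro t ht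
        have := (Finset.mem_sdiff.1 ht).1
        simpa using this))) ?_
      rw [Ideal.map_le_iff_le_comap, Ideal.span_le]
      rintro _ ⟨j, rfl⟩
      rw [SetLike.mem_coe, Ideal.mem_comap]
      by_cases hj : x j ∈ U.image x
      · obtain ⟨l, hl, hlj⟩ := Finset.mem_image.1 hj
        rw [← hlj, Ideal.Quotient.eq_zero_iff_mem.2 (mem_subsetIdeal hl)]
        exact zero_mem _
      · exact Ideal.mem_map_of_mem _ (Ideal.subset_span (by
          rw [Finset.mem_coe, Finset.mem_sdiff]
          exact ⟨Finset.mem_image_of_mem _ (Finset.mem_univ _), hj⟩)))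
    (Finset.card_image_le.trans (by
      rw [Finset.card_sdiff_of_subset (Finset.image_subset_image (Finset.subset_univ _))]
      have : (Finset.univ.image x).card ≤ m :=
        Finset.card_image_le.trans (by simp)
      omega))
    (by
      have := ringKrullDim_le_ringKrullDim_quotient_add_card (U.image x) (by
        rw [IsLocalRing.ringJacobson_eq_maximalIdeal]
        intro t ht
        obtain ⟨j, -, rfl⟩ := Finset.mem_image.1 ht
        exact hxm j)
      rw [Finset.coe_image] at this
      exact le_of_le_add_natCast (hm.trans this))
  have hprime : (subsetIdeal x U).IsPrime := (Ideal.Quotient.isDomain_iff_prime _).1 hdom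
  -- If `x i` were in the ideal of its predecessors, `m - 1` elements would generate the maximal
  -- ideal, fewer than the dimension allows.
  refine (hprime.mem_or_mem hr).resolve_left fun hi => ?_
  have hspan : Ideal.span (((Finset.univ.erase i).image x : Finset R) : Set R) =
      IsLocalRing.maximalIdeal R := by
    rw [← hx]
    refine le_antisymm (Ideal.span_mono (by simp)) ?_
    rw [Ideal.span_le]
    rintro _ ⟨j, rfl⟩
    by_cases hj : j = i
    · subst hj
      refine Ideal.span_mono ?_ hi
      rw [Finset.coe_image]
      exact Set.image_mono fun l hl => Finset.mem_coe.2 (Finset.mem_erase.2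
        ⟨fun h => hiU (h ▸ hl), Finset.mem_univ _⟩)
    · exact Ideal.subset_span (Finset.mem_coe.2 (Finset.mem_image_of_mem _
        (Finset.mem_erase.2 ⟨hj, Finset.mem_univ _⟩)))
  have h1 := hm.trans (ringKrullDim_le_spanFinrank_maximalIdeal R)
  rw [← hspan] at h1
  have h2 : m ≤ (Ideal.span (((Finset.univ.erase i).image x : Finset R) : Set R)).spanFinrank := by
    exact_mod_cast h1
  have h3 := h2.trans (Submodule.spanFinrank_span_le_ncard_of_finite (Finset.finite_toSet _))
  rw [Set.ncard_coe_finset] at h3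
  have h4 := h3.trans Finset.card_image_le
  rw [Finset.card_erase_of_mem (Finset.mem_univ _), Finset.card_univ, Fintype.card_fin] at h4
  have := i.2
  omega

/-- Needed so that passing to the quotient does not change minimal numbers of generators. -/
theorem restrictedPower_le_sq {R : Type u} [CommRing R] {F : Type v} [AddCommGroup F] [Module R F]
    {f : Module.Basis (Fin n) R F} {ψ : Module.Dual R F} {𝔪 : Ideal R} (h : ∀ j, ψ (f j) ∈ 𝔪)
    (w : Fin n → ℕ) {d : ℕ} (hd : 2 ≤ d) : restrictedPower f ψ w d ≤ 𝔪 ^ 2 := by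
  rw [restrictedPower_eq, restrictedIdeal, Ideal.span_le]
  rintro _ ⟨α, hα, rfl⟩
  have hdeg : α.degree = d := (mem_restrictedExponents.1 hα).2
  obtain ⟨s, hs⟩ : ∃ s, α s ≠ 0 := by
    by_contra! h0
    rw [show α = 0 from Finsupp.ext h0] at hdeg
    simp at hdeg
    omega
  have hdeg' := degree_tsub_single_add hs
  rw [SetLike.mem_coe, evalMonomial_of_pos _ hs, sq]
  refine Ideal.mul_mem_mul (h s) (evalMonomial_mem_maximal h fun h0 => ?_)
  rw [h0] at hdeg'
  simp at hdeg'
  omega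

/-- Any minimal generators of the maximal ideal of the quotient lift to elements that generate the
maximal ideal of `R`, at most dim `R` in number, so their Koszul complex over `R` is exact. -/
theorem isGolodRing_of_isRegularLocalRing {R : Type u} [CommRing R] [IsRegularLocalRing R]
    {F : Type v} [AddCommGroup F] [Module R F] {f : Module.Basis (Fin n) R F}
    {ψ : Module.Dual R F} (hψ : RingTheory.Sequence.IsRegular R (List.ofFn fun j => ψ (f j)))
    (w : Fin n → ℕ) {d : ℕ} (hd : 2 ≤ d) : IsGolodRing (R ⧸ restrictedPower f ψ w d) := by
  have hI := restrictedPower_le_sq (mem_maximalIdeal_of_isRegular hψ) w hd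
  have hne : restrictedPower f ψ w d ≠ ⊤ := fun h =>
    (IsLocalRing.maximalIdeal.isMaximal R).ne_top
      (eq_top_iff.2 (h ▸ hI.trans (Ideal.pow_le_self two_ne_zero)))
  have : Nontrivial (R ⧸ restrictedPower f ψ w d) := Ideal.Quotient.nontrivial_iff.2 hne
  have hloc : IsLocalRing (R ⧸ restrictedPower f ψ w d) :=
    IsLocalRing.of_surjective' (Ideal.Quotient.mk _) Ideal.Quotient.mk_surjective
  refine @IsGolodRing.mk _ _ hloc inferInstance ?_
  intro m y hy hm
  choose y' hy' using fun i => Ideal.Quotient.mk_surjective (y i)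
  obtain rfl : (fun i => Ideal.Quotient.mk _ (y' i)) = y := funext hy'
  have hspan : Ideal.span (Set.range y') = IsLocalRing.maximalIdeal R := by
    rw [← map_mk_maximalIdeal, show (fun i => Ideal.Quotient.mk (restrictedPower f ψ w d) (y' i)) =
      Ideal.Quotient.mk (restrictedPower f ψ w d) ∘ y' from rfl, Set.range_comp,
      ← Ideal.map_span] at hy
    have h1 := congrArg (Ideal.comap (Ideal.Quotient.mk (restrictedPower f ψ w d))) hy
    rw [Ideal.comap_map_of_surjective _ Ideal.Quotient.mk_surjective,
      Ideal.comap_map_of_surjective _ Ideal.Quotient.mk_surjective, ← RingHom.ker_eq_comap_bot,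
      Ideal.mk_ker, sup_eq_left.2 (hI.trans (Ideal.pow_le_self two_ne_zero))] at h1
    refine le_antisymm (h1 ▸ le_sup_left) ?_
    -- The lifted elements generate the maximal ideal modulo its square, which suffices by Nakayama.
    refine Submodule.le_of_le_smul_of_le_jacobson_bot (I := IsLocalRing.maximalIdeal R)
      (IsNoetherian.noetherian _) (IsLocalRing.jacobson_eq_maximalIdeal ⊥ bot_ne_top).ge ?_
    conv_lhs => rw [← h1]
    refine sup_le_sup_left ?_ _
    rw [smul_eq_mul, ← sq]
    exact hI
  have hdim : (m : WithBot ℕ∞) ≤ ringKrullDim R := by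
    rw [← IsRegularLocalRing.spanFinrank_maximalIdeal, hm, ← map_mk_maximalIdeal]
    exact_mod_cast Ideal.spanFinrank_map_le_of_fg _ (IsNoetherian.noetherian _)
  refine admitsTrivialMasseyOperation (isKoszulExact_of_le_ringKrullDim hspan hdim)
    (isPermutablyRegular_of_isRegular hψ) (fun j => ?_) w hd
  rw [hspan]
  exact mem_maximalIdeal_of_isRegular hψ j

end LocalRing

/-! ### Standard graded polynomial rings -/

section Polynomial

variable {k : Type u} [Field k] {m n : ℕ}

theorem homogeneousComponent_mul_of_isHomogeneous {a : MvPolynomial (Fin m) k} {D : ℕ}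
    (ha : a.IsHomogeneous D) (c : MvPolynomial (Fin m) k) (e : ℕ) :
    MvPolynomial.homogeneousComponent e (a * c) = ∑ l ∈ Finset.range (c.totalDegree + 1),
      if D + l = e then a * MvPolynomial.homogeneousComponent l c else 0 := by
  conv_lhs => rw [← MvPolynomial.sum_homogeneousComponent c, Finset.mul_sum, map_sum]
  refine Finset.sum_congr rfl fun l _ => ?_
  rw [MvPolynomial.homogeneousComponent_of_mem (ha.mul
    (MvPolynomial.homogeneousComponent_isHomogeneous l c))]
  simp only [eq_comm]

theorem homogeneousComponent_mem_subsetIdeal {a : Fin n → MvPolynomial (Fin m) k}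
    (ha : ∀ j, ∃ D : ℕ, 0 < D ∧ (a j).IsHomogeneous D) {U : Finset (Fin n)}
    {r : MvPolynomial (Fin m) k} (hr : r ∈ subsetIdeal a U) (e : ℕ) :
    MvPolynomial.homogeneousComponent e r ∈ subsetIdeal a U := by
  rw [subsetIdeal] at hr
  -- The claim is strengthened to all multiples `c * r`, which makes the scalar step immediate; it
  -- is applied with `c = 1`.
  refine Submodule.span_induction (p := fun r _ => ∀ c,
    MvPolynomial.homogeneousComponent e (c * r) ∈ subsetIdeal a U) ?_ ?_ ?_ ?_ hr 1 |> fun h => by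
      rwa [one_mul] at h
  · rintro _ ⟨j, hj, rfl⟩ c
    obtain ⟨D, -, hD⟩ := ha j
    rw [mul_comm, homogeneousComponent_mul_of_isHomogeneous hD]
    refine sum_mem fun l _ => ?_
    split_ifs
    · exact Ideal.mul_mem_right _ _ (mem_subsetIdeal hj)
    · exact zero_mem _
  · intro c
    rw [mul_zero, map_zero]
    exact zero_mem _
  · intro r r' _ _ h h' c
    rw [mul_add, map_add]
    exact add_mem (h c) (h' c)
  · intro s r _ h c
    rw [smul_eq_mul, ← mul_assoc]
    exact h _

/-- Regular sequences of homogeneous elements of positive degree are permutable. -/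
theorem isPermutablyRegular_of_isHomogeneous {a : Fin n → MvPolynomial (Fin m) k}
    (ha : ∀ j, ∃ D : ℕ, 0 < D ∧ (a j).IsHomogeneous D)
    (h : RingTheory.Sequence.IsRegular (MvPolynomial (Fin m) k) (List.ofFn a)) :
    IsPermutablyRegular a := by
  refine isPermutablyRegular_of_separated (mem_of_isWeaklyRegular h.toIsWeaklyRegular) ?_
  intro U s r hr
  rw [← MvPolynomial.sum_homogeneousComponent r]
  refine sum_mem fun e _ => ?_
  obtain ⟨D, hD0, hD⟩ := ha s
  -- Since `a s` has positive degree, multiples of `a s ^ (e + 1)` have no component of degree `e`.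
  obtain ⟨j, hj, c, hc, hjc⟩ := Submodule.mem_sup.1 (hr (e + 1))
  obtain ⟨c, rfl⟩ := Ideal.mem_span_singleton'.1 hc
  have h0 : MvPolynomial.homogeneousComponent e (c * a s ^ (e + 1)) = 0 := by
    rw [mul_comm, homogeneousComponent_mul_of_isHomogeneous (hD.pow (e + 1))]
    refine Finset.sum_eq_zero fun l _ => if_neg fun hl => ?_
    have := Nat.mul_le_mul_right (e + 1) hD0
    rw [mul_comm] at this
    omega
  rw [← hjc, map_add, h0, add_zero]
  exact homogeneousComponent_mem_subsetIdeal ha hj e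

theorem mem_span_X_of_isHomogeneous {p : MvPolynomial (Fin m) k} {D : ℕ} (hD : 0 < D)
    (hp : p.IsHomogeneous D) :
    p ∈ Ideal.span (Set.range (MvPolynomial.X : Fin m → MvPolynomial (Fin m) k)) := by
  rw [← Set.image_univ, MvPolynomial.mem_ideal_span_X_image]
  intro α hα
  by_contra! h
  have h0 : α = 0 := Finsupp.ext fun i => h i trivial
  have := hp.coeff_eq_zero (d := α) (by rw [h0]; simpa using hD.ne)
  exact MvPolynomial.mem_support_iff.1 hα this

/-- Membership in an ideal of variables is read off the support, and multiplication by `X i` does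
not change the exponents at the earlier variables. -/
theorem isKoszulExact_X :
    IsKoszulExact (MvPolynomial.X : Fin m → MvPolynomial (Fin m) k) := by
  refine isKoszulExact_of_regular fun i r hr => ?_
  rw [subsetIdeal, MvPolynomial.mem_ideal_span_X_image] at hr ⊢
  intro α hα
  obtain ⟨j, hj, hj'⟩ := hr (Finsupp.single i 1 + α) (by
    rw [MvPolynomial.mem_support_iff, MvPolynomial.coeff_X_mul]
    exact MvPolynomial.mem_support_iff.1 hα)
  refine ⟨j, hj, ?_⟩
  have hji : j ≠ i := by
    rintro rfl
    simp at hj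
  rwa [Finsupp.add_apply, Finsupp.single_eq_of_ne hji, zero_add] at hj'

/-- The coefficient of a variable in a polynomial. -/
abbrev linearCoeff (l : Fin m) : MvPolynomial (Fin m) k →ₗ[k] k :=
  MvPolynomial.lcoeff k (Finsupp.single l 1)

/-- The linear coefficient is a derivation at the origin, so it vanishes on the square of the ideal
of the variables. -/
theorem linearCoeff_mul (l : Fin m) (p q : MvPolynomial (Fin m) k) :
    linearCoeff l (p * q) = MvPolynomial.constantCoeff p * linearCoeff l q +
      linearCoeff l p * MvPolynomial.constantCoeff q := by
  simp only [MvPolynomial.lcoeff_apply, MvPolynomial.coeff_mul, Finsupp.antidiagonal_single,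
    Finset.sum_map, MvPolynomial.constantCoeff_eq]
  simp [Finset.Nat.antidiagonal_succ]

theorem constantCoeff_eq_zero_of_mem {p : MvPolynomial (Fin m) k}
    (hp : p ∈ Ideal.span (Set.range (MvPolynomial.X : Fin m → MvPolynomial (Fin m) k))) :
    MvPolynomial.constantCoeff p = 0 := by
  rw [← RingHom.mem_ker]
  refine (Ideal.span_le.2 ?_ : _ ≤ RingHom.ker MvPolynomial.constantCoeff) hp
  rintro _ ⟨i, rfl⟩
  simp

theorem linearCoeff_eq_zero_of_mem_sq {p : MvPolynomial (Fin m) k}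
    (hp : p ∈ Ideal.span (Set.range (MvPolynomial.X : Fin m → MvPolynomial (Fin m) k)) ^ 2)
    (l : Fin m) : linearCoeff l p = 0 := by
  rw [sq] at hp
  refine Submodule.mul_induction_on hp (fun p hp q hq => ?_) fun p q hp hq => ?_
  · rw [linearCoeff_mul, constantCoeff_eq_zero_of_mem hp, constantCoeff_eq_zero_of_mem hq,
      zero_mul, mul_zero, add_zero]
  · rw [map_add, hp, hq, add_zero]

theorem exists_eq_single_of_degree_eq_one {α : Fin m →₀ ℕ} (hα : α.degree = 1) :
    ∃ l, α = Finsupp.single l 1 := by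
  obtain ⟨l, hl⟩ : ∃ l, α l ≠ 0 := by
    by_contra! h0
    rw [show α = 0 from Finsupp.ext h0] at hα
    simp at hα
  have h1 := degree_tsub_single_add hl
  have h2 : (α - Finsupp.single l 1).degree = 0 := by omega
  rw [Finsupp.degree_eq_zero_iff] at h2
  refine ⟨l, ?_⟩
  rw [← tsub_add_cancel_of_le (Finsupp.single_le_iff.2 (Nat.one_le_iff_ne_zero.2 hl)), h2, zero_add]

theorem eq_sum_of_isHomogeneous_one {p : MvPolynomial (Fin m) k} (hp : p.IsHomogeneous 1) :
    p = ∑ l, MvPolynomial.C (linearCoeff l p) * MvPolynomial.X l := by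
  ext α
  by_cases hα : α.degree = 1
  · obtain ⟨l, rfl⟩ := exists_eq_single_of_degree_eq_one hα
    rw [MvPolynomial.coeff_sum, Finset.sum_eq_single l]
    · simp
    · intro j _ hj
      rw [MvPolynomial.coeff_C_mul, MvPolynomial.coeff_X, if_neg, mul_zero]
      exact fun h => hj ((Finsupp.single_left_injective one_ne_zero) h)
    · simp
  · rw [hp.coeff_eq_zero hα, MvPolynomial.coeff_sum]
    refine (Finset.sum_eq_zero fun j _ => ?_).symm
    rw [MvPolynomial.coeff_C_mul, MvPolynomial.coeff_X, if_neg, mul_zero]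
    rintro rfl
    simp at hα

theorem irrelevantIdeal_quotientGrading (I : Ideal (MvPolynomial (Fin m) k)) :
    irrelevantIdeal (quotientGrading I) =
      (Ideal.span (Set.range (MvPolynomial.X : Fin m → MvPolynomial (Fin m) k))).map
        (Ideal.Quotient.mk I) := by
  refine le_antisymm (Ideal.span_le.2 ?_) ?_
  · rintro _ ⟨D, hD, p, hp, rfl⟩
    exact Ideal.mem_map_of_mem _ (mem_span_X_of_isHomogeneous hD hp)
  · rw [Ideal.map_le_iff_le_comap, Ideal.span_le]
    rintro _ ⟨i, rfl⟩
    exact Ideal.subset_span ⟨1, one_pos, _, MvPolynomial.isHomogeneous_X k i, rfl⟩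

/-- Homogeneous elements whose linear parts have an invertible coefficient matrix form an exact
Koszul complex. -/
theorem isKoszulExact_of_matrix {y : Fin m → MvPolynomial (Fin m) k} {A B : Matrix (Fin m) (Fin m) k}
    (hAB : A * B = 1) (hBA : B * A = 1)
    (hy : ∀ i, y i = ∑ l, MvPolynomial.C (A i l) * MvPolynomial.X l) : IsKoszulExact y := by
  have hcomp : ∀ {A B : Matrix (Fin m) (Fin m) k}, A * B = 1 →
      Matrix.toLin' (B.map (MvPolynomial.C (σ := Fin m))).transpose ∘ₗ
        Matrix.toLin' (A.map (MvPolynomial.C (σ := Fin m))).transpose = LinearMap.id :=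
    fun {A B} h => by
      rw [← Matrix.toLin'_mul, ← Matrix.transpose_mul, ← Matrix.map_mul, h,
        Matrix.map_one _ (map_zero _) (map_one _), Matrix.transpose_one, Matrix.toLin'_one]
  refine isKoszulExact_X.comp_equiv (LinearEquiv.ofLinearMap _ _ (hcomp hBA) (hcomp hAB)) ?_
  refine (Pi.basisFun _ (Fin m)).ext fun i => ?_
  rw [formOf_basisFun, hy, LinearMap.comp_apply]
  change formOf MvPolynomial.X (Matrix.toLin' (A.map MvPolynomial.C).transpose
    (Pi.basisFun _ (Fin m) i)) = _
  rw [Pi.basisFun_apply, Matrix.toLin'_apply, Matrix.mulVec_single_one]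
  simp [formOf, Fintype.linearCombination_apply]

/-- Minimal homogeneous generators of the quotient lift to homogeneous polynomials. Comparing linear
parts shows that these are an invertible linear change of the variables, so their Koszul complex is
exact. -/
theorem isGradedGolodRing_of_isRegular {F : Type v} [AddCommGroup F]
    [Module (MvPolynomial (Fin m) k) F] {f : Module.Basis (Fin n) (MvPolynomial (Fin m) k) F}
    {ψ : Module.Dual (MvPolynomial (Fin m) k) F}
    (hψ : ∀ j, ∃ D : ℕ, 0 < D ∧ (ψ (f j)).IsHomogeneous D)
    (hreg : RingTheory.Sequence.IsRegular (MvPolynomial (Fin m) k) (List.ofFn fun j => ψ (f j)))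
    (w : Fin n → ℕ) {d : ℕ} (hd : 2 ≤ d) :
    IsGradedGolodRing (quotientGrading (restrictedPower f ψ w d)) := by
  intro m' y hyD hy hm
  have ham : ∀ j, ψ (f j) ∈
      Ideal.span (Set.range (MvPolynomial.X : Fin m → MvPolynomial (Fin m) k)) := fun j => by
    obtain ⟨D, hD, hj⟩ := hψ j
    exact mem_span_X_of_isHomogeneous hD hj
  have hI := restrictedPower_le_sq ham w hd
  choose D hD y' hyh hy' using hyD
  obtain rfl : (fun i => Ideal.Quotient.mk (restrictedPower f ψ w d) (y' i)) = y := funext hy'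
  rw [irrelevantIdeal_quotientGrading] at hy hm
  have hspan : Ideal.span (Set.range y') ⊔ restrictedPower f ψ w d =
      Ideal.span (Set.range (MvPolynomial.X : Fin m → MvPolynomial (Fin m) k)) := by
    rw [show (fun i => Ideal.Quotient.mk (restrictedPower f ψ w d) (y' i)) =
      Ideal.Quotient.mk (restrictedPower f ψ w d) ∘ y' from rfl, Set.range_comp,
      ← Ideal.map_span] at hy
    have h1 := congrArg (Ideal.comap (Ideal.Quotient.mk (restrictedPower f ψ w d))) hy
    rwa [Ideal.comap_map_of_surjective _ Ideal.Quotient.mk_surjective,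
      Ideal.comap_map_of_surjective _ Ideal.Quotient.mk_surjective, ← RingHom.ker_eq_comap_bot,
      Ideal.mk_ker, sup_eq_left.2 (hI.trans (Ideal.pow_le_self two_ne_zero))] at h1
  have hle : m' ≤ m := by
    have h1 := Ideal.spanFinrank_map_le_of_fg (Ideal.Quotient.mk (restrictedPower f ψ w d))
      (IsNoetherian.noetherian
        (Ideal.span (Set.range (MvPolynomial.X : Fin m → MvPolynomial (Fin m) k))))
    have h2 := Submodule.spanFinrank_span_le_ncard_of_finite (R := MvPolynomial (Fin m) k)
      (Set.finite_range (MvPolynomial.X : Fin m → MvPolynomial (Fin m) k))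
    have h3 : (Set.range (MvPolynomial.X : Fin m → MvPolynomial (Fin m) k)).ncard ≤ m := by
      rw [← Set.image_univ]
      exact (Set.ncard_image_le Set.finite_univ).trans (by simp [Set.ncard_univ])
    exact (hm.trans_le h1).trans (h2.trans h3)
  let A : Matrix (Fin m') (Fin m) k := fun i l => linearCoeff l (y' i)
  have hX : ∀ j, ∃ c : Fin m' → MvPolynomial (Fin m) k, ∃ h ∈ restrictedPower f ψ w d,
      ∑ i, c i * y' i + h = MvPolynomial.X j := fun j => by
    have : MvPolynomial.X j ∈ Ideal.span (Set.range y') ⊔ restrictedPower f ψ w d :=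
      hspan ▸ Ideal.subset_span ⟨j, rfl⟩
    obtain ⟨p, hp, h, hh, hph⟩ := Submodule.mem_sup.1 this
    obtain ⟨c, rfl⟩ := Ideal.mem_span_range_iff_exists_fun.1 hp
    exact ⟨c, h, hh, hph⟩
  choose c h hh hch using hX
  let B : Matrix (Fin m) (Fin m') k := fun j i => MvPolynomial.constantCoeff (c j i)
  -- Linear coefficients of `X j = ∑ c j i * y' i + h`: the term `h` lies in the square and drops
  -- out, and only the constant terms of `c j i` count.
  have hBA : B * A = 1 := by
    ext j l
    have h1 := congrArg (linearCoeff l) (hch j)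
    rw [map_add, map_sum, linearCoeff_eq_zero_of_mem_sq (hI (hh j)), add_zero] at h1
    rw [Matrix.mul_apply]
    refine (Finset.sum_congr rfl fun i _ => ?_).trans (h1.trans ?_)
    · rw [linearCoeff_mul, constantCoeff_eq_zero_of_mem
        (mem_span_X_of_isHomogeneous (hD i) (hyh i)), mul_zero, add_zero]
    · rw [MvPolynomial.lcoeff_apply, MvPolynomial.coeff_X, Matrix.one_apply]
      simp only [Finsupp.single_left_inj one_ne_zero]
  have hge : m ≤ m' := by
    have h1 := B.rank_mul_le_left A
    rw [hBA, Matrix.rank_one, Fintype.card_fin] at h1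
    exact h1.trans (B.rank_le_card_width.trans_eq (Fintype.card_fin _))
  obtain rfl : m' = m := le_antisymm hle hge
  have hAB : A * B = 1 := mul_eq_one_comm.1 hBA
  -- A generator of another degree would give a zero row in the invertible matrix `A`.
  have hone : ∀ i, D i = 1 := fun i => by
    by_contra hne
    have h0 : ∀ l, A i l = 0 := fun l => (hyh i).coeff_eq_zero (by simpa using Ne.symm hne)
    have h1 := congrFun (congrFun hAB i) i
    rw [Matrix.mul_apply, Matrix.one_apply_eq] at h1
    simp [h0] at h1
  have hex : IsKoszulExact y' := isKoszulExact_of_matrix hAB hBA fun i =>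
    eq_sum_of_isHomogeneous_one (hone i ▸ hyh i)
  refine admitsTrivialMasseyOperation hex (isPermutablyRegular_of_isHomogeneous hψ hreg)
    (fun j => ?_) w hd
  have hXy : Ideal.span (Set.range (MvPolynomial.X : Fin m' → MvPolynomial (Fin m') k)) ≤
      Ideal.span (Set.range y') := by
    rw [Ideal.span_le]
    rintro _ ⟨j, rfl⟩
    have : (MvPolynomial.X j : MvPolynomial (Fin m') k) =
        ∑ i, MvPolynomial.C (B j i) * y' i := by
      have h1 : ∀ i, y' i = ∑ l, MvPolynomial.C (A i l) * MvPolynomial.X l := fun i =>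
        eq_sum_of_isHomogeneous_one (hone i ▸ hyh i)
      simp only [h1, Finset.mul_sum]
      rw [Finset.sum_comm]
      have h2 : ∀ l, ∑ i, MvPolynomial.C (B j i) * (MvPolynomial.C (A i l) *
          (MvPolynomial.X l : MvPolynomial (Fin m') k)) =
          MvPolynomial.C ((B * A) j l) * MvPolynomial.X l := fun l => by
        simp only [Matrix.mul_apply, map_sum, map_mul, Finset.sum_mul, mul_assoc]
      simp only [h2, hBA, Matrix.one_apply]
      simp
    rw [SetLike.mem_coe, this]
    exact sum_mem fun i _ => Ideal.mul_mem_left _ _ (Ideal.subset_span ⟨i, rfl⟩)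
  exact hXy (ham j)

end Polynomial

end RestrictedPower

end

open RestrictedPower in
theorem mainTheorem2 (n : ℕ) (w : Fin n → ℕ) (d : ℕ) (hd : 1 ≤ d) :
    -- `R` a regular local ring, `x` a minimal system of generators of its maximal ideal
    (∀ (R : Type u) [CommRing R] [IsRegularLocalRing R] (m : ℕ) (x : Fin m → R)
      (F : Type v) [AddCommGroup F] [Module R F] (f : Module.Basis (Fin n) R F)
      (ψ : Module.Dual R F),
      Ideal.span (Set.range x) = IsLocalRing.maximalIdeal R →
      (m : WithBot ℕ∞) = ringKrullDim R →
      RingTheory.Sequence.IsRegular R (List.ofFn fun j => ψ (f j)) →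
      KoszulHomologyDescription f ψ w d x ∧
      (2 ≤ d → IsGolodRing (R ⧸ restrictedPower f ψ w d))) ∧
    -- `R = k[X_1, …, X_m]` standard graded, `x` the variables
    (∀ (k : Type u) [Field k] (m : ℕ)
      (F : Type v) [AddCommGroup F] [Module (MvPolynomial (Fin m) k) F]
      (f : Module.Basis (Fin n) (MvPolynomial (Fin m) k) F)
      (ψ : Module.Dual (MvPolynomial (Fin m) k) F),
      (∀ j, ∃ D : ℕ, 0 < D ∧ (ψ (f j)).IsHomogeneous D) →
      RingTheory.Sequence.IsRegular (MvPolynomial (Fin m) k) (List.ofFn fun j => ψ (f j)) →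
      KoszulHomologyDescription f ψ w d (fun i : Fin m => (MvPolynomial.X i : MvPolynomial (Fin m) k)) ∧
      (2 ≤ d → IsGradedGolodRing (quotientGrading (restrictedPower f ψ w d)))) := by
  refine ⟨fun R _ _ m x F _ _ f ψ hx hm hψ => ⟨?_, isGolodRing_of_isRegularLocalRing hψ w⟩,
    fun k _ m F _ _ f ψ hψ hreg => ⟨?_, isGradedGolodRing_of_isRegular hψ hreg w⟩⟩
  · refine koszulHomologyDescription (isKoszulExact_of_le_ringKrullDim hx hm.le)
      (isPermutablyRegular_of_isRegular hψ) (fun j => ?_) w hd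
    rw [hx]
    exact mem_maximalIdeal_of_isRegular hψ j
  · refine koszulHomologyDescription isKoszulExact_X
      (isPermutablyRegular_of_isHomogeneous hψ hreg) (fun j => ?_) w hd
    obtain ⟨D, hD, hj⟩ := hψ j
    exact mem_span_X_of_isHomogeneous hD hj
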